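/- **Setting.** Time is measured in rounds; round $0$ is the end of the bootstrap phase. Let $V_r$ be the set of nodes present in round $r$. *Adversary:* in every round $r$ it chooses $V_r$ and the seeds of the new nodes, with immediate effect, as a function of all random bits used by the algorithm up to round $r-t$ ($t$-late omniscient). It must satisfy $n\le |V_r|\le fn$; in every window of at most $\tau$ rounds at most $\varepsilon n$ of the nodes present at its start are removed during the window, and at most $\varepsilon n$ of the nodes present at its end were not there throughout (churn rate $(\varepsilon n,\tau)$; a node that leaves and returns counts as new). Each node $u$ that is new in round $r$ is given the ID of one seed in $V_{r-1}\cap V_r$, and no node is the seed of more than $s$ new nodes in a round. *Spartan.* There are $N=k2^k$ committees $(\rho,c)$, $\rho\in\{0,1\}^k$, $c\in\mathbb Z/k$, forming a wrapped butterfly: logical edges join $(\rho,c)$ to $(\rho,c+1)$ and to $(\rho',c+1)$, where $\rho'$ differs from $\rho$ exactly in bit $c+1$ mod $k$. At round $0$ each node is in an independent uniformly random committee. Sampling cycle $\ell\ge1$ consists of rounds $(\ell-1)T+1,\dots,\ell T$. In each cycle (or in the bootstrap phase, for use in cycle $1$) the committees obtain samples by independent random walks: a walk makes $k$ steps, taking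 the straight or the cross edge with probability $\tfrac12$ each, and then goes to a uniformly random committee in the row it has reached. A sample consists of that committee and its member list at the end of the cycle; it is used in the next cycle. A committee has $Q$ samples per cycle; they are shared equally, and a member needs $1+sT$ of them (if the committee is too large for this, its members get none). At the start of every cycle, each member of a committee asks to move, with probability $p$ independently, and certainly if it has already stayed at $M$ starts of cycles; it uses one of its samples. A new node receives a sample from its seed in its first round and uses it in its second round. A request to join is accepted if some node of the sample's member list is still in the committee and stays there; otherwise the node is in no committee. Overlay edges join all pairs of nodes that are in the same committee or in committees joined by a logical edge, provided that neither of the two nodes needs more than its $\Delta$ ports. *Robustness.* A committee is robust until round $r$ if in every round $r'\le r$ it has at least $a\log n$ members and in any two consecutive rounds up to $r$ it has a common member. A logical edge is robust until round $r$ if both its committees are, and in every round $r'\le r$ all overlay edges between their members are present. Spartan is robust until round $r$ if all committees and logical edges are. It is *in order* until round $r$ if moreover, in every round up to $r$, every node from its second round on is in a committee. **Lemma.** Let $f\ge1$, let $s\ge1$ and $M\ge2$ be integers, $0<p<\tfrac12$, $0<b_1\le b_2$, $b_3>0$. There is $\varepsilon>0$ such that for all $c,q>0$ there is $K_0>0$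 such that for all $K_2\ge K_1\ge K_0$ there are $a,D,\kappa>0$ and $n_0$ with the following property. Let $n\ge n_0$, $K_1\log n\le n/(k2^k)\le K_2\log n$, $b_1\log\log n\le T\le b_2\log\log n$, $\tau\ge b_3\log\log n$, $t\ge(M+3)T$, $\Delta=\lceil D\log n\rceil$, $Q=\lceil\kappa\log n\log\log n\rceil$. Then for every finite universe of nodes, every such adversary and every $\ell\ge1$ there are random assignments $X_r$ of committees to the nodes, for the rounds $r$ of cycle $\ell$, such that 1. for each of these $r$, the committees $X_r(u)$ are uniformly distributed on the $N$ committees, independent over all nodes $u$, and jointly independent of everything that the adversary knows in round $r$; 2. conditionally on Spartan being in order until the start of cycle $\ell$ (round $(\ell-1)T$), with probability at least $1-n^{-c}$ Spartan is robust until the end of cycle $\ell$ (round $\ell T$), and in every round $r$ of cycle $\ell$ every node $u\in V_{r-1}\cap V_r$ is a member of the committee $X_r(u)$; 3. if $\ell\le n^q$, the same holds conditionally on Spartan being merely robust until the start of cycle $\ell$. -/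

import Mathlib

open MeasureTheory

namespace Spartan

noncomputable section

/-! ### The wrapped butterfly of committees -/

/-- The address of a committee: its row (one of the `2 ^ k` bit strings of length `k`) and its
column. There are `k * 2 ^ k` committees. -/
abbrev Committee (k : ℕ) := (Fin k → Bool) × Fin k

/-- One step of a walk on the wrapped butterfly: from column `c` to column `c + 1` (mod `k`), along
the straight edge if `b = false`, and along the cross edge, which changes bit `c + 1` (mod `k`) of
the row, if `b = true`. -/
def stepEdge {k : ℕ} [NeZero k] (C : Committee k) (b : Bool) : Committee k :=
  (if b then Function.update C.1 (C.2 + 1) (!C.1 (C.2 + 1)) else C.1, C.2 + 1)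

/-- The logical edges of the wrapped butterfly framework graph, directed from column `c` to
column `c + 1` (mod `k`). -/
def LogicalEdge {k : ℕ} [NeZero k] (C C' : Committee k) : Prop :=
  ∃ b, C' = stepEdge C b

/-- The random choices of a sampling token: one coin for each of its `k` steps through the
butterfly, and the column that it takes at the end of the walk. -/
abbrev Token (k : ℕ) := (Fin k → Bool) × Fin k

/-- The destination of a token launched in committee `C`: it makes `k` steps in the butterfly, each
along the straight or the cross edge according to its coin, and then it goes to a random committee
of the row which it has reached. -/
def Token.dst {k : ℕ} [NeZero k] (w : Token k) (C : Committee k) : Committee k :=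
  (((List.finRange k).foldl (fun D i => stepEdge D (w.1 i)) C).1, w.2)

/-! ### Parameters

Round `0` is the last round of the bootstrap phase, and sampling cycle `ℓ = 1, 2, …` consists of
the rounds `(ℓ - 1) * T + 1, …, ℓ * T`. Round `(ℓ - 1) * T` is the moment at which cycle `ℓ` starts
(and cycle `ℓ - 1` ends). -/

/-- The numerical parameters of the network, of the adversary and of the protocol. -/
structure Params where
  /-- the scale of the network size -/
  n : ℕ
  /-- the number of nodes is always in `[n, f * n]` -/
  f : ℝ
  /-- the churn rate is `(ε * n, τ)` -/
  ε : ℝ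
  /-- the length of the time window in the churn rate -/
  τ : ℕ
  /-- the adversary is `t`-late -/
  t : ℕ
  /-- no node is the seed of more than `s` new nodes in one round -/
  s : ℕ
  /-- the number of rounds in a sampling cycle -/
  T : ℕ
  /-- a node which has completed more than `M` sampling cycles in its committee must move -/
  M : ℕ
  /-- the number of samples that a committee obtains in one sampling cycle -/
  Q : ℕ
  /-- the number of ports of a node -/
  Δ : ℕ
  /-- a committee needs at least `a * log n` members -/
  a : ℝ

/-! ### Random bits -/

/-- All random bits of an execution. The components are
* the committee of each node at the end of the bootstrap phase;
* for each cycle `ℓ` and node `u`, the coin which tells `u` whether to move at the start of `ℓ`;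
* for each cycle `ℓ` and node `u`, the token that `u` uses for its own move at the start of `ℓ`;
* for each round `r`, node `v` and `i < s`, the token that `v` hands to the `i`-th new node that is
  seeded with `v` in round `r`.

Thus a node has at most `1 + s * T` tokens for each sampling cycle. -/
abbrev Bits (U : Type) (k s : ℕ) :=
  (U → Committee k) × (ℕ × U → Bool) × (ℕ × U → Token k) × (ℕ × U × Fin s → Token k)

section Bits

variable {U : Type} {k s : ℕ}

/-- The committee of `u` at the end of the bootstrap phase. -/
def Bits.init (ω : Bits U k s) (u : U) : Committee k := ω.1 u

/-- The coin of `u` at the start of cycle `ℓ`. -/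
def Bits.coin (ω : Bits U k s) (ℓ : ℕ) (u : U) : Bool := ω.2.1 (ℓ, u)

/-- The token for the own move of `u` at the start of cycle `ℓ`. -/
def Bits.own (ω : Bits U k s) (ℓ : ℕ) (u : U) : Token k := ω.2.2.1 (ℓ, u)

/-- The token that `v` hands to the `i`-th new node that it helps in round `r`. -/
def Bits.help (ω : Bits U k s) (r : ℕ) (v : U) (i : Fin s) : Token k := ω.2.2.2 (r, v, i)

/-- The law of the random bits: all of them are independent, the coins for moving are `true` with
probability `p`, and all the other choices are uniform. -/
def law (U : Type) [Fintype U] (k s : ℕ) [NeZero k] (p : unitInterval) : Measure (Bits U k s) :=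
  (Measure.pi fun _ : U => (PMF.uniformOfFintype (Committee k)).toMeasure).prod
    ((Measure.infinitePi fun _ : ℕ × U =>
        ProbabilityTheory.bernoulliMeasure true false p).prod
      ((Measure.infinitePi fun _ : ℕ × U => (PMF.uniformOfFintype (Token k)).toMeasure).prod
        (Measure.infinitePi fun _ : ℕ × U × Fin s =>
          (PMF.uniformOfFintype (Token k)).toMeasure)))

end Bits

/-- The sampling cycle that contains the round `r ≥ 1`. -/
def cycleOf (T r : ℕ) : ℕ := (r - 1) / T + 1

/-- The round in which the first bits of the tokens consumed in cycle `ℓ` are drawn: the first round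
of cycle `ℓ - 1`, and the bootstrap phase if `ℓ = 1`. -/
def drawRound (T ℓ : ℕ) : ℕ := if ℓ ≤ 1 then 0 else (ℓ - 2) * T + 1

/-- `ω` and `ω'` look the same to a `t`-late adversary in round `r`: they agree in every random bit
that is used by the algorithm in some round `≤ r - t`. -/
def SameView {U : Type} {k s : ℕ} (T t r : ℕ) (ω ω' : Bits U k s) : Prop :=
  (t ≤ r → ω.init = ω'.init) ∧
  (∀ ℓ, (ℓ - 1) * T + 1 + t ≤ r → ω.coin ℓ = ω'.coin ℓ) ∧
  (∀ ℓ, drawRound T ℓ + t ≤ r → ω.own ℓ = ω'.own ℓ) ∧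
  (∀ r', drawRound T (cycleOf T r') + t ≤ r → ω.help r' = ω'.help r')

/-! ### The adversary -/

/-- A `t`-late omniscient adversary with instantaneous actions and churn rate `(ε * n, τ)`. In every
round it chooses the set of nodes that are present and the seed of every new node. A node that
leaves and comes back counts as a new node. -/
structure Adversary (P : Params) (U : Type) [DecidableEq U] (k : ℕ) where
  /-- the set of nodes that are present in round `r` -/
  nodes : ℕ → Bits U k P.s → Finset U
  /-- `seed r ω u = (v, i)`: the new node `u` of round `r` knows the ID of `v`, and it is the `i`-th
  new node of round `r` with this seed -/
  seed : ℕ → Bits U k P.s → U → U × Fin P.s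
  nodes_late : ∀ r ω ω', SameView P.T P.t r ω ω' → nodes r ω = nodes r ω'
  seed_late : ∀ r ω ω', SameView P.T P.t r ω ω' → seed r ω = seed r ω'
  card_nodes : ∀ r ω, (P.n : ℝ) ≤ (nodes r ω).card ∧ ((nodes r ω).card : ℝ) ≤ P.f * P.n
  /-- in any window of `τ` rounds, all but `ε * n` of the nodes at its start are never removed in
  the window -/
  deleted : ∀ r ω, ∀ i ≤ P.τ,
    (((nodes r ω).filter fun u => ∃ j ≤ i, u ∉ nodes (r + j) ω).card : ℝ) ≤ P.ε * P.n
  /-- in any window of `τ` rounds, all but `ε * n` of the nodes at its end have been there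
  throughout the window -/
  added : ∀ r ω, ∀ i ≤ P.τ,
    (((nodes (r + i) ω).filter fun u => ∃ j ≤ i, u ∉ nodes (r + j) ω).card : ℝ) ≤ P.ε * P.n
  /-- the seed of a new node is a pre-existing node that is still there -/
  seed_mem : ∀ r ω, ∀ u ∈ nodes (r + 1) ω \ nodes r ω,
    (seed (r + 1) ω u).1 ∈ nodes r ω ∩ nodes (r + 1) ω
  seed_inj : ∀ r ω, Set.InjOn (seed (r + 1) ω) ↑(nodes (r + 1) ω \ nodes r ω)

/-! ### The maintenance protocol -/

/-- A sample: a committee, with a (possibly outdated) list of its members. -/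
abbrev Sample (U : Type) (k : ℕ) := Committee k × Finset U

/-- The state of a node. -/
structure NodeState (U : Type) (k : ℕ) where
  /-- the committee of the node, if there is one -/
  comm : Option (Committee k)
  /-- the number of starts of sampling cycles at which the node has stayed in this committee -/
  age : ℕ
  /-- the sample that a new node has received from its seed, to be used in its second round -/
  pending : Option (Sample U k)

/-- The state of the network in a round. -/
structure State (U : Type) (k : ℕ) where
  /-- the states of the nodes -/
  node : U → NodeState U k
  /-- the member lists which are contained in the samples that are consumed in the current cycle;
  they date from the end of the previous cycle -/
  lists : Committee k → Finset U

section Protocol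

open scoped Classical in
/-- The members of committee `C` among the present nodes `V`. -/
def members {U : Type} {k : ℕ} (V : Finset U) (node : U → NodeState U k) (C : Committee k) :
    Finset U :=
  V.filter fun u => (node u).comm = some C

/-- The samples of a cycle are shared out equally among the members `S` of a committee, each of
whom needs `1 + s * T` of them. -/
def Supplied {U : Type} (P : Params) (S : Finset U) : Prop := S.card * (1 + P.s * P.T) ≤ P.Q

variable {P : Params} {U : Type} [DecidableEq U] {k : ℕ} [NeZero k]

open scoped Classical in
/-- The sample with which `u` asks for admission to a committee in round `r + 1`, if it does so.
A node that was new in round `r` uses the sample of its seed. If round `r + 1` is the first one of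
cycle `ℓ = r / T + 1`, then a member of a committee moves if its coin says so or if it has been in
its committee for too long, and it uses a token launched in its present committee. -/
def request (A : Adversary P U k) (ω : Bits U k P.s) (r : ℕ) (σ : State U k) (u : U) :
    Option (Sample U k) :=
  match (σ.node u).pending, (σ.node u).comm with
  | some q, _ => some q
  | none, none => none
  | none, some C =>
      if P.T ∣ r ∧ (ω.coin (r / P.T + 1) u = true ∨ P.M ≤ (σ.node u).age) ∧
          Supplied P (members (A.nodes r ω) σ.node C) then
        some ((ω.own (r / P.T + 1) u).dst C, σ.lists ((ω.own (r / P.T + 1) u).dst C))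
      else none

/-- In round `r + 1`, the node `w` is still present and remains in its committee `C`. -/
def Remains (A : Adversary P U k) (ω : Bits U k P.s) (r : ℕ) (σ : State U k) (w : U)
    (C : Committee k) : Prop :=
  w ∈ A.nodes r ω ∧ w ∈ A.nodes (r + 1) ω ∧ (σ.node w).comm = some C ∧
    request A ω r σ w = none

open scoped Classical in
/-- The state in round `r + 1` of a node that is present in rounds `r` and `r + 1`. A request
for admission to a committee succeeds if some node of the member list in the sample is still in
the committee. -/
def stepOld (A : Adversary P U k) (ω : Bits U k P.s) (r : ℕ) (σ : State U k) (u : U) :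
    NodeState U k :=
  match request A ω r σ u with
  | some q => ⟨if ∃ w ∈ q.2, Remains A ω r σ w q.1 then some q.1 else none, 0, none⟩
  | none => ⟨(σ.node u).comm, if P.T ∣ r then (σ.node u).age + 1 else (σ.node u).age, none⟩

open scoped Classical in
/-- The state of a new node in its first round `r + 1`: it has no committee yet, and it has received
a sample from its seed. -/
def stepNew (A : Adversary P U k) (ω : Bits U k P.s) (r : ℕ) (σ : State U k) (u : U) :
    NodeState U k :=
  let v := (A.seed (r + 1) ω u).1
  let w := ω.help (r + 1) v (A.seed (r + 1) ω u).2
  ⟨none, 0,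
    match (stepOld A ω r σ v).comm with
    | some C =>
        if Supplied P (members (A.nodes r ω ∩ A.nodes (r + 1) ω) (stepOld A ω r σ) C) then
          some (w.dst C, σ.lists (w.dst C))
        else none
    | none => none⟩

open scoped Classical in
/-- One round of the protocol, from round `r` to round `r + 1`. -/
def step (A : Adversary P U k) (ω : Bits U k P.s) (r : ℕ) (σ : State U k) : State U k :=
  let node : U → NodeState U k := fun u =>
    if u ∈ A.nodes (r + 1) ω then
      if u ∈ A.nodes r ω then stepOld A ω r σ u else stepNew A ω r σ u
    else ⟨none, 0, none⟩
  ⟨node, if P.T ∣ r + 1 then members (A.nodes (r + 1) ω) node else σ.lists⟩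

open scoped Classical in
/-- The execution of the maintenance protocol. At the end of the bootstrap phase, every node is in
its random committee. -/
def run (A : Adversary P U k) (ω : Bits U k P.s) : ℕ → State U k
  | 0 =>
      let node : U → NodeState U k := fun u =>
        ⟨if u ∈ A.nodes 0 ω then some (ω.init u) else none, 0, none⟩
      ⟨node, members (A.nodes 0 ω) node⟩
  | r + 1 => step A ω r (run A ω r)

/-- The committee of `u` in round `r`. -/
def comm (A : Adversary P U k) (ω : Bits U k P.s) (r : ℕ) (u : U) : Option (Committee k) :=
  ((run A ω r).node u).comm

/-- The set of members of the committee `C` in round `r`. -/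
def CML (A : Adversary P U k) (ω : Bits U k P.s) (r : ℕ) (C : Committee k) : Finset U :=
  members (A.nodes r ω) (run A ω r).node C

/-! ### Overlay edges and robustness -/

/-- The protocol tries to maintain an overlay edge between `u` and `v` in round `r`: they are two
members of one committee or members of two committees that are joined by a logical edge. -/
def Wants (A : Adversary P U k) (ω : Bits U k P.s) (r : ℕ) (u v : U) : Prop :=
  u ≠ v ∧ ∃ C C', u ∈ CML A ω r C ∧ v ∈ CML A ω r C' ∧
    (C = C' ∨ LogicalEdge C C' ∨ LogicalEdge C' C)

open scoped Classical in
/-- The number of ports that `u` needs in round `r`. -/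
def demand (A : Adversary P U k) (ω : Bits U k P.s) (r : ℕ) (u : U) : ℕ :=
  ((A.nodes r ω).filter fun v => Wants A ω r u v).card

/-- There is an overlay edge between `u` and `v` in round `r`: the protocol wants it, and both nodes
have enough ports for all the edges that they need. -/
def Overlay (A : Adversary P U k) (ω : Bits U k P.s) (r : ℕ) (u v : U) : Prop :=
  Wants A ω r u v ∧ demand A ω r u ≤ P.Δ ∧ demand A ω r v ≤ P.Δ

/-- The committee `C` has been robust until round `r`. -/
def CommitteeRobust (A : Adversary P U k) (ω : Bits U k P.s) (r : ℕ) (C : Committee k) : Prop :=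
  (∀ r' ≤ r, P.a * Real.log P.n ≤ ((CML A ω r' C).card : ℝ)) ∧
  (∀ r' < r, (CML A ω r' C ∩ CML A ω (r' + 1) C).Nonempty)

/-- The logical edge between `C` and `C'` has been robust until round `r`. -/
def EdgeRobust (A : Adversary P U k) (ω : Bits U k P.s) (r : ℕ) (C C' : Committee k) : Prop :=
  CommitteeRobust A ω r C ∧ CommitteeRobust A ω r C' ∧
  ∀ r' ≤ r, ∀ u ∈ CML A ω r' C, ∀ v ∈ CML A ω r' C', Overlay A ω r' u v

/-- Spartan has been robust until round `r`: all committees and all logical edges have been. -/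
def Robust (A : Adversary P U k) (ω : Bits U k P.s) (r : ℕ) : Prop :=
  (∀ C : Committee k, CommitteeRobust A ω r C) ∧
  (∀ C C' : Committee k, LogicalEdge C C' → EdgeRobust A ω r C C')

/-- Until round `r`, every node has been in a committee from its second round on. -/
def Placed (A : Adversary P U k) (ω : Bits U k P.s) (r : ℕ) : Prop :=
  ∀ r' < r, ∀ u ∈ A.nodes r' ω ∩ A.nodes (r' + 1) ω, comm A ω (r' + 1) u ≠ none

/-- `X r ω` is, for every round `r` of cycle `ℓ`, an assignment of committees to the nodes that is
uniformly distributed, independent over the nodes, and independent of all that the late adversary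
knows in round `r`. -/
def IsUniformPlacement [Fintype U] (P : Params) (p : unitInterval) (ℓ : ℕ)
    (X : ℕ → Bits U k P.s → U → Committee k) : Prop :=
  ∀ r, (ℓ - 1) * P.T < r → r ≤ ℓ * P.T →
    Measurable (X r) ∧
    ∀ E : Set (Bits U k P.s), (∀ ω ω', SameView P.T P.t r ω ω' → (ω ∈ E ↔ ω' ∈ E)) →
      ∀ x : U → Committee k,
        (law U k P.s p).real (E ∩ {ω | X r ω = x}) =
          (law U k P.s p).real E * (1 / (k * 2 ^ k : ℝ)) ^ Fintype.card U

/-- In every round of cycle `ℓ`, each node that is not in its first round is in the committee that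
is given by `X`. -/
def Follows (A : Adversary P U k) (ω : Bits U k P.s) (ℓ : ℕ)
    (X : ℕ → Bits U k P.s → U → Committee k) : Prop :=
  ∀ r, (ℓ - 1) * P.T < r → r ≤ ℓ * P.T → ∀ u ∈ A.nodes (r - 1) ω ∩ A.nodes r ω,
    comm A ω r u = some (X r ω u)

end Protocol

end

end Spartan

/-!
The execution is compared with an *ideal process*, in which every request for admission succeeds
and no committee runs out of samples: `pos` is the committee of a node in it, and `age` counts the
starts of cycles at which the node has stayed there. The assignment `X` is `pos`.

*The ideal committees are uniform.* The destination of a random token is uniform wherever the token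
is launched (`dst_bijective`). Who moves, and who gets a token from whom, depends on the coins and
on what the adversary does, but not on the tokens themselves as long as the adversary has not seen
them. A node stays at no more than `M` starts of cycles, so each ideal committee in cycle `ℓ` comes
from a token consumed after the start of cycle `ℓ - M - 1` (`lt_refresh_add`) or from the bootstrap
phase, and an adversary that is `(M + 3) T`-late sees none of these tokens before the end of cycle
`ℓ`. Revealing the tokens block by block, where a block holds the tokens of all nodes for one
round, therefore shows that the ideal committees are uniform and independent, even given all coins
and all that happened before cycle `ℓ - M - 1` (`uniformOn_pos`, `law_real_pos`).

*The execution follows the ideal process.* The two agree as long as Spartan is in order, since then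
requests are accepted and the ports bound the committee sizes, so that samples suffice
(`InOrder.matches`). Agreement extends through cycle `ℓ` if no ideal committee becomes too large
and if every committee has enough nodes that stay in it during the cycles `ℓ - 1` and `ℓ`: every
member list in use contains such nodes, so requests are accepted (`comm_succ_ne_none`), and these
nodes alone make the committees robust (`inOrder_of_lively`). That ideal committees are not too
large is a Chernoff bound (`law_real_load_le`). For the nodes that stay, the ones counted move to
the committee at the start of cycle `ℓ - 2` and have coins that let them stay at the next two
starts; since `M ≥ 2` they are not forced to move. At least half of the nodes are present during
these cycles, by the churn rate, and their tokens and coins are unknown to the adversary throughout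
(`law_real_core_lt_of_old`).

*Conditioning.* The event that Spartan is in order until the start of cycle `ℓ` may be unlikely
when `ℓ` is large, and it is not independent of the tokens in use. But the bounds hold
conditionally on Spartan being in order until the start of cycle `ℓ - M - 1`, and by induction on
`ℓ` the latter event is at most twice as likely as the former, because `M + 1` cycles in a row
succeed with conditional probability at least `1 / 2` (`law_real_orderly`). The statement for
networks that are merely robust follows from the unconditional bound `1 - ℓ δ` for the probability
that Spartan is in order until the start of cycle `ℓ`, where `δ` bounds the failure probability of
one cycle (`cond_law_real`).
-/

open MeasureTheory

namespace Spartan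

noncomputable section

/-! ### Blocks of random bits and independence -/

section Blocks

open scoped Classical in
/-- Replacing the coordinates in `J` of a random family by those of an independent copy preserves
the law of the family. -/
lemma measurePreserving_piecewise {ι : Type*} {X : ι → Type*} [∀ i, MeasurableSpace (X i)]
    (μ : ∀ i, Measure (X i)) [∀ i, IsProbabilityMeasure (μ i)] (J : Set ι) :
    MeasurePreserving (fun z : (∀ i, X i) × (∀ i, X i) => fun i => if i ∈ J then z.2 i else z.1 i)
      ((Measure.infinitePi μ).prod (Measure.infinitePi μ)) (Measure.infinitePi μ) := by
  have hm : Measurable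
      (fun z : (∀ i, X i) × (∀ i, X i) => fun i => if i ∈ J then z.2 i else z.1 i) := by
    refine measurable_pi_lambda _ fun i => ?_
    by_cases h : i ∈ J <;> simp only [h, if_true, if_false] <;> fun_prop
  refine ⟨hm, Measure.eq_infinitePi μ fun s t ht => ?_⟩
  rw [Measure.map_apply hm (.pi s.countable_toSet fun i _ => ht i)]
  have : (fun z : (∀ i, X i) × (∀ i, X i) => fun i => if i ∈ J then z.2 i else z.1 i) ⁻¹'
      (Set.pi s t) = (Set.pi ↑(s.filter (· ∉ J)) t) ×ˢ (Set.pi ↑(s.filter (· ∈ J)) t) := by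
    ext z
    simp only [Set.mem_preimage, Set.mem_pi, Set.mem_prod, Finset.coe_filter, Set.mem_ofPred_eq,
      Finset.mem_coe]
    constructor
    · exact fun h => ⟨fun i hi => by simpa [hi.2] using h i hi.1,
        fun i hi => by simpa [hi.2] using h i hi.1⟩
    · intro h i hi
      by_cases hJ : i ∈ J
      · simpa [hJ] using h.2 i ⟨hi, hJ⟩
      · simpa [hJ] using h.1 i ⟨hi, hJ⟩
  rw [this, Measure.prod_prod, Measure.infinitePi_pi _ fun i _ => ht i,
    Measure.infinitePi_pi _ fun i _ => ht i, mul_comm, Finset.prod_filter_mul_prod_filter_not]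

lemma measurePreserving_prodMap_shuffle {α β : Type*} [MeasurableSpace α] [MeasurableSpace β]
    {μ : Measure α} {ν : Measure β} [SFinite μ] [SFinite ν] {f : α × α → α}
    {g : β × β → β} (hf : MeasurePreserving f (μ.prod μ) μ)
    (hg : MeasurePreserving g (ν.prod ν) ν) :
    MeasurePreserving
      (fun z : (α × β) × (α × β) => (f (z.1.1, z.2.1), g (z.1.2, z.2.2)))
      ((μ.prod ν).prod (μ.prod ν)) (μ.prod ν) := by
  have h1 : MeasurePreserving (fun z : (α × β) × (α × β) => ((z.1.1, z.2.1), (z.1.2, z.2.2)))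
      ((μ.prod ν).prod (μ.prod ν)) ((μ.prod μ).prod (ν.prod ν)) := by
    have a1 := measurePreserving_prodAssoc μ ν (μ.prod ν)
    have a2 := (MeasurePreserving.id μ).prod ((measurePreserving_prodAssoc ν μ ν).symm
      MeasurableEquiv.prodAssoc)
    have a3 := (MeasurePreserving.id μ).prod
      ((Measure.measurePreserving_swap (μ := ν) (ν := μ)).prod (MeasurePreserving.id ν))
    have a4 := (MeasurePreserving.id μ).prod (measurePreserving_prodAssoc μ ν ν)
    have a5 := (measurePreserving_prodAssoc μ μ (ν.prod ν)).symm MeasurableEquiv.prodAssoc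
    exact a5.comp (a4.comp (a3.comp (a2.comp a1)))
  exact (hf.prod hg).comp h1

/-- The random bits come in blocks, which are revealed as a whole: the committees at the end of the
bootstrap phase, the coins of a cycle, the tokens for the own moves at the start of a cycle, and the
tokens handed to new nodes in a round. -/
inductive Block
  | init
  | coin (ℓ : ℕ)
  | own (ℓ : ℕ)
  | help (r : ℕ)

variable {U : Type} {k s : ℕ}

/-- `ω` and `ω'` agree in the bits of a block. -/
def AgreeAt : Block → Bits U k s → Bits U k s → Prop
  | .init, ω, ω' => ω.init = ω'.init
  | .coin ℓ, ω, ω' => ω.coin ℓ = ω'.coin ℓ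
  | .own ℓ, ω, ω' => ω.own ℓ = ω'.own ℓ
  | .help r, ω, ω' => ω.help r = ω'.help r

/-- `F` depends only on the bits in the blocks of `I`. Events are treated as functions with values
in `Prop`. -/
def Determined (I : Set Block) {α : Sort*} (F : Bits U k s → α) : Prop :=
  ∀ ω ω', (∀ b ∈ I, AgreeAt b ω ω') → F ω = F ω'

lemma Determined.mono {I J : Set Block} (h : I ⊆ J) {α : Sort*} {F : Bits U k s → α}
    (hF : Determined I F) : Determined J F :=
  fun ω ω' hω => hF ω ω' fun b hb => hω b (h hb)

lemma Determined.comp {I : Set Block} {α β : Sort*} {F : Bits U k s → α}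
    (hF : Determined I F) (G : α → β) : Determined I fun ω => G (F ω) :=
  fun ω ω' hω => congrArg G (hF ω ω' hω)

lemma Determined.comp₂ {I : Set Block} {α β γ : Sort*} {F : Bits U k s → α} {F' : Bits U k s → β}
    (hF : Determined I F) (hF' : Determined I F') (G : α → β → γ) :
    Determined I fun ω => G (F ω) (F' ω) :=
  fun ω ω' hω => by simp only [hF ω ω' hω, hF' ω ω' hω]

lemma Determined.forall {I : Set Block} {ι : Sort*} {F : ι → Bits U k s → Prop}
    (hF : ∀ i, Determined I (F i)) : Determined I fun ω => ∀ i, F i ω :=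
  fun ω ω' hω => by simp only [fun i => hF i ω ω' hω]

lemma determined_const (I : Set Block) {α : Sort*} (a : α) :
    Determined I fun _ : Bits U k s => a :=
  fun _ _ _ => rfl

lemma determined_init : Determined {Block.init} (Bits.init : Bits U k s → _) :=
  fun _ _ h => h _ rfl

lemma determined_coin (ℓ : ℕ) :
    Determined {Block.coin ℓ} (fun ω : Bits U k s => ω.coin ℓ) :=
  fun _ _ h => h _ rfl

lemma determined_own (ℓ : ℕ) :
    Determined {Block.own ℓ} (fun ω : Bits U k s => ω.own ℓ) :=
  fun _ _ h => h _ rfl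

lemma determined_help (r : ℕ) :
    Determined {Block.help r} (fun ω : Bits U k s => ω.help r) :=
  fun _ _ h => h _ rfl

open scoped Classical in
/-- The bits of `z.2` in the blocks of `J`, and the bits of `z.1` in the other blocks. -/
def mix (J : Set Block) (z : Bits U k s × Bits U k s) : Bits U k s :=
  (if .init ∈ J then z.2.1 else z.1.1,
    fun x => if .coin x.1 ∈ J then z.2.2.1 x else z.1.2.1 x,
    fun x => if .own x.1 ∈ J then z.2.2.2.1 x else z.1.2.2.1 x,
    fun x => if .help x.1 ∈ J then z.2.2.2.2 x else z.1.2.2.2 x)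

lemma agreeAt_mix_of_mem {J : Set Block} {b : Block} (h : b ∈ J) (z : Bits U k s × Bits U k s) :
    AgreeAt b (mix J z) z.2 := by
  cases b <;> simp [AgreeAt, mix, Bits.init, Bits.coin, Bits.own, Bits.help, funext_iff, h]

lemma agreeAt_mix_of_notMem {J : Set Block} {b : Block} (h : b ∉ J)
    (z : Bits U k s × Bits U k s) : AgreeAt b (mix J z) z.1 := by
  cases b <;> simp [AgreeAt, mix, Bits.init, Bits.coin, Bits.own, Bits.help, funext_iff, h]

variable [Fintype U] [NeZero k] {p : unitInterval}

instance : IsProbabilityMeasure (law U k s p) := by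
  unfold law; infer_instance

/-- Resampling the bits in the blocks of `J` preserves the law. -/
lemma measurePreserving_mix (J : Set Block) :
    MeasurePreserving (mix J) ((law U k s p).prod (law U k s p)) (law U k s p) := by
  have h₁ := measurePreserving_piecewise
    (fun _ : ℕ × U × Fin s => (PMF.uniformOfFintype (Token k)).toMeasure)
    {x | Block.help x.1 ∈ J}
  have h₂ := measurePreserving_piecewise
    (fun _ : ℕ × U => (PMF.uniformOfFintype (Token k)).toMeasure) {x | Block.own x.1 ∈ J}
  have h₃ := measurePreserving_piecewise
    (fun _ : ℕ × U => ProbabilityTheory.bernoulliMeasure true false p) {x | Block.coin x.1 ∈ J}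
  have h₄ : MeasurePreserving
      (fun z : (U → Committee k) × (U → Committee k) =>
        open scoped Classical in if Block.init ∈ J then z.2 else z.1)
      ((Measure.pi fun _ : U => (PMF.uniformOfFintype (Committee k)).toMeasure).prod
        (Measure.pi fun _ : U => (PMF.uniformOfFintype (Committee k)).toMeasure))
      (Measure.pi fun _ : U => (PMF.uniformOfFintype (Committee k)).toMeasure) := by
    by_cases h : Block.init ∈ J
    · simpa [h] using measurePreserving_snd
    · simpa [h] using measurePreserving_fst
  exact measurePreserving_prodMap_shuffle h₄
    (measurePreserving_prodMap_shuffle h₃ (measurePreserving_prodMap_shuffle h₂ h₁))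

/-- The blocks with an index below `R`. -/
def below (R : ℕ) : Set Block :=
  {b | match b with
    | .init => True
    | .coin ℓ => ℓ < R
    | .own ℓ => ℓ < R
    | .help r => r < R}

lemma below_mono {R R' : ℕ} (h : R ≤ R') : below R ⊆ below R' := by
  rintro (_ | i | i | i) hb
  · trivial
  all_goals exact lt_of_lt_of_le (α := ℕ) hb h

/-- A function of finitely many of the bits is measurable. -/
lemma Determined.measurable {R : ℕ} {α : Type*} [MeasurableSpace α] {F : Bits U k s → α}
    (hF : Determined (below R) F) : Measurable F := by
  let ρ : Bits U k s → (U → Committee k) × (Fin R × U → Bool) × (Fin R × U → Token k) ×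
      (Fin R × U × Fin s → Token k) := fun ω =>
    (ω.1, fun x => ω.2.1 (x.1, x.2), fun x => ω.2.2.1 (x.1, x.2), fun x => ω.2.2.2 (x.1, x.2))
  let e : (U → Committee k) × (Fin R × U → Bool) × (Fin R × U → Token k) ×
      (Fin R × U × Fin s → Token k) → Bits U k s := fun y =>
    (y.1, fun x => if h : x.1 < R then y.2.1 (⟨x.1, h⟩, x.2) else default,
      fun x => if h : x.1 < R then y.2.2.1 (⟨x.1, h⟩, x.2) else default,
      fun x => if h : x.1 < R then y.2.2.2 (⟨x.1, h⟩, x.2) else default)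
  have hρ : Measurable ρ := by fun_prop
  have hFe : F = (F ∘ e) ∘ ρ := by
    funext ω
    refine hF _ _ fun b hb => ?_
    cases b <;> simp only [below, Set.mem_ofPred_eq] at hb <;>
      simp [AgreeAt, e, ρ, Bits.init, Bits.coin, Bits.own, Bits.help, funext_iff, hb]
  rw [hFe]
  exact (Measurable.of_discrete (f := F ∘ e)).comp hρ

lemma Determined.measurableSet {R : ℕ} {B : Set (Bits U k s)}
    (hB : Determined (below R) (· ∈ B)) : MeasurableSet B :=
  measurableSet_setOfPred.mpr hB.measurable

/-- Events that depend on disjoint sets of blocks are independent. -/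
lemma Determined.indep {I J : Set Block} {R : ℕ} {A B : Set (Bits U k s)}
    (hA : Determined I (· ∈ A)) (hB : Determined J (· ∈ B)) (hIJ : Disjoint I J)
    (hI : I ⊆ below R) (hJ : J ⊆ below R) :
    (law U k s p).real (A ∩ B) = (law U k s p).real A * (law U k s p).real B := by
  have hAm := (hA.mono hI).measurableSet
  have hBm := (hB.mono hJ).measurableSet
  have := (measurePreserving_mix (p := p) J).measure_preimage (hAm.inter hBm).nullMeasurableSet
  have h2 : mix J ⁻¹' (A ∩ B) = A ×ˢ B := by
    ext z
    have h3 : (mix J z ∈ A) = (z.1 ∈ A) := hA _ _ fun b hb =>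
      agreeAt_mix_of_notMem (Set.disjoint_left.mp hIJ hb) z
    have h4 : (mix J z ∈ B) = (z.2 ∈ B) := hB _ _ fun b hb => agreeAt_mix_of_mem hb z
    simp [h3, h4]
  rw [h2, Measure.prod_prod] at this
  simp [Measure.real, ← this]

end Blocks

/-! ### Cylinder events -/

section Cylinder

lemma infinitePi_real_cylinder {ι V Y : Type*} [MeasurableSpace Y] (μ : Measure Y)
    [IsProbabilityMeasure μ] (S : Finset V) {e : V → ι} (he : Set.InjOn e S) {A : V → Set Y}
    (hA : ∀ v, MeasurableSet (A v)) :
    (Measure.infinitePi fun _ : ι => μ).real {x | ∀ v ∈ S, x (e v) ∈ A v} =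
      ∏ v ∈ S, μ.real (A v) := by
  classical
  have ht : ∀ i, MeasurableSet (⋂ v ∈ S.filter (e · = i), A v) := fun i =>
    Finset.measurableSet_biInter _ fun v _ => hA v
  have h1 : {x : ι → Y | ∀ v ∈ S, x (e v) ∈ A v} =
      Set.pi ↑(S.image e) fun i => ⋂ v ∈ S.filter (e · = i), A v := by
    ext x
    simp only [Set.mem_ofPred_eq, Finset.coe_image, Set.mem_pi, Set.mem_image, Finset.mem_coe,
      Set.mem_iInter, Finset.mem_filter]
    constructor
    · rintro h _ ⟨v, -, rfl⟩ w ⟨hw, hwv⟩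
      exact hwv ▸ h w hw
    · exact fun h v hv => h _ ⟨v, hv, rfl⟩ v ⟨hv, rfl⟩
  rw [h1, Measure.real, Measure.infinitePi_pi _ fun i _ => ht i, Finset.prod_image he,
    ENNReal.toReal_prod]
  refine Finset.prod_congr rfl fun v hv => ?_
  have : S.filter (e · = e v) = {v} := by
    ext w
    simp only [Finset.mem_filter, Finset.mem_singleton]
    exact ⟨fun h => he h.1 hv h.2, by rintro rfl; exact ⟨hv, rfl⟩⟩
  simp [this, Measure.real]

lemma uniformOfFintype_real_singleton {Y : Type*} [Fintype Y] [Nonempty Y] [MeasurableSpace Y]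
    [MeasurableSingletonClass Y] (y : Y) :
    (PMF.uniformOfFintype Y).toMeasure.real {y} = 1 / Fintype.card Y := by
  simp [Measure.real, PMF.toMeasure_apply_singleton _ _ (measurableSet_singleton y)]

lemma card_committee (k : ℕ) : (Fintype.card (Committee k) : ℝ) = k * 2 ^ k := by
  simp [Committee, mul_comm]

variable {U : Type} {k s : ℕ} [Fintype U] [NeZero k] {p : unitInterval}

lemma law_real_init (S : Finset U) (g : U → Committee k) :
    (law U k s p).real {ω | ∀ u ∈ S, ω.init u = g u} = (1 / (k * 2 ^ k : ℝ)) ^ S.card := by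
  have h := infinitePi_real_cylinder (PMF.uniformOfFintype (Committee k)).toMeasure S
    (e := id) (Set.injOn_id _) (A := fun u => {g u}) fun _ => measurableSet_singleton _
  simp only [uniformOfFintype_real_singleton, Finset.prod_const, card_committee] at h
  rw [← h, Measure.infinitePi_eq_pi]
  have : {ω : Bits U k s | ∀ u ∈ S, ω.init u = g u} =
      {x | ∀ u ∈ S, x (id u) ∈ ({g u} : Set (Committee k))} ×ˢ Set.univ := by
    ext ω; simp [Bits.init]
  rw [this, Measure.real, law, Measure.prod_prod]
  simp [Measure.real]

lemma law_real_coin (ℓ : ℕ) (S : Finset U) (b : Bool) :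
    (law U k s p).real {ω | ∀ u ∈ S, ω.coin ℓ u = b} =
      (if b then (p : ℝ) else 1 - p) ^ S.card := by
  have h := infinitePi_real_cylinder (ProbabilityTheory.bernoulliMeasure true false p) S
    (e := fun u => (ℓ, u)) (fun _ _ _ _ h => (Prod.ext_iff.mp h).2) (A := fun _ => {b})
    fun _ => measurableSet_singleton _
  have hb : (ProbabilityTheory.bernoulliMeasure true false p).real {b} =
      if b then (p : ℝ) else 1 - p := by
    rw [ProbabilityTheory.bernoulliMeasure_real_apply p (measurableSet_singleton _)]
    cases b <;> simp
  simp only [hb, Finset.prod_const] at h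
  rw [← h]
  have : {ω : Bits U k s | ∀ u ∈ S, ω.coin ℓ u = b} = Set.univ ×ˢ
      ({x | ∀ u ∈ S, x (ℓ, u) ∈ ({b} : Set Bool)} ×ˢ Set.univ) := by
    ext ω; simp [Bits.coin]
  rw [this, Measure.real, law, Measure.prod_prod, Measure.prod_prod]
  simp [Measure.real]

lemma law_real_own (ℓ : ℕ) (S : Finset U) (g : U → Token k) :
    (law U k s p).real {ω | ∀ u ∈ S, ω.own ℓ u = g u} = (1 / (k * 2 ^ k : ℝ)) ^ S.card := by
  have h := infinitePi_real_cylinder (PMF.uniformOfFintype (Token k)).toMeasure S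
    (e := fun u => (ℓ, u)) (fun _ _ _ _ h => (Prod.ext_iff.mp h).2) (A := fun u => {g u})
    fun _ => measurableSet_singleton _
  simp only [uniformOfFintype_real_singleton, Finset.prod_const] at h
  rw [← card_committee, show Fintype.card (Committee k) = Fintype.card (Token k) from rfl, ← h]
  have : {ω : Bits U k s | ∀ u ∈ S, ω.own ℓ u = g u} = Set.univ ×ˢ (Set.univ ×ˢ
      ({x | ∀ u ∈ S, x (ℓ, u) ∈ ({g u} : Set (Token k))} ×ˢ Set.univ)) := by
    ext ω; simp [Bits.own]
  rw [this, Measure.real, law, Measure.prod_prod, Measure.prod_prod, Measure.prod_prod]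
  simp [Measure.real]

lemma law_real_help (r : ℕ) (S : Finset U) {e : U → U × Fin s} (he : Set.InjOn e S)
    (g : U → Token k) :
    (law U k s p).real {ω | ∀ u ∈ S, ω.help r (e u).1 (e u).2 = g u} =
      (1 / (k * 2 ^ k : ℝ)) ^ S.card := by
  have h := infinitePi_real_cylinder (PMF.uniformOfFintype (Token k)).toMeasure S
    (e := fun u => (r, e u)) (fun _ hu _ hv h => he hu hv (Prod.ext_iff.mp h).2)
    (A := fun u => {g u}) fun _ => measurableSet_singleton _
  simp only [uniformOfFintype_real_singleton, Finset.prod_const] at h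
  rw [← card_committee, show Fintype.card (Committee k) = Fintype.card (Token k) from rfl, ← h]
  have : {ω : Bits U k s | ∀ u ∈ S, ω.help r (e u).1 (e u).2 = g u} = Set.univ ×ˢ (Set.univ ×ˢ
      (Set.univ ×ˢ {x | ∀ u ∈ S, x (r, e u) ∈ ({g u} : Set (Token k))})) := by
    ext ω; simp [Bits.help]
  rw [this, Measure.real, law, Measure.prod_prod, Measure.prod_prod, Measure.prod_prod]
  simp [Measure.real]

end Cylinder

/-! ### The destination of a token -/

section Destination

variable {k : ℕ} [NeZero k]

/-- A walk of fewer than `k - d` steps that starts in column `c` does not touch bit `c - d`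
(mod `k`). -/
lemma foldl_stepEdge_apply_of_lt (l : List Bool) (C : Committee k) (j : Fin k) (d : ℕ)
    (hj : j.val + d = C.2.val ∨ j.val + d = C.2.val + k) (hd : l.length + d < k) :
    (l.foldl stepEdge C).1 j = C.1 j := by
  induction l generalizing C d with
  | nil => rfl
  | cons b l ih =>
    simp only [List.length_cons] at hd
    have hv : (C.2 + 1).val = if C.2.val + 1 = k then 0 else C.2.val + 1 := by
      have hk1 : 1 < k := by omega
      have := C.2.isLt
      rw [Fin.val_add, Fin.val_one', Nat.mod_eq_of_lt hk1]
      split_ifs with h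
      · simp [h]
      · exact Nat.mod_eq_of_lt (by omega)
    have hlt := C.2.isLt
    have hlj := j.isLt
    rw [List.foldl_cons, ih (stepEdge C b) (d + 1) ?_ (by omega)]
    · have : j ≠ C.2 + 1 := fun h => by
        rw [h, hv] at hj
        split_ifs at hj <;> omega
      simp only [stepEdge]
      split_ifs <;> simp [this]
    · simp only [stepEdge, hv]
      split_ifs <;> omega

lemma foldl_stepEdge_injective (l l' : List Bool) (C : Committee k) (hl : l.length = l'.length)
    (hk : l.length ≤ k) (h : (l.foldl stepEdge C).1 = (l'.foldl stepEdge C).1) : l = l' := by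
  induction l generalizing l' C with
  | nil => exact (List.length_eq_zero_iff.mp hl.symm).symm
  | cons b l ih =>
    obtain _ | ⟨b', l'⟩ := l'
    · simp at hl
    · simp only [List.length_cons, add_left_inj] at hl hk
      simp only [List.foldl_cons] at h
      -- the bit flipped by the first step is not touched by the later ones
      have h1 := congrFun h (C.2 + 1)
      rw [foldl_stepEdge_apply_of_lt l _ (C.2 + 1) 0 (.inl rfl) (by omega),
        foldl_stepEdge_apply_of_lt l' _ (C.2 + 1) 0 (.inl rfl) (by omega)] at h1
      have hb : b = b' := by
        cases b <;> cases b' <;> simp [stepEdge] at h1 ⊢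
      subst hb
      rw [ih l' _ hl (by omega) h]

/-- The destination of a uniformly random token is uniformly distributed, wherever the token is
launched: the coins of the walk determine the row that it reaches, and vice versa. -/
lemma dst_bijective (C : Committee k) : Function.Bijective fun w : Token k => w.dst C := by
  refine (Fintype.bijective_iff_injective_and_card _).mpr ⟨fun w w' h => ?_, rfl⟩
  simp only [Token.dst, Prod.mk.injEq] at h
  have hf : ∀ g : Fin k → Bool, (List.finRange k).foldl (fun D i => stepEdge D (g i)) C =
      ((List.finRange k).map g).foldl stepEdge C := fun g => by rw [List.foldl_map]
  rw [hf, hf] at h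
  have h2 := foldl_stepEdge_injective _ _ C (by simp) (by simp) h.1
  refine Prod.ext (funext fun i => ?_) h.2
  exact List.map_inj_left.mp h2 i (List.mem_finRange i)

/-- The token that leads from `C` to `C'`. -/
def tokenTo (C C' : Committee k) : Token k :=
  Function.surjInv (dst_bijective C).surjective C'

lemma dst_eq_iff (w : Token k) (C C' : Committee k) : w.dst C = C' ↔ w = tokenTo C C' := by
  have h : (tokenTo C C').dst C = C' := Function.surjInv_eq (dst_bijective C).surjective C'
  exact ⟨fun hw => (dst_bijective C).injective (hw.trans h.symm), fun hw => hw ▸ h⟩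

end Destination

/-! ### Finite decompositions and an exponential tail bound -/

section Tail

variable {Ω : Type*} [MeasurableSpace Ω] {μ : Measure Ω} [IsFiniteMeasure μ]

lemma measureReal_eq_sum_fiber {β : Type*} [Fintype β] (A : Set Ω) (Z : Ω → β)
    (hZ : ∀ z, MeasurableSet {ω | Z ω = z}) :
    μ.real A = ∑ z, μ.real (A ∩ {ω | Z ω = z}) := by
  classical
  have h := sum_measureReal_preimage_singleton (μ := μ.restrict A) (Finset.univ : Finset β)
    (f := Z) fun z _ => hZ z
  simp only [Finset.coe_univ, Set.preimage_univ, measureReal_restrict_apply_univ] at h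
  rw [← h]
  refine Finset.sum_congr rfl fun z _ => ?_
  rw [Set.inter_comm]
  exact measureReal_restrict_apply (hZ z)

lemma measureReal_eq_of_fiber {β : Type*} [Fintype β] {A B : Set Ω} {Z : Ω → β} {q : ℝ}
    (hZ : ∀ z, MeasurableSet {ω | Z ω = z})
    (h : ∀ z, μ.real (A ∩ {ω | Z ω = z}) = μ.real (B ∩ {ω | Z ω = z}) * q) :
    μ.real A = μ.real B * q := by
  rw [measureReal_eq_sum_fiber A Z hZ, measureReal_eq_sum_fiber B Z hZ, Finset.sum_mul]
  exact Finset.sum_congr rfl fun z _ => h z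

lemma measureReal_le_of_fiber {β : Type*} [Fintype β] {A B : Set Ω} {Z : Ω → β} {q : ℝ}
    (hZ : ∀ z, MeasurableSet {ω | Z ω = z})
    (h : ∀ z, μ.real (A ∩ {ω | Z ω = z}) ≤ μ.real (B ∩ {ω | Z ω = z}) * q) :
    μ.real A ≤ μ.real B * q := by
  rw [measureReal_eq_sum_fiber A Z hZ, measureReal_eq_sum_fiber B Z hZ, Finset.sum_mul]
  exact Finset.sum_le_sum fun z _ => h z

/-- If any `j` of the events `E u` happen jointly with conditional probability `q ^ j` given `B`,
then their number has the generating function of a binomial distribution. -/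
lemma integral_pow_card_filter {V : Type*} {B : Set Ω} (A : Finset V) {E : V → Set Ω}
    [∀ ω, DecidablePred (ω ∈ E ·)] {q : ℝ}
    (hE : ∀ v, MeasurableSet (E v))
    (h : ∀ S ⊆ A, μ.real (B ∩ {ω | ∀ v ∈ S, ω ∈ E v}) = μ.real B * q ^ S.card) (z : ℝ) :
    ∫ ω in B, z ^ (A.filter (ω ∈ E ·)).card ∂μ = μ.real B * (1 + q * (z - 1)) ^ A.card := by
  have hm : ∀ S : Finset V, MeasurableSet {ω | ∀ v ∈ S, ω ∈ E v} := fun S => by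
    have : {ω | ∀ v ∈ S, ω ∈ E v} = ⋂ v ∈ S, E v := by ext; simp
    exact this ▸ Finset.measurableSet_biInter S fun v _ => hE v
  have h1 : ∀ ω, z ^ (A.filter (ω ∈ E ·)).card = ∑ S ∈ A.powerset,
      ({ω | ∀ v ∈ S, ω ∈ E v}.indicator (fun _ => (z - 1) ^ S.card) ω : ℝ) := fun ω => by
    have h2 := Finset.sum_pow_mul_eq_add_pow (z - 1) 1 (A.filter (ω ∈ E ·))
    simp only [one_pow, mul_one, sub_add_cancel] at h2
    rw [← h2]
    simp only [Set.indicator_apply, Set.mem_ofPred_eq]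
    rw [← Finset.sum_filter]
    refine Finset.sum_congr ?_ fun _ _ => rfl
    ext S
    simp only [Finset.mem_powerset, Finset.mem_filter, Finset.subset_iff]
    grind
  simp only [h1]
  rw [integral_finsetSum _ fun S _ => (integrable_const _).indicator (hm S)]
  have h3 : ∀ S ∈ A.powerset, ∫ ω in B,
      ({ω | ∀ v ∈ S, ω ∈ E v}.indicator (fun _ => (z - 1) ^ S.card) ω : ℝ) ∂μ =
      μ.real B * ((q * (z - 1)) ^ S.card * 1 ^ (A.card - S.card)) := fun S hS => by
    rw [integral_indicator_const _ (hm S), measureReal_restrict_apply (hm S), Set.inter_comm,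
      h S (Finset.mem_powerset.mp hS), smul_eq_mul, mul_pow]
    ring
  rw [Finset.sum_congr rfl h3, ← Finset.mul_sum, Finset.sum_pow_mul_eq_add_pow, add_comm]

/-- The Chernoff bound that follows from `integral_pow_card_filter`, for a deviation upwards if
`x > 0` and downwards if `x < 0`. -/
lemma measureReal_inter_le_of_exp {V : Type*} {B : Set Ω} (A : Finset V) {E : V → Set Ω}
    [∀ ω, DecidablePred (ω ∈ E ·)] {q : ℝ}
    (hE : ∀ v, MeasurableSet (E v))
    (h : ∀ S ⊆ A, μ.real (B ∩ {ω | ∀ v ∈ S, ω ∈ E v}) = μ.real B * q ^ S.card)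
    {x y : ℝ} {H : Set Ω} (hHm : MeasurableSet H)
    (hH : ∀ ω ∈ H, y ≤ x * (A.filter (ω ∈ E ·)).card)
    (hq : 0 ≤ 1 + q * (Real.exp x - 1)) :
    μ.real (B ∩ H) ≤ μ.real B * Real.exp (A.card * (q * (Real.exp x - 1)) - y) := by
  have h1 := integral_pow_card_filter (μ := μ) A hE h (Real.exp x)
  have hi : Integrable (fun ω => Real.exp x ^ (A.filter (ω ∈ E ·)).card) (μ.restrict B) := by
    have hmf : Measurable fun ω => (A.filter (ω ∈ E ·)).card := by
      have : (fun ω => (A.filter (ω ∈ E ·)).card) =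
          fun ω => ∑ v ∈ A, (E v).indicator (fun _ => 1) ω := by
        funext ω
        rw [Finset.card_filter]
        exact Finset.sum_congr rfl fun v _ => by by_cases h : ω ∈ E v <;> simp [h]
      rw [this]
      exact Finset.measurable_sum _ fun v _ => measurable_const.indicator (hE v)
    refine Integrable.of_bound (C := (1 + Real.exp x) ^ A.card)
      ((measurable_from_nat (f := fun i => Real.exp x ^ i)).comp hmf).aestronglyMeasurable
      (.of_forall fun ω => ?_)
    rw [Real.norm_of_nonneg (by positivity)]
    calc Real.exp x ^ (A.filter (ω ∈ E ·)).card
        ≤ (1 + Real.exp x) ^ (A.filter (ω ∈ E ·)).card := by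
          gcongr; linarith
      _ ≤ _ := pow_le_pow_right₀ (by linarith [Real.exp_pos x])
          (Finset.card_filter_le _ _)
  have h2 : Real.exp y * μ.real (B ∩ H) ≤
      ∫ ω in B, Real.exp x ^ (A.filter (ω ∈ E ·)).card ∂μ := by
    calc Real.exp y * μ.real (B ∩ H) = ∫ ω in B, H.indicator (fun _ => Real.exp y) ω ∂μ := by
          rw [integral_indicator_const _ hHm, measureReal_restrict_apply hHm, Set.inter_comm,
            smul_eq_mul, mul_comm]
      _ ≤ _ := by
          refine integral_mono ((integrable_const _).indicator hHm) hi fun ω => ?_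
          by_cases hω : ω ∈ H
          · simp only [Set.indicator_of_mem hω, ← Real.exp_nat_mul]
            exact Real.exp_le_exp.mpr ((hH ω hω).trans_eq (mul_comm _ _))
          · simp only [Set.indicator_of_notMem hω]
            positivity
  have h3 : (1 + q * (Real.exp x - 1)) ^ A.card ≤
      Real.exp (A.card * (q * (Real.exp x - 1))) := by
    rw [Real.exp_nat_mul]
    refine pow_le_pow_left₀ hq ?_ _
    linarith [Real.add_one_le_exp (q * (Real.exp x - 1))]
  rw [h1] at h2
  rw [Real.exp_sub, ← mul_div_assoc, le_div_iff₀ (Real.exp_pos y), mul_comm]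
  exact h2.trans (mul_le_mul_of_nonneg_left h3 measureReal_nonneg)

end Tail

/-! ### The ideal process -/

section Ideal

variable {P : Params} {U : Type} [DecidableEq U] {k : ℕ}

/-- The node `u` is in its first round in round `r`. Nodes that are there at the end of the
bootstrap phase do not count as new. -/
def IsNew (A : Adversary P U k) (ω : Bits U k P.s) (r : ℕ) (u : U) : Prop :=
  0 < r ∧ u ∈ A.nodes r ω ∧ u ∉ A.nodes (r - 1) ω

/-- A node of age `a` decides in round `r` to move at the start of the next cycle. -/
def WantsMove (A : Adversary P U k) (ω : Bits U k P.s) (r a : ℕ) (u : U) : Prop :=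
  P.T ∣ r ∧ ¬ IsNew A ω r u ∧ (ω.coin (r / P.T + 1) u = true ∨ P.M ≤ a)

open scoped Classical in
/-- The age of `u` in round `r` if it was admitted wherever it asked for admission. It is defined
for all nodes of the universe, whether they are present or not. -/
def age (A : Adversary P U k) (ω : Bits U k P.s) : ℕ → U → ℕ
  | 0, _ => 0
  | r + 1, u =>
      if IsNew A ω (r + 1) u ∨ IsNew A ω r u ∨ WantsMove A ω r (age A ω r u) u then 0
      else if P.T ∣ r then age A ω r u + 1 else age A ω r u

/-- In the ideal process, `u` moves with a token of its own from round `r` to round `r + 1`. -/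
def Moves (A : Adversary P U k) (ω : Bits U k P.s) (r : ℕ) (u : U) : Prop :=
  WantsMove A ω r (age A ω r u) u

open scoped Classical in
/-- The last round up to round `r` in which the ideal committee of `u` was determined by a token,
and `0` if there is none. -/
def refresh (A : Adversary P U k) (ω : Bits U k P.s) : ℕ → U → ℕ
  | 0, _ => 0
  | r + 1, u => if IsNew A ω (r + 1) u ∨ Moves A ω r u then r + 1 else refresh A ω r u

variable {A : Adversary P U k} {ω : Bits U k P.s} {r : ℕ} {u : U}

lemma not_isNew_zero : ¬ IsNew A ω 0 u := fun h => absurd h.1 (lt_irrefl 0)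

lemma isNew_succ : IsNew A ω (r + 1) u ↔ u ∈ A.nodes (r + 1) ω ∧ u ∉ A.nodes r ω := by
  simp [IsNew]

lemma Moves.not_isNew (h : Moves A ω r u) : ¬ IsNew A ω r u := h.2.1

lemma Moves.dvd (h : Moves A ω r u) : P.T ∣ r := h.1

lemma refresh_of_isNew (h : IsNew A ω r u) : refresh A ω r u = r := by
  cases r with
  | zero => rfl
  | succ r => simp [refresh, h]

lemma age_succ_of_moves (h : Moves A ω r u) : age A ω (r + 1) u = 0 := by
  simp only [Moves] at h
  simp [age, h]

lemma age_succ_of_not_moves (h₀ : ¬ IsNew A ω r u) (h₁ : ¬ IsNew A ω (r + 1) u)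
    (h : ¬ Moves A ω r u) :
    age A ω (r + 1) u = if P.T ∣ r then age A ω r u + 1 else age A ω r u := by
  simp only [Moves] at h
  simp [age, h₀, h₁, h]

lemma refresh_le (A : Adversary P U k) (ω : Bits U k P.s) (r : ℕ) (u : U) :
    refresh A ω r u ≤ r := by
  induction r with
  | zero => rfl
  | succ r ih =>
    simp only [refresh]
    split_ifs <;> omega

lemma age_le (A : Adversary P U k) (ω : Bits U k P.s) (r : ℕ) (u : U) :
    age A ω r u ≤ P.M := by
  induction r with
  | zero => simp [age]
  | succ r ih =>
    rw [age]
    split_ifs with h h₁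
    · exact Nat.zero_le _
    · by_contra! h₂
      rw [not_or, not_or] at h
      exact h.2.2 ⟨h₁, h.2.1, .inr (by omega)⟩
    · exact ih

open scoped Classical in
/-- The number of starts of cycles since the last refreshment exceeds the age by at most one: a new
node may see the start of a cycle before it uses its sample. -/
lemma count_le_age (A : Adversary P U k) (ω : Bits U k P.s) (r : ℕ) (u : U) :
    Nat.count (P.T ∣ ·) r ≤ Nat.count (P.T ∣ ·) (refresh A ω r u) + age A ω r u + 1 := by
  induction r with
  | zero => simp
  | succ r ih =>
    by_cases h : IsNew A ω (r + 1) u ∨ Moves A ω r u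
    · simp only [refresh, h, if_true]
      omega
    · simp only [refresh, h, if_false]
      rw [not_or] at h
      by_cases h₀ : IsNew A ω r u
      · rw [refresh_of_isNew h₀, Nat.count_succ]
        split_ifs <;> omega
      · rw [age_succ_of_not_moves h₀ h.1 h.2, Nat.count_succ]
        split_ifs <;> omega

open scoped Classical in
/-- There are `⌈r / T⌉` multiples of `T` below `r`. -/
lemma le_mul_count (T r : ℕ) (hT : 0 < T) :
    r ≤ T * Nat.count (T ∣ ·) r ∧ T * Nat.count (T ∣ ·) r < r + T := by
  induction r with
  | zero => simp [hT]
  | succ r ih =>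
    rw [Nat.count_succ]
    by_cases h : T ∣ r
    · rw [if_pos h, mul_add, mul_one]
      obtain ⟨m, rfl⟩ := h
      have h1 : Nat.count (T ∣ ·) (T * m) < m + 1 := by
        have := ih.2
        rw [← Nat.mul_succ] at this
        exact lt_of_mul_lt_mul_left this hT.le
      have h2 := Nat.mul_le_mul_left T (Nat.lt_succ_iff.mp h1)
      omega
    · rw [if_neg h, add_zero]
      have h1 : r ≠ T * Nat.count (T ∣ ·) r := fun e => h ⟨_, e⟩
      omega

/-- In a round of cycle `ℓ`, the position of every node was refreshed after the start of cycle
`ℓ - M - 1`, if there is such a cycle. -/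
lemma lt_refresh_add (hT : 0 < P.T) {ℓ : ℕ} (hr : ℓ * P.T < r + P.T) (u : U) :
    ℓ * P.T < refresh A ω r u + (P.M + 2) * P.T := by
  classical
  have h1 := count_le_age A ω r u
  have h2 := age_le A ω r u
  have h3 := (le_mul_count P.T r hT).1
  have h4 := (le_mul_count P.T (refresh A ω r u) hT).2
  set c := Nat.count (P.T ∣ ·) r
  set d := Nat.count (P.T ∣ ·) (refresh A ω r u)
  have h5 : ℓ < c + 1 := by
    refine lt_of_mul_lt_mul_right (a := P.T) ?_ hT.le
    rw [add_mul, one_mul, mul_comm c]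
    omega
  have h6 : ℓ * P.T ≤ (d + P.M + 1) * P.T := Nat.mul_le_mul_right _ (by omega)
  have h7 : (d + P.M + 1) * P.T = P.T * d + (P.M + 1) * P.T := by ring
  have h8 : (P.M + 2) * P.T = (P.M + 1) * P.T + P.T := by ring
  omega

variable [NeZero k]

open scoped Classical in
/-- The committees after the own moves between the rounds `r` and `r + 1`, if those before are given
by `π`. -/
def hop (A : Adversary P U k) (ω : Bits U k P.s) (r : ℕ) (π : U → Committee k) (u : U) :
    Committee k :=
  if Moves A ω r u then (ω.own (r / P.T + 1) u).dst (π u) else π u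

open scoped Classical in
/-- The committee of `u` in round `r` if all requests for admission were accepted and all committees
had enough samples. A new node is assigned at once to the committee of the sample that it receives
from its seed; all nodes of the universe move as if they were present. -/
def pos (A : Adversary P U k) (ω : Bits U k P.s) : ℕ → U → Committee k
  | 0, u => ω.init u
  | r + 1, u =>
      if IsNew A ω (r + 1) u then
        (ω.help (r + 1) (A.seed (r + 1) ω u).1 (A.seed (r + 1) ω u).2).dst
          (hop A ω r (pos A ω r) (A.seed (r + 1) ω u).1)
      else hop A ω r (pos A ω r) u

lemma pos_succ_of_not_isNew (h : ¬ IsNew A ω (r + 1) u) :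
    pos A ω (r + 1) u = hop A ω r (pos A ω r) u := by
  simp [pos, h]

lemma hop_of_moves {π : U → Committee k} (h : Moves A ω r u) :
    hop A ω r π u = (ω.own (r / P.T + 1) u).dst (π u) := if_pos h

lemma hop_of_not_moves {π : U → Committee k} (h : ¬ Moves A ω r u) : hop A ω r π u = π u :=
  if_neg h

end Ideal

/-! ### Agreement of the protocol with the ideal process -/

section Agreement

variable {P : Params} {U : Type} [DecidableEq U] {k : ℕ} [NeZero k]
  {A : Adversary P U k} {ω : Bits U k P.s} {r : ℕ} {u : U}

open scoped Classical in
/-- In round `r`, all present nodes are in the state that the ideal process predicts. -/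
def Matches (A : Adversary P U k) (ω : Bits U k P.s) (r : ℕ) : Prop :=
  ∀ u ∈ A.nodes r ω, (run A ω r).node u =
    if IsNew A ω r u then
      ⟨none, 0, some (pos A ω r u, (run A ω (r - 1)).lists (pos A ω r u))⟩
    else ⟨some (pos A ω r u), age A ω r u, none⟩

lemma matches_zero : Matches A ω 0 := fun u hu => by
  simp [run, hu, not_isNew_zero, pos, age]

lemma mem_CML {C : Committee k} :
    u ∈ CML A ω r C ↔ u ∈ A.nodes r ω ∧ comm A ω r u = some C := by
  simp [CML, members, comm]

lemma Matches.mem_CML_iff (h : Matches A ω r) {C : Committee k} :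
    u ∈ CML A ω r C ↔ u ∈ A.nodes r ω ∧ ¬ IsNew A ω r u ∧ pos A ω r u = C := by
  rw [mem_CML]
  refine and_congr_right fun hu => ?_
  rw [comm, h u hu]
  by_cases hn : IsNew A ω r u <;> simp [hn]

omit [DecidableEq U] in
lemma Supplied.mono {S S' : Finset U} (h : S ⊆ S') (h' : Supplied P S') : Supplied P S :=
  (Nat.mul_le_mul_right _ (Finset.card_le_card h)).trans h'

lemma Matches.request_of_isNew (h : Matches A ω r) (hu : u ∈ A.nodes r ω) (hn : IsNew A ω r u) :
    request A ω r (run A ω r) u =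
      some (pos A ω r u, (run A ω (r - 1)).lists (pos A ω r u)) := by
  simp [request, h u hu, hn]

lemma Matches.request_of_not_moves (h : Matches A ω r) (hu : u ∈ A.nodes r ω)
    (hn : ¬ IsNew A ω r u) (hv : ¬ Moves A ω r u) : request A ω r (run A ω r) u = none := by
  have h1 := h u hu
  rw [if_neg hn] at h1
  have h3 : ((run A ω r).node u).age = age A ω r u := by rw [h1]
  simp only [request, h1]
  exact if_neg fun h2 => hv ⟨h2.1, hn, h3 ▸ h2.2.1⟩

lemma Matches.request_of_moves (h : Matches A ω r) (hu : u ∈ A.nodes r ω)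
    (hv : Moves A ω r u) (hs : ∀ C, Supplied P (CML A ω r C)) :
    request A ω r (run A ω r) u = some (hop A ω r (pos A ω r) u,
      (run A ω r).lists (hop A ω r (pos A ω r) u)) := by
  rw [hop_of_moves hv]
  have hs' := hs (pos A ω r u)
  rw [CML] at hs'
  have h1 := h u hu
  rw [if_neg hv.not_isNew] at h1
  have h3 : ((run A ω r).node u).age = age A ω r u := by rw [h1]
  simp only [request, h1]
  rw [if_pos ⟨hv.1, h3 ▸ hv.2.2, hs'⟩]

lemma run_succ_node (hu : u ∈ A.nodes r ω) (hu' : u ∈ A.nodes (r + 1) ω) :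
    (run A ω (r + 1)).node u = stepOld A ω r (run A ω r) u := by
  simp [run, step, hu, hu']

lemma Matches.stepOld_eq (h : Matches A ω r)
    (hs : P.T ∣ r → ∀ C, Supplied P (CML A ω r C)) (hu : u ∈ A.nodes r ω)
    (hu' : u ∈ A.nodes (r + 1) ω) (ha : comm A ω (r + 1) u ≠ none) :
    stepOld A ω r (run A ω r) u = ⟨some (pos A ω (r + 1) u), age A ω (r + 1) u, none⟩ := by
  have hn' : ¬ IsNew A ω (r + 1) u := fun h => (isNew_succ.mp h).2 hu
  rw [comm, run_succ_node hu hu'] at ha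
  rw [pos_succ_of_not_isNew hn']
  by_cases hn : IsNew A ω r u
  · have hm : ¬ Moves A ω r u := fun h => h.not_isNew hn
    have ha' : age A ω (r + 1) u = 0 := by simp [age, hn]
    simp only [stepOld, h.request_of_isNew hu hn] at ha ⊢
    rw [hop_of_not_moves hm, ha']
    split_ifs at ha ⊢ <;> simp_all
  · by_cases hm : Moves A ω r u
    · simp only [stepOld, h.request_of_moves hu hm (hs hm.dvd)] at ha ⊢
      rw [age_succ_of_moves hm]
      split_ifs at ha ⊢ <;> simp_all
    · simp only [stepOld, h.request_of_not_moves hu hn hm]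
      rw [age_succ_of_not_moves hn hn' hm, hop_of_not_moves hm, h u hu]
      simp [hn]

lemma comm_succ_of_isNew (hn : IsNew A ω (r + 1) u) : comm A ω (r + 1) u = none := by
  rw [isNew_succ] at hn
  simp [comm, run, step, hn, stepNew]

lemma Matches.pos_succ_of_mem_CML (h : Matches A ω r)
    (hs : P.T ∣ r → ∀ C, Supplied P (CML A ω r C)) {C : Committee k}
    (hu : u ∈ CML A ω (r + 1) C) : pos A ω (r + 1) u = C := by
  obtain ⟨hu', hC⟩ := mem_CML.mp hu
  have hu : u ∈ A.nodes r ω := by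
    by_contra hn
    rw [comm_succ_of_isNew (isNew_succ.mpr ⟨hu', hn⟩)] at hC
    simp at hC
  have h1 := h.stepOld_eq hs hu hu' (by simp [hC])
  rw [comm, run_succ_node hu hu', h1] at hC
  exact Option.some.inj hC

/-- The protocol follows the ideal process for another round if all requests are accepted and all
committees have enough samples. -/
lemma Matches.succ (h : Matches A ω r)
    (hs : P.T ∣ r → ∀ C, Supplied P (CML A ω r C))
    (ha : ∀ u ∈ A.nodes r ω ∩ A.nodes (r + 1) ω, comm A ω (r + 1) u ≠ none)
    (hs' : ∀ C, Supplied P (CML A ω (r + 1) C)) : Matches A ω (r + 1) := by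
  intro u hu'
  by_cases hu : u ∈ A.nodes r ω
  · have hn' : ¬ IsNew A ω (r + 1) u := fun h => (isNew_succ.mp h).2 hu
    rw [if_neg hn', run_succ_node hu hu',
      h.stepOld_eq hs hu hu' (ha u (Finset.mem_inter.mpr ⟨hu, hu'⟩))]
  · have hn' : IsNew A ω (r + 1) u := isNew_succ.mpr ⟨hu', hu⟩
    have hv := A.seed_mem r ω u (Finset.mem_sdiff.mpr ⟨hu', hu⟩)
    set v := (A.seed (r + 1) ω u).1 with hvdef
    have hv' := Finset.mem_inter.mp hv
    have hnv : ¬ IsNew A ω (r + 1) v := fun h => (isNew_succ.mp h).2 hv'.1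
    have h1 := h.stepOld_eq hs hv'.1 hv'.2 (ha v hv)
    have h2 : Supplied P (members (A.nodes r ω ∩ A.nodes (r + 1) ω)
        (stepOld A ω r (run A ω r)) (pos A ω (r + 1) v)) := by
      refine Supplied.mono (fun w hw => ?_) (hs' (pos A ω (r + 1) v))
      simp only [members, Finset.mem_filter, Finset.mem_inter] at hw
      rw [mem_CML, comm, run_succ_node hw.1.1 hw.1.2]
      exact ⟨hw.1.2, hw.2⟩
    have h3 : (run A ω (r + 1)).node u = stepNew A ω r (run A ω r) u := by
      simp [run, step, hu, hu']
    rw [if_pos hn', h3]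
    simp only [stepNew, ← hvdef, h1, if_pos h2]
    have h4 : pos A ω (r + 1) u = (ω.help (r + 1) v (A.seed (r + 1) ω u).2).dst
        (pos A ω (r + 1) v) := by
      rw [pos_succ_of_not_isNew hnv]
      simp [pos, hn', ← hvdef]
    rw [h4]
    rfl

/-- The member lists in the samples of a cycle date from the start of that cycle. -/
lemma lists_eq (r : ℕ) :
    (run A ω r).lists = CML A ω (r / P.T * P.T) := by
  induction r with
  | zero => rw [Nat.zero_div, zero_mul]; rfl
  | succ r ih =>
    by_cases h : P.T ∣ r + 1
    · rw [Nat.div_mul_cancel h]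
      simp only [run, step, h, if_true]
      rfl
    · have h1 : (r + 1) / P.T = r / P.T := by
        rw [Nat.succ_div, if_neg h, add_zero]
      rw [h1, ← ih]
      simp [run, step, h]

end Agreement

/-! ### A good cycle keeps the network in order -/

section Good

lemma stepEdge_injective {k : ℕ} [NeZero k] (b : Bool) :
    Function.Injective fun C : Committee k => stepEdge C b := by
  rintro ⟨ρ, c⟩ ⟨ρ', c'⟩ h
  simp only [stepEdge, Prod.mk.injEq, add_left_inj] at h
  obtain ⟨h, rfl⟩ := h
  cases b with
  | false => simpa using h
  | true =>
    simp only [if_true] at h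
    refine Prod.ext (funext fun j => ?_) rfl
    have hj := congrFun h j
    by_cases hjc : j = c + 1
    · subst hjc; simpa using hj
    · simpa [hjc] using hj

lemma stepEdge_ne {k : ℕ} [NeZero k] (hk : 2 ≤ k) (C : Committee k) (b : Bool) :
    stepEdge C b ≠ C := by
  intro h
  have h1 : C.2 + 1 = C.2 := congrArg Prod.snd h
  have h2 : (1 : Fin k) = 0 := by simpa using h1
  have h3 := congrArg Fin.val h2
  rw [Fin.val_one', Nat.mod_eq_of_lt (by omega)] at h3
  simp at h3

open scoped Classical in
/-- The committees that are joined to `C`, including `C` itself. -/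
def neighbors {k : ℕ} [NeZero k] (C : Committee k) : Finset (Committee k) :=
  insert C (Finset.univ.image (stepEdge C) ∪
    Finset.univ.biUnion fun b => Finset.univ.filter fun C' => stepEdge C' b = C)

lemma card_neighbors_le {k : ℕ} [NeZero k] (C : Committee k) : (neighbors C).card ≤ 5 := by
  classical
  have h1 : (Finset.univ.image (stepEdge C)).card ≤ 2 := by
    simpa using Finset.card_image_le (s := Finset.univ) (f := stepEdge C)
  have h2 : ∀ b ∈ (Finset.univ : Finset Bool),
      (Finset.univ.filter fun C' => stepEdge C' b = C).card ≤ 1 := fun b _ =>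
    Finset.card_le_one.mpr fun D hD D' hD' => stepEdge_injective b
      ((Finset.mem_filter.mp hD).2.trans (Finset.mem_filter.mp hD').2.symm)
  have h3 := Finset.card_biUnion_le_card_mul _ _ 1 h2
  have h4 := Finset.card_insert_le C (Finset.univ.image (stepEdge C) ∪
    Finset.univ.biUnion fun b => Finset.univ.filter fun C' => stepEdge C' b = C)
  have h5 := Finset.card_union_le (Finset.univ.image (stepEdge C))
    (Finset.univ.biUnion fun b => Finset.univ.filter fun C' => stepEdge C' b = C)
  simp only [Finset.card_univ, Fintype.card_bool] at h3
  unfold neighbors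
  convert h4.trans (by omega : _ ≤ 5)

variable {P : Params} {U : Type} [DecidableEq U] {k : ℕ} [NeZero k]
  {A : Adversary P U k} {ω : Bits U k P.s} {r R : ℕ} {u v : U}

lemma eq_of_mem_CML {C C' : Committee k} (h : u ∈ CML A ω r C) (h' : u ∈ CML A ω r C') :
    C = C' :=
  Option.some.inj ((mem_CML.mp h).2.symm.trans (mem_CML.mp h').2)

/-- The ports bound the size of the committees as long as Spartan is robust. -/
lemma Robust.card_CML_le (ha : 0 < P.a * Real.log P.n) (h : Robust A ω R)
    (hr : r ≤ R) (C : Committee k) : (CML A ω r C).card ≤ P.Δ + 1 := by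
  classical
  obtain hC | ⟨u, hu⟩ := (CML A ω r C).eq_empty_or_nonempty
  · simp [hC]
  obtain ⟨v, hv⟩ : (CML A ω r (stepEdge C true)).Nonempty := by
    have := ha.trans_le ((h.1 (stepEdge C true)).1 r hr)
    exact Finset.card_pos.mp (by exact_mod_cast this)
  have h1 := ((h.2 C (stepEdge C true) ⟨true, rfl⟩).2.2 r hr u hu v hv).2.1
  have h2 : ((CML A ω r C).erase u).card ≤ demand A ω r u := by
    refine Finset.card_le_card fun w hw => ?_
    rw [Finset.mem_erase] at hw
    exact Finset.mem_filter.mpr ⟨(mem_CML.mp hw.2).1, hw.1.symm, C, C, hu, hw.2, .inl rfl⟩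
  rw [Finset.card_erase_of_mem hu] at h2
  omega

/-- Spartan is robust until round `r`, and every node has been in a committee from its second round
on. -/
def InOrder (A : Adversary P U k) (ω : Bits U k P.s) (r : ℕ) : Prop :=
  Robust A ω r ∧ Placed A ω r

lemma Robust.mono (h : Robust A ω R) (hr : r ≤ R) : Robust A ω r :=
  have hc : ∀ C, CommitteeRobust A ω r C := fun C =>
    ⟨fun r' hr' => (h.1 C).1 r' (hr'.trans hr), fun r' hr' => (h.1 C).2 r' (hr'.trans_le hr)⟩
  ⟨hc, fun C C' hE => ⟨hc C, hc C', fun r' hr' => (h.2 C C' hE).2.2 r' (hr'.trans hr)⟩⟩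

lemma InOrder.mono (h : InOrder A ω R) (hr : r ≤ R) : InOrder A ω r :=
  ⟨h.1.mono hr, fun r' hr' => h.2 r' (hr'.trans_le hr)⟩

lemma Robust.supplied (ha : 0 < P.a * Real.log P.n)
    (hQ : (P.Δ + 1) * (1 + P.s * P.T) ≤ P.Q) (h : Robust A ω R)
    (hr : r ≤ R) (C : Committee k) : Supplied P (CML A ω r C) :=
  (Nat.mul_le_mul_right _ (h.card_CML_le ha hr C)).trans hQ

lemma InOrder.matches (ha : 0 < P.a * Real.log P.n)
    (hQ : (P.Δ + 1) * (1 + P.s * P.T) ≤ P.Q) (h : InOrder A ω R) (hr : r ≤ R) :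
    Matches A ω r := by
  induction r with
  | zero => exact matches_zero
  | succ r ih =>
    exact (ih (by omega)).succ (fun _ => h.1.supplied ha hQ (by omega)) (h.2 r hr)
      (h.1.supplied ha hQ hr)

/-- The number of nodes that the ideal process assigns to the committee `C`. -/
def load (A : Adversary P U k) (ω : Bits U k P.s) (r : ℕ) (C : Committee k) : ℕ :=
  ((A.nodes r ω).filter fun u => pos A ω r u = C).card

lemma Matches.card_CML_le (h : Matches A ω r) (C : Committee k) :
    (CML A ω r C).card ≤ load A ω r C :=
  Finset.card_le_card fun u hu => by
    rw [h.mem_CML_iff] at hu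
    exact Finset.mem_filter.mpr ⟨hu.1, hu.2.2⟩

lemma Matches.demand_le (h : Matches A ω r) {d : ℝ} (hd : ∀ C, (load A ω r C : ℝ) ≤ d)
    {C : Committee k} (hu : u ∈ CML A ω r C) : (demand A ω r u : ℝ) ≤ 5 * d := by
  classical
  have h1 : demand A ω r u ≤ ((neighbors C).biUnion (CML A ω r)).card := by
    refine Finset.card_le_card fun v hv => ?_
    obtain ⟨-, -, D, D', hD, hD', hE⟩ := Finset.mem_filter.mp hv
    obtain rfl := eq_of_mem_CML hu hD
    refine Finset.mem_biUnion.mpr ⟨D', ?_, hD'⟩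
    simp only [neighbors, Finset.mem_insert, Finset.mem_union, Finset.mem_image, Finset.mem_univ,
      true_and, Finset.mem_biUnion, Finset.mem_filter]
    obtain rfl | ⟨b, hb⟩ | ⟨b, hb⟩ := hE
    · exact .inl rfl
    · exact .inr (.inl ⟨b, hb.symm⟩)
    · exact .inr (.inr ⟨b, hb.symm⟩)
  have hd0 : 0 ≤ d := (Nat.cast_nonneg _).trans (hd C)
  calc (demand A ω r u : ℝ) ≤ ∑ C' ∈ neighbors C, ((CML A ω r C').card : ℝ) := by
        exact_mod_cast h1.trans Finset.card_biUnion_le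
    _ ≤ ∑ C' ∈ neighbors C, d := Finset.sum_le_sum fun C' _ =>
        le_trans (by exact_mod_cast h.card_CML_le C') (hd C')
    _ = (neighbors C).card * d := by rw [Finset.sum_const, nsmul_eq_mul]
    _ ≤ 5 * d := by
        gcongr
        exact_mod_cast card_neighbors_le C

lemma Matches.overlay (hk : 2 ≤ k) (h : Matches A ω r) {d : ℝ}
    (hd : ∀ C, (load A ω r C : ℝ) ≤ d) (hΔ : 5 * d ≤ P.Δ) {C C' : Committee k}
    (hE : LogicalEdge C C') (hu : u ∈ CML A ω r C) (hv : v ∈ CML A ω r C') :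
    Overlay A ω r u v := by
  refine ⟨⟨?_, C, C', hu, hv, .inr (.inl hE)⟩, ?_, ?_⟩
  · rintro rfl
    obtain ⟨b, hb⟩ := hE
    exact stepEdge_ne hk C b (hb.symm.trans (eq_of_mem_CML hu hv).symm)
  · exact_mod_cast (h.demand_le hd hu).trans hΔ
  · exact_mod_cast (h.demand_le hd hv).trans hΔ

/-- In the ideal process, `w` is a member of `C` during the cycles `ℓ - 1` and `ℓ`, and it does not
move at their starts. Such nodes keep `C` alive and admit those that ask to join it, no matter
whether their samples date from the start of cycle `ℓ - 1` or from that of cycle `ℓ`. -/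
def Stays (A : Adversary P U k) (ω : Bits U k P.s) (ℓ : ℕ) (C : Committee k) (w : U) : Prop :=
  ∀ r, (ℓ - 2) * P.T ≤ r → r ≤ ℓ * P.T →
    w ∈ A.nodes r ω ∧ ¬ IsNew A ω r w ∧ pos A ω r w = C ∧ (r < ℓ * P.T → ¬ Moves A ω r w)

lemma Stays.mem_CML {ℓ : ℕ} {C : Committee k} {w : U} (h : Stays A ω ℓ C w)
    (hm : Matches A ω r) (h₁ : (ℓ - 2) * P.T ≤ r) (h₂ : r ≤ ℓ * P.T) : w ∈ CML A ω r C :=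
  hm.mem_CML_iff.mpr ⟨(h r h₁ h₂).1, (h r h₁ h₂).2.1, (h r h₁ h₂).2.2.1⟩

lemma Stays.remains {ℓ : ℕ} {C : Committee k} {w : U} (h : Stays A ω ℓ C w)
    (hm : Matches A ω r) (h₁ : (ℓ - 2) * P.T ≤ r) (h₂ : r < ℓ * P.T) :
    Remains A ω r (run A ω r) w C := by
  obtain ⟨a, b, -, d⟩ := h r h₁ h₂.le
  exact ⟨a, (h (r + 1) (by omega) h₂).1, (Spartan.mem_CML.mp (h.mem_CML hm h₁ h₂.le)).2,
    hm.request_of_not_moves a b (d h₂)⟩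

/-- If every committee has a member that stays, then all requests of the cycle are accepted. -/
lemma comm_succ_ne_none {ℓ : ℕ} (hT : 0 < P.T) (hm : ∀ r' ≤ r, Matches A ω r')
    (h₁ : (ℓ - 1) * P.T ≤ r) (h₂ : r < ℓ * P.T) (hs : P.T ∣ r → ∀ C, Supplied P (CML A ω r C))
    (hst : ∀ C, ∃ w, Stays A ω ℓ C w) (hu : u ∈ A.nodes r ω ∩ A.nodes (r + 1) ω) :
    comm A ω (r + 1) u ≠ none := by
  obtain ⟨hu, hu'⟩ := Finset.mem_inter.mp hu
  have h0 : (ℓ - 2) * P.T ≤ (ℓ - 1) * P.T := Nat.mul_le_mul_right _ (by omega)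
  have hlt : ∀ q, q * P.T ≤ r → q < ℓ := fun q hq =>
    lt_of_mul_lt_mul_right (hq.trans_lt h₂) hT.le
  -- A sample with a member list from the start of cycle `ℓ - 1` or `ℓ` leads to admission.
  have key : ∀ q C, q * P.T ≤ r → ℓ ≤ q + 2 →
      request A ω r (run A ω r) u = some (C, CML A ω (q * P.T) C) →
      (stepOld A ω r (run A ω r) u).comm ≠ none := by
    intro q C hq hℓ hreq
    obtain ⟨w, hw⟩ := hst C
    have hq2 : (ℓ - 2) * P.T ≤ q * P.T := Nat.mul_le_mul_right _ (by omega)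
    have hex : ∃ w ∈ CML A ω (q * P.T) C, Remains A ω r (run A ω r) w C :=
      ⟨w, hw.mem_CML (hm _ hq) hq2 (by omega), hw.remains (hm r le_rfl) (by omega) h₂⟩
    simp only [stepOld, hreq, if_pos hex]
    exact Option.some_ne_none C
  rw [comm, run_succ_node hu hu']
  have hmr := hm r le_rfl
  by_cases hn : IsNew A ω r u
  · have h3 := hmr.request_of_isNew hu hn
    rw [lists_eq] at h3
    have hr0 : 0 < r := hn.1
    have hle : (r - 1) / P.T * P.T ≤ r - 1 := Nat.div_mul_le_self _ _
    refine key _ _ (by omega) ?_ h3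
    have h4 : r - 1 < ((r - 1) / P.T + 1) * P.T := by
      rw [add_mul, one_mul]; exact Nat.lt_div_mul_add hT
    have h5 : ℓ - 1 ≤ (r - 1) / P.T + 1 :=
      Nat.le_of_mul_le_mul_right (by omega : (ℓ - 1) * P.T ≤ _) hT
    omega
  · by_cases hv : Moves A ω r u
    · have h3 := hmr.request_of_moves hu hv (hs hv.dvd)
      rw [lists_eq] at h3
      refine key _ _ (Nat.div_mul_le_self _ _) ?_ h3
      have h5 : ℓ - 1 ≤ r / P.T := (Nat.le_div_iff_mul_le hT).mpr h₁
      omega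
    · simp only [stepOld, hmr.request_of_not_moves hu hn hv]
      have h6 := hmr u hu
      rw [if_neg hn] at h6
      simp [h6]

variable [Fintype U]

open scoped Classical in
/-- The number of nodes that stay in the committee `C` throughout the cycles `ℓ - 1` and `ℓ`. -/
def core (A : Adversary P U k) (ω : Bits U k P.s) (ℓ : ℕ) (C : Committee k) : ℕ :=
  (Finset.univ.filter (Stays A ω ℓ C)).card

/-- All committees have enough members that stay in cycle `ℓ`. -/
def Lively (A : Adversary P U k) (ω : Bits U k P.s) (ℓ : ℕ) : Prop :=
  ∀ C, P.a * Real.log P.n ≤ core A ω ℓ C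

lemma Lively.exists_stays {ℓ : ℕ} (ha : 0 < P.a * Real.log P.n) (h : Lively A ω ℓ)
    (C : Committee k) : ∃ w, Stays A ω ℓ C w := by
  classical
  have h1 : 0 < core A ω ℓ C := by exact_mod_cast ha.trans_le (h C)
  obtain ⟨w, hw⟩ := Finset.card_pos.mp h1
  exact ⟨w, (Finset.mem_filter.mp hw).2⟩

lemma Lively.le_card_CML {ℓ : ℕ} (h : Lively A ω ℓ) (hm : Matches A ω r)
    (h₁ : (ℓ - 2) * P.T ≤ r) (h₂ : r ≤ ℓ * P.T) (C : Committee k) :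
    P.a * Real.log P.n ≤ (CML A ω r C).card := by
  classical
  refine (h C).trans ?_
  exact_mod_cast Finset.card_le_card fun w hw =>
    Stays.mem_CML (Finset.mem_filter.mp hw).2 hm h₁ h₂

/-- Only nodes that stay in cycle `1` are needed at the end of the bootstrap phase, because
`(1 - 2) * T = 0`. -/
lemma inOrder_zero (hk : 2 ≤ k) {d : ℝ} (hΔ : 5 * d ≤ P.Δ) (hl : Lively A ω 1)
    (hd : ∀ C, (load A ω 0 C : ℝ) ≤ d) : InOrder A ω 0 := by
  have hc : ∀ C, CommitteeRobust A ω 0 C := fun C =>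
    ⟨fun r hr => hl.le_card_CML (by obtain rfl := Nat.le_zero.mp hr; exact matches_zero)
      (by simp) (by omega) C, fun r hr => absurd hr (Nat.not_lt_zero r)⟩
  refine ⟨⟨hc, fun C C' hE => ⟨hc C, hc C', fun r hr u hu v hv => ?_⟩⟩,
    fun r hr => absurd hr (Nat.not_lt_zero r)⟩
  obtain rfl := Nat.le_zero.mp hr
  exact matches_zero.overlay hk hd hΔ hE hu hv

/-- The protocol follows the ideal process through a lively cycle in which no ideal committee is too
large. The bound on the loads guarantees that the samples suffice in the next round. -/
lemma matches_of_lively (hT : 0 < P.T) (ha : 0 < P.a * Real.log P.n)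
    (hQ : (P.Δ + 1) * (1 + P.s * P.T) ≤ P.Q) {d : ℝ} (hd₀ : d ≤ P.Δ) {ℓ : ℕ}
    (hin : InOrder A ω ((ℓ - 1) * P.T)) (hl : Lively A ω ℓ)
    (hd : ∀ r, (ℓ - 1) * P.T < r → r ≤ ℓ * P.T → ∀ C, (load A ω r C : ℝ) ≤ d) :
    ∀ R ≤ ℓ * P.T, ∀ r ≤ R, Matches A ω r := by
  intro R
  induction R with
  | zero =>
    intro _ r hr
    obtain rfl := Nat.le_zero.mp hr
    exact matches_zero
  | succ R ih =>
    intro hR r hr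
    have ih' := ih (by omega)
    obtain hr | rfl : r ≤ R ∨ r = R + 1 := by omega
    · exact ih' r hr
    by_cases h : R + 1 ≤ (ℓ - 1) * P.T
    · exact hin.matches ha hQ h
    have hsR : P.T ∣ R → ∀ C, Supplied P (CML A ω R C) := by
      intro hdvd
      obtain ⟨q, rfl⟩ := hdvd
      have h1 : q < ℓ := by
        refine lt_of_mul_lt_mul_left (a := P.T) ?_ hT.le
        rw [mul_comm P.T ℓ]; omega
      have h2 : P.T * q ≤ (ℓ - 1) * P.T := by
        rw [mul_comm]; exact Nat.mul_le_mul_right _ (by omega)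
      exact hin.1.supplied ha hQ h2
    refine (ih' R le_rfl).succ hsR (fun u hu => ?_) (fun C => ?_)
    · exact comm_succ_ne_none hT ih' (by omega) hR hsR (hl.exists_stays ha) hu
    · refine (Nat.mul_le_mul_right _ ?_).trans hQ
      have h1 : (CML A ω (R + 1) C).card ≤ load A ω (R + 1) C :=
        Finset.card_le_card fun u hu => Finset.mem_filter.mpr
          ⟨(mem_CML.mp hu).1, (ih' R le_rfl).pos_succ_of_mem_CML hsR hu⟩
      have h2 : load A ω (R + 1) C ≤ P.Δ := by
        exact_mod_cast (hd (R + 1) (by omega) hR C).trans hd₀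
      omega

/-- The deterministic part of the argument: if Spartan is in order at the start of cycle `ℓ`, and if
the ideal process behaves well in this cycle, then Spartan remains in order. -/
lemma inOrder_of_lively (hT : 0 < P.T) (hk : 2 ≤ k) (ha : 0 < P.a * Real.log P.n)
    (hQ : (P.Δ + 1) * (1 + P.s * P.T) ≤ P.Q) {d : ℝ} (hΔ : 5 * d ≤ P.Δ) {ℓ : ℕ}
    (hin : InOrder A ω ((ℓ - 1) * P.T)) (hl : Lively A ω ℓ)
    (hd : ∀ r, (ℓ - 1) * P.T < r → r ≤ ℓ * P.T → ∀ C, (load A ω r C : ℝ) ≤ d) :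
    InOrder A ω (ℓ * P.T) ∧ Follows A ω ℓ fun r ω => pos A ω r := by
  have hm := matches_of_lively hT ha hQ (by linarith) hin hl hd (ℓ * P.T) le_rfl
  have h0 : (ℓ - 2) * P.T ≤ (ℓ - 1) * P.T := Nat.mul_le_mul_right _ (by omega)
  have hc : ∀ C, CommitteeRobust A ω (ℓ * P.T) C := by
    refine fun C => ⟨fun r hr => ?_, fun r hr => ?_⟩
    · by_cases h : r ≤ (ℓ - 1) * P.T
      · exact (hin.1.1 C).1 r h
      · exact hl.le_card_CML (hm r hr) (by omega) hr C
    · by_cases h : r < (ℓ - 1) * P.T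
      · exact (hin.1.1 C).2 r h
      · obtain ⟨w, hw⟩ := hl.exists_stays ha C
        exact ⟨w, Finset.mem_inter.mpr ⟨hw.mem_CML (hm r hr.le) (by omega) hr.le,
          hw.mem_CML (hm (r + 1) hr) (by omega) hr⟩⟩
  have hplaced : ∀ r < ℓ * P.T, ∀ u ∈ A.nodes r ω ∩ A.nodes (r + 1) ω,
      comm A ω (r + 1) u = some (pos A ω (r + 1) u) := by
    intro r hr u hu
    have hu' := Finset.mem_inter.mp hu
    rw [comm, hm (r + 1) hr u hu'.2, if_neg fun h => (isNew_succ.mp h).2 hu'.1]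
  refine ⟨⟨⟨hc, fun C C' hE => ⟨hc C, hc C', fun r hr u hu v hv => ?_⟩⟩, fun r hr u hu => ?_⟩,
    fun r h₁ h₂ u hu => ?_⟩
  · by_cases h : r ≤ (ℓ - 1) * P.T
    · exact (hin.1.2 C C' hE).2.2 r h u hu v hv
    · exact (hm r hr).overlay hk (hd r (by omega) hr) hΔ hE hu hv
  · simp [hplaced r hr u hu]
  · obtain ⟨r, rfl⟩ : ∃ r', r = r' + 1 := ⟨r - 1, by omega⟩
    exact hplaced r h₂ u hu

end Good

/-! ### The random bits on which the execution depends -/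

section Dependence

/-- The round in which the bits of a block are drawn. -/
def blockRound (T : ℕ) : Block → ℕ
  | .init => 0
  | .coin ℓ => (ℓ - 1) * T + 1
  | .own ℓ => drawRound T ℓ
  | .help r => drawRound T (cycleOf T r)

/-- The blocks that a `t`-late adversary knows in round `r`. -/
def view (T t r : ℕ) : Set Block := {b | blockRound T b + t ≤ r}

/-- The blocks of the bits that have any influence on the execution once the own moves up to the
one from round `a - 1` to round `a` have been made, and the tokens up to round `h` have been handed
to new nodes. -/
def used (T a h : ℕ) : Set Block :=
  {b | match b with
    | .init => True
    | .coin ℓ => ℓ * T < a + T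
    | .own ℓ => ℓ * T < a + T
    | .help r => r ≤ h}

/-- A set of blocks that contains all that the adversary knows until the end of cycle `ℓ` and all
the coins of these rounds, but no block of tokens that may have determined the committee of a node
in cycle `ℓ`. -/
def past (T M ℓ : ℕ) : Set Block :=
  {b | match b with
    | .init => M + 2 ≤ ℓ
    | .coin j => j ≤ ℓ
    | .own j => j + M + 2 ≤ ℓ
    | .help r => r + (M + 2) * T ≤ ℓ * T}

lemma sameView_iff {U : Type} {k s T t r : ℕ} {ω ω' : Bits U k s} :
    SameView T t r ω ω' ↔ ∀ b ∈ view T t r, AgreeAt b ω ω' := by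
  constructor
  · rintro ⟨h₁, h₂, h₃, h₄⟩ (_ | ℓ | ℓ | r') hb
    · exact h₁ (by simpa [view, blockRound] using hb)
    · exact h₂ ℓ hb
    · exact h₃ ℓ hb
    · exact h₄ r' hb
  · intro h
    exact ⟨fun ht => h .init (by simpa [view, blockRound] using ht), fun ℓ hℓ => h (.coin ℓ) hℓ,
      fun ℓ hℓ => h (.own ℓ) hℓ, fun r' hr' => h (.help r') hr'⟩

lemma le_cycleOf_mul {T : ℕ} (hT : 0 < T) (r : ℕ) : r ≤ cycleOf T r * T := by
  have h := Nat.lt_div_mul_add (a := r - 1) hT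
  rw [cycleOf, add_mul, one_mul]
  omega

/-- Tokens that are drawn before round `r` are consumed before round `r + 2 T`. -/
lemma mul_le_of_drawRound {T t r ℓ : ℕ} (h : drawRound T ℓ + t ≤ r) :
    ℓ * T + t ≤ r + 2 * T := by
  unfold drawRound at h
  split_ifs at h with h1
  · have := Nat.mul_le_mul_right T h1
    omega
  · obtain ⟨m, rfl⟩ : ∃ m, ℓ = m + 2 := ⟨ℓ - 2, by omega⟩
    rw [add_tsub_cancel_right] at h
    rw [add_mul]
    omega

lemma view_subset_used {T t r : ℕ} (hT : 0 < T) (ht : 2 * T ≤ t) :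
    view T t r ⊆ used T r r := by
  rintro (_ | ℓ | ℓ | r') hb
  · trivial
  · change (ℓ - 1) * T + 1 + t ≤ r at hb
    change ℓ * T < r + T
    have : ℓ * T ≤ (ℓ - 1 + 1) * T := Nat.mul_le_mul_right _ (by omega)
    rw [add_mul] at this
    omega
  · have := mul_le_of_drawRound hb
    change ℓ * T < r + T
    omega
  · have := mul_le_of_drawRound hb
    have := le_cycleOf_mul hT r'
    change r' ≤ r
    omega

lemma view_mono {T t r r' : ℕ} (h : r ≤ r') : view T t r ⊆ view T t r' :=
  fun _ hb => le_trans hb h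

lemma used_mono {T a a' h h' : ℕ} (ha : a ≤ a') (hh : h ≤ h') : used T a h ⊆ used T a' h' := by
  rintro (_ | ℓ | ℓ | r) hb
  · trivial
  · exact lt_of_lt_of_le hb (Nat.add_le_add_right ha T)
  · exact lt_of_lt_of_le hb (Nat.add_le_add_right ha T)
  · exact le_trans hb hh

lemma used_subset_below {T r : ℕ} (hT : 0 < T) : used T r r ⊆ below (r + 1) := by
  have h1 : ∀ ℓ, ℓ * T < r + T → ℓ < r + 1 := fun ℓ h => by
    by_contra! h2
    have h3 := Nat.mul_le_mul_right T h2
    have h4 := Nat.le_mul_of_pos_right r hT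
    rw [add_mul, one_mul] at h3
    omega
  rintro (_ | ℓ | ℓ | r') hb
  · trivial
  · exact h1 ℓ hb
  · exact h1 ℓ hb
  · exact Nat.lt_succ_of_le hb

lemma view_subset_past {T t M ℓ r : ℕ} (hT : 0 < T) (ht : (M + 3) * T ≤ t) (hr : r ≤ ℓ * T) :
    view T t r ⊆ past T M ℓ := by
  have e : (M + 3) * T = (M + 1) * T + 2 * T := by ring
  have key : ∀ j, drawRound T j + t ≤ r → j + M + 2 ≤ ℓ := fun j hj => by
    -- tokens consumed in cycle `j ≥ 1` are drawn after round `(j - 2) T`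
    by_contra! h
    have h1 : (ℓ + 1) * T ≤ (j + M + 2) * T := Nat.mul_le_mul_right T h
    unfold drawRound at hj
    split_ifs at hj with h2
    · have h3 : (j + M + 2) * T ≤ (M + 3) * T := Nat.mul_le_mul_right T (by omega)
      rw [add_mul] at h1
      omega
    · obtain ⟨m, rfl⟩ : ∃ m, j = m + 2 := ⟨j - 2, by omega⟩
      rw [add_tsub_cancel_right] at hj
      have h3 : (m + 2 + M + 2) * T = m * T + (M + 3) * T + T := by ring
      rw [add_mul] at h1
      omega
  rintro (_ | j | j | r') hb
  · have hb' : 0 + t ≤ r := hb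
    change M + 2 ≤ ℓ
    have h1 : (M + 3) * T ≤ ℓ * T := by omega
    have := Nat.le_of_mul_le_mul_right h1 hT
    omega
  · change (j - 1) * T + 1 + t ≤ r at hb
    change j ≤ ℓ
    have h1 : (j - 1) * T ≤ ℓ * T := by omega
    have := Nat.le_of_mul_le_mul_right h1 hT
    have h2 : (j - 1) * T < ℓ * T := by omega
    have := lt_of_mul_lt_mul_right h2 hT.le
    omega
  · exact key j hb
  · have h1 := key _ hb
    have h2 := le_cycleOf_mul hT r'
    change r' + (M + 2) * T ≤ ℓ * T
    calc r' + (M + 2) * T ≤ cycleOf T r' * T + (M + 2) * T := Nat.add_le_add_right h2 _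
      _ = (cycleOf T r' + M + 2) * T := by ring
      _ ≤ ℓ * T := Nat.mul_le_mul_right T h1

variable {P : Params} {U : Type} [DecidableEq U] {k : ℕ} {A : Adversary P U k}

lemma determined_nodes {I : Set Block} {r : ℕ} (hI : view P.T P.t r ⊆ I) :
    Determined I (A.nodes r) :=
  fun ω ω' h => A.nodes_late r ω ω' (sameView_iff.mpr fun b hb => h b (hI hb))

lemma determined_seed {I : Set Block} {r : ℕ} (hI : view P.T P.t r ⊆ I) :
    Determined I (A.seed r) :=
  fun ω ω' h => A.seed_late r ω ω' (sameView_iff.mpr fun b hb => h b (hI hb))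

lemma determined_isNew {I : Set Block} {r : ℕ} (hI : view P.T P.t r ⊆ I) :
    Determined I fun ω => IsNew A ω r := fun ω ω' h => by
  funext u
  simp only [IsNew, determined_nodes hI ω ω' h,
    determined_nodes ((view_mono (Nat.sub_le r 1)).trans hI) ω ω' h]

lemma determined_wantsMove {I : Set Block} {r : ℕ} (hI : view P.T P.t r ⊆ I)
    (hc : ∀ j, j * P.T < r + 1 + P.T → Block.coin j ∈ I) {a : Bits U k P.s → U → ℕ}
    (ha : Determined I a) : Determined I fun ω u => WantsMove A ω r (a ω u) u := fun ω ω' h => by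
  have h1 : ω.coin (r / P.T + 1) = ω'.coin (r / P.T + 1) := h (.coin _) <| hc _ <| by
    have := Nat.div_mul_le_self r P.T
    rw [add_mul, one_mul]; omega
  simp only [WantsMove, determined_isNew hI ω ω' h, ha ω ω' h, h1]

/-- The ages in the ideal process depend on the coins and on the adversary, not on the tokens that
the adversary has not seen. -/
lemma determined_age {I : Set Block} {r : ℕ} (hI : view P.T P.t r ⊆ I)
    (hc : ∀ j, j * P.T < r + P.T → Block.coin j ∈ I) : Determined I fun ω => age A ω r := by
  induction r with
  | zero => exact fun _ _ _ => rfl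
  | succ r ih =>
    have hI' := (view_mono r.le_succ).trans hI
    have ih := ih hI' fun j hj => hc j (by omega)
    intro ω ω' h
    funext u
    have h1 : WantsMove A ω r (age A ω r u) u = WantsMove A ω' r (age A ω' r u) u :=
      congrFun (determined_wantsMove hI' hc ih ω ω' h) u
    have h2 : age A ω r = age A ω' r := ih ω ω' h
    have h3 : IsNew A ω r = IsNew A ω' r := determined_isNew hI' ω ω' h
    have h4 : IsNew A ω (r + 1) = IsNew A ω' (r + 1) := determined_isNew hI ω ω' h
    beta_reduce
    rw [age, age, h1, h2, h3, h4]

lemma determined_moves {I : Set Block} {r : ℕ} (hI : view P.T P.t r ⊆ I)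
    (hc : ∀ j, j * P.T < r + 1 + P.T → Block.coin j ∈ I) :
    Determined I fun ω => Moves A ω r :=
  determined_wantsMove hI hc (determined_age hI fun j hj => hc j (by omega))

variable [NeZero k]

lemma own_mem_used (T r h : ℕ) : Block.own (r / T + 1) ∈ used T (r + 1) h := by
  change (r / T + 1) * T < r + 1 + T
  have := Nat.div_mul_le_self r T
  rw [add_mul, one_mul]; omega

lemma coin_mem_used (T r h : ℕ) : Block.coin (r / T + 1) ∈ used T (r + 1) h :=
  own_mem_used T r h

lemma determined_hop {r : ℕ} (hT : 0 < P.T) (ht : 2 * P.T ≤ P.t)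
    {π : Bits U k P.s → U → Committee k} (hπ : Determined (used P.T r r) π) :
    Determined (used P.T (r + 1) r) fun ω => hop A ω r (π ω) := fun ω ω' h => by
  have h1 : Moves A ω r = Moves A ω' r := determined_moves ((view_subset_used hT ht).trans
    (used_mono r.le_succ le_rfl)) (fun j hj => hj) ω ω' h
  have h2 : ω.own (r / P.T + 1) = ω'.own (r / P.T + 1) := h _ (own_mem_used P.T r r)
  have h3 := hπ.mono (used_mono r.le_succ le_rfl) ω ω' h
  funext u
  beta_reduce
  rw [hop, hop, h1, h2, h3]

lemma determined_pos (hT : 0 < P.T) (ht : 2 * P.T ≤ P.t) (r : ℕ) :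
    Determined (used P.T r r) fun ω => pos A ω r := by
  induction r with
  | zero => exact fun ω ω' h => h .init trivial
  | succ r ih =>
    intro ω ω' h
    have h1 : hop A ω r (pos A ω r) = hop A ω' r (pos A ω' r) :=
      (determined_hop hT ht ih).mono (used_mono le_rfl r.le_succ) ω ω' h
    have h2 : ω.help (r + 1) = ω'.help (r + 1) := h (.help _) (le_refl (r + 1))
    have hI := view_subset_used (r := r + 1) hT ht
    have h3 : IsNew A ω (r + 1) = IsNew A ω' (r + 1) := determined_isNew hI ω ω' h
    funext u
    beta_reduce
    rw [pos, pos, determined_seed hI ω ω' h, h1, h2, h3]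

lemma determined_run (hT : 0 < P.T) (ht : 2 * P.T ≤ P.t) (r : ℕ) :
    Determined (used P.T r r) fun ω => run A ω r := by
  induction r with
  | zero =>
    intro ω ω' h
    have h1 : ω.init = ω'.init := h .init trivial
    simp only [run, h1, determined_nodes (view_subset_used hT ht) ω ω' h]
  | succ r ih =>
    intro ω ω' h
    have hI := view_subset_used (r := r + 1) hT ht
    have h1 := ih.mono (used_mono r.le_succ r.le_succ) ω ω' h
    have h2 := determined_nodes (A := A) ((view_mono r.le_succ).trans hI) ω ω' h
    have h3 := determined_nodes (A := A) hI ω ω' h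
    have h4 : ω.help (r + 1) = ω'.help (r + 1) := h (.help _) (le_refl (r + 1))
    have h5 : ω.own (r / P.T + 1) = ω'.own (r / P.T + 1) := h _ (own_mem_used P.T r _)
    have h6 : ω.coin (r / P.T + 1) = ω'.coin (r / P.T + 1) := h _ (coin_mem_used P.T r _)
    have h7 : ∀ σ, request A ω r σ = request A ω' r σ := fun σ => by
      funext u
      unfold request
      rw [h2, h5, h6]
    have h8 : ∀ σ, stepOld A ω r σ = stepOld A ω' r σ := fun σ => by
      funext u
      unfold stepOld Remains
      rw [h7, h2, h3]
    have h9 : ∀ σ, stepNew A ω r σ = stepNew A ω' r σ := fun σ => by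
      funext u
      unfold stepNew
      rw [h8, h2, h3, h4, determined_seed hI ω ω' h]
    have h10 : run A ω r = run A ω' r := h1
    beta_reduce
    rw [run, run]
    unfold step
    rw [h10, h2, h3, h8, h9]

lemma determined_CML (hT : 0 < P.T) (ht : 2 * P.T ≤ P.t) (r : ℕ) :
    Determined (used P.T r r) fun ω => CML A ω r := fun ω ω' h => by
  funext C
  simp only [CML, determined_run (A := A) hT ht r ω ω' h,
    determined_nodes (A := A) (view_subset_used hT ht) ω ω' h]

lemma determined_inOrder (hT : 0 < P.T) (ht : 2 * P.T ≤ P.t) (R : ℕ) :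
    Determined (used P.T R R) (fun ω => Robust A ω R) ∧
      Determined (used P.T R R) (fun ω => InOrder A ω R) := by
  have hC : ∀ r ≤ R, Determined (used P.T R R) fun ω => CML A ω r := fun r hr =>
    (determined_CML hT ht r).mono (used_mono hr hr)
  have hN : ∀ r ≤ R, Determined (used P.T R R) (A.nodes r) := fun r hr =>
    determined_nodes ((view_subset_used hT ht).trans (used_mono hr hr))
  have hO : ∀ r ≤ R, Determined (used P.T R R) fun ω => Overlay A ω r := fun r hr ω ω' h => by
    have h1 : Wants A ω r = Wants A ω' r := by
      funext u v
      simp only [Wants, hC r hr ω ω' h]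
    have h2 : demand A ω r = demand A ω' r := by
      unfold demand
      rw [hN r hr ω ω' h, h1]
    funext u v
    simp only [Overlay, h1, h2]
  have hR : Determined (used P.T R R) fun ω => Robust A ω R := by
    intro ω ω' h
    have h1 : ∀ C, CommitteeRobust A ω R C = CommitteeRobust A ω' R C := fun C => by
      unfold CommitteeRobust
      congr 1
      · exact propext <| forall₂_congr fun r hr => by
          have e : CML A ω r = CML A ω' r := hC r hr ω ω' h
          rw [e]
      · exact propext <| forall₂_congr fun r hr => by
          have e : CML A ω r = CML A ω' r := hC r hr.le ω ω' h
          have e' : CML A ω (r + 1) = CML A ω' (r + 1) := hC (r + 1) hr ω ω' h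
          rw [e, e']
    have h2 : ∀ C C', EdgeRobust A ω R C C' = EdgeRobust A ω' R C C' := fun C C' => by
      unfold EdgeRobust
      rw [h1, h1]
      congr 2
      exact propext <| forall₂_congr fun r hr => by
        have e : CML A ω r = CML A ω' r := hC r hr ω ω' h
        have e' : Overlay A ω r = Overlay A ω' r := hO r hr ω ω' h
        rw [e, e']
    simp only [Robust, h1, h2]
  refine ⟨hR, hR.comp₂ (F' := fun ω => Placed A ω R) ?_ And⟩
  intro ω ω' h
  unfold Placed
  refine propext <| forall₂_congr fun r hr => ?_
  have h1 := ((determined_run (A := A) hT ht (r + 1)).mono (used_mono hr hr)) ω ω' h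
  simp only [comm, hN r hr.le ω ω' h, hN (r + 1) hr ω ω' h, h1]

end Dependence

/-! ### The ideal committees are uniform and independent -/

section Uniform

variable {U : Type} [Fintype U] {k s : ℕ} [NeZero k] {p : unitInterval}

lemma Determined.measurableSet_fiber {K : Set Block} {R : ℕ} (hK : K ⊆ below R) {β : Type*}
    {Z : Bits U k s → β} (hZ : Determined K Z) (z : β) : MeasurableSet {ω | Z ω = z} :=
  Determined.measurableSet (R := R) ((hZ.comp (· = z)).mono hK)

/-- An event about a fresh block of bits may depend on other blocks through `Z`: if it has
probability `q` for each value of `Z`, then it has conditional probability `q` given `B`. -/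
lemma law_real_inter_fresh {K : Set Block} {b : Block} {R : ℕ} (hK : K ⊆ below R)
    (hb : b ∈ below R) (hbK : b ∉ K) {B : Set (Bits U k s)} (hB : Determined K (· ∈ B))
    {β : Type*} [Fintype β] {Z : Bits U k s → β} (hZ : Determined K Z)
    {F : β → Set (Bits U k s)} (hF : ∀ z, Determined {b} (· ∈ F z)) {q : ℝ}
    (hq : ∀ ω ∈ B, (law U k s p).real (F (Z ω)) = q) :
    (law U k s p).real (B ∩ {ω | ω ∈ F (Z ω)}) = (law U k s p).real B * q := by
  refine measureReal_eq_of_fiber (fun z => hZ.measurableSet_fiber hK z) fun z => ?_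
  have h1 : B ∩ {ω | ω ∈ F (Z ω)} ∩ {ω | Z ω = z} = (B ∩ {ω | Z ω = z}) ∩ F z := by
    ext ω
    simp only [Set.mem_inter_iff, Set.mem_ofPred_eq]
    constructor
    · rintro ⟨⟨h, h'⟩, rfl⟩; exact ⟨⟨h, rfl⟩, h'⟩
    · rintro ⟨⟨h, rfl⟩, h'⟩; exact ⟨⟨h, h'⟩, rfl⟩
  have h2 : Determined K (· ∈ B ∩ {ω | Z ω = z}) := hB.comp₂ (hZ.comp (· = z)) And
  rw [h1, h2.indep (hF z) (Set.disjoint_singleton_right.mpr hbK) hK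
    (Set.singleton_subset_iff.mpr hb)]
  obtain h | ⟨ω, hω⟩ := (B ∩ {ω | Z ω = z}).eq_empty_or_nonempty
  · simp [h]
  · obtain ⟨hω, rfl⟩ := hω
    rw [hq ω hω]

variable {P : Params} [DecidableEq U] {A : Adversary P U k}

/-- The committees `π` of any nodes whose last refreshments, in the rounds given by `ρ`, came after
the start of cycle `ℓ - M - 1` are uniform, independent, and independent of the past. This is stated
for a set `S` of nodes and events `B` under which all nodes of `S` have been refreshed. -/
def UniformOn (P : Params) (p : unitInterval) (ℓ : ℕ) (π : Bits U k P.s → U → Committee k)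
    (ρ : Bits U k P.s → U → ℕ) : Prop :=
  ∀ (S : Finset U) (x : U → Committee k) (B : Set (Bits U k P.s)),
    Determined (past P.T P.M ℓ) (· ∈ B) →
    (∀ ω ∈ B, ∀ u ∈ S, ℓ * P.T < ρ ω u + (P.M + 2) * P.T) →
    (law U k P.s p).real (B ∩ {ω | ∀ u ∈ S, π ω u = x u}) =
      (law U k P.s p).real B * (1 / (k * 2 ^ k : ℝ)) ^ S.card

/-- Replacing some of the committees by the destinations of tokens from a fresh block keeps them
uniform and independent. The set `S` is split into the nodes that get a new committee and the
others; this splitting, and the assignment of the tokens to the nodes, are known in advance. -/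
lemma UniformOn.renew {ℓ R : ℕ} {π π' : Bits U k P.s → U → Committee k}
    {ρ ρ' : Bits U k P.s → U → ℕ} (hu : UniformOn P p ℓ π ρ)
    {K : Set Block} {b : Block} (hK : past P.T P.M ℓ ∪ K ⊆ below R) (hb : b ∈ below R)
    (hbK : b ∉ past P.T P.M ℓ ∪ K) (hπ : Determined K π)
    {E : Type*} [Fintype E] {tok : E → U → Bits U k P.s → Token k}
    (htok : ∀ e u, Determined {b} (tok e u))
    {ren : Bits U k P.s → U → Prop} (hren : Determined (past P.T P.M ℓ) ren)
    {ε : Bits U k P.s → E} (hε : Determined (past P.T P.M ℓ) ε) {src : E → U → U}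
    (hπ' : ∀ ω u, ren ω u → π' ω u = (tok (ε ω) u ω).dst (π ω (src (ε ω) u)))
    (hπ'' : ∀ ω u, ¬ ren ω u → π' ω u = π ω u) (hρ : ∀ ω u, ¬ ren ω u → ρ' ω u = ρ ω u)
    (hq : ∀ ω (S : Finset U), (∀ u ∈ S, ren ω u) → ∀ g : U → Token k,
      (law U k P.s p).real {ω' | ∀ u ∈ S, tok (ε ω) u ω' = g u} =
        (1 / (k * 2 ^ k : ℝ)) ^ S.card) :
    UniformOn P p ℓ π' ρ' := by
  classical
  intro S x B hB hS
  have hZ : Determined (past P.T P.M ℓ) fun ω => (S.filter (ren ω), ε ω) := fun ω ω' h => by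
    have e : ren ω = ren ω' := hren ω ω' h
    beta_reduce
    rw [e, hε ω ω' h]
  have hKp := Set.subset_union_left.trans hK
  refine measureReal_eq_of_fiber (fun z => hZ.measurableSet_fiber hKp z) fun z => ?_
  set B' := B ∩ {ω | (S.filter (ren ω), ε ω) = z} with hB'
  have hdB' : Determined (past P.T P.M ℓ) (· ∈ B') := hB.comp₂ (hZ.comp (· = z)) And
  have hmem : ∀ ω ∈ B', ∀ u, u ∈ z.1 ↔ u ∈ S ∧ ren ω u := by
    rintro ω ⟨-, rfl⟩ u
    simp
  have hmem' : ∀ ω ∈ B', ε ω = z.2 := by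
    rintro ω ⟨-, rfl⟩
    rfl
  obtain hne | ⟨ω₀, hω₀⟩ := B'.eq_empty_or_nonempty
  · have : B ∩ {ω | ∀ u ∈ S, π' ω u = x u} ∩ {ω | (S.filter (ren ω), ε ω) = z} = ∅ := by
      rw [Set.inter_right_comm, ← hB', hne, Set.empty_inter]
    simp [this, hne]
  have hBB : B' ⊆ B := Set.inter_subset_left
  clear_value B'
  have hsub : z.1 ⊆ S := fun u hu => ((hmem ω₀ hω₀ u).mp hu).1
  have h1 : B ∩ {ω | ∀ u ∈ S, π' ω u = x u} ∩ {ω | (S.filter (ren ω), ε ω) = z} =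
      (B' ∩ {ω | ∀ u ∈ S \ z.1, π ω u = x u}) ∩
        {ω | ω ∈ {ω' | ∀ u ∈ z.1, tok z.2 u ω' = tokenTo (π ω (src z.2 u)) (x u)}} := by
    rw [Set.inter_right_comm, ← hB', Set.inter_assoc B']
    ext ω
    refine and_congr_right fun hω => ?_
    have a1 := hmem ω hω
    have a2 := hmem' ω hω
    simp only [Set.mem_inter_iff, Set.mem_ofPred_eq, ← dst_eq_iff, Finset.mem_sdiff]
    constructor
    · refine fun h => ⟨fun u hu => ?_, fun u hu => ?_⟩
      · rw [← hπ'' ω u fun hr => hu.2 ((a1 u).mpr ⟨hu.1, hr⟩), h u hu.1]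
      · rw [← h u (hsub hu), hπ' ω u ((a1 u).mp hu).2, a2]
    · intro h u hu
      by_cases hr : ren ω u
      · rw [hπ' ω u hr, a2, h.2 u ((a1 u).mpr ⟨hu, hr⟩)]
      · rw [hπ'' ω u hr, h.1 u ⟨hu, fun hz => hr ((a1 u).mp hz).2⟩]
  have h2 : Determined (past P.T P.M ℓ ∪ K) (· ∈ B' ∩ {ω | ∀ u ∈ S \ z.1, π ω u = x u}) :=
    (hdB'.mono Set.subset_union_left).comp₂
      ((hπ.mono Set.subset_union_right).comp fun π => ∀ u ∈ S \ z.1, π u = x u) And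
  rw [h1, law_real_inter_fresh hK hb hbK h2 (hπ.mono Set.subset_union_right)
    (F := fun π => {ω' | ∀ u ∈ z.1, tok z.2 u ω' = tokenTo (π (src z.2 u)) (x u)})
    (q := (1 / (k * 2 ^ k : ℝ)) ^ z.1.card), hu _ x B' hdB', mul_assoc, ← pow_add,
    Finset.card_sdiff_add_card_eq_card hsub]
  · rintro ω hω u hu'
    obtain ⟨hu₁, hu₂⟩ := Finset.mem_sdiff.mp hu'
    rw [← hρ ω u fun hr => hu₂ ((hmem ω hω u).mpr ⟨hu₁, hr⟩)]
    exact hS ω (hBB hω) u hu₁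
  · intro π
    exact Determined.forall fun u => Determined.forall fun _ => (htok z.2 u).comp (· = _)
  · rintro ω ⟨hω, -⟩
    have := hq ω z.1 (fun u hu => ((hmem ω hω u).mp hu).2)
      fun u => tokenTo (π ω (src z.2 u)) (x u)
    rw [hmem' ω hω] at this
    exact this

lemma past_subset_below {T M ℓ : ℕ} (hT : 0 < T) : past T M ℓ ⊆ below (ℓ * T + 1) := by
  have := Nat.le_mul_of_pos_right ℓ hT
  rintro (_ | j | j | j) hb
  · trivial
  · exact Nat.lt_succ_of_le (le_trans hb this)
  · change j + M + 2 ≤ ℓ at hb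
    change j < ℓ * T + 1
    omega
  · change j + (M + 2) * T ≤ ℓ * T at hb
    change j < ℓ * T + 1
    omega

lemma coin_mem_past {T M ℓ a : ℕ} (ha : a ≤ ℓ * T) (j : ℕ) (hj : j * T < a + T) :
    Block.coin j ∈ past T M ℓ := by
  change j ≤ ℓ
  have h : j * T < (ℓ + 1) * T := by rw [add_mul, one_mul]; omega
  exact Nat.lt_succ_iff.mp (lt_of_mul_lt_mul_right h (Nat.zero_le T))

lemma own_notMem_past {T M ℓ r : ℕ} (hT : 0 < T) (hr : (ℓ - (M + 2)) * T ≤ r) :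
    Block.own (r / T + 1) ∉ past T M ℓ := by
  change ¬ (r / T + 1 + M + 2 ≤ ℓ)
  have := (Nat.le_div_iff_mul_le hT).mpr hr
  omega

lemma own_notMem_used {T r : ℕ} (h : T ∣ r) : Block.own (r / T + 1) ∉ used T r r := by
  change ¬ ((r / T + 1) * T < r + T)
  rw [add_mul, one_mul, Nat.div_mul_cancel h]
  exact lt_irrefl _

/-- In round `r ≤ ℓ T`, the ideal committees of those nodes whose last refreshment is recent enough
are uniform, independent, and independent of the past. -/
lemma uniformOn_pos (hT : 0 < P.T) (ht : (P.M + 3) * P.T ≤ P.t) (hM : 2 ≤ P.M) {ℓ r : ℕ}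
    (h₀ : (ℓ - (P.M + 2)) * P.T ≤ r) (h₁ : r ≤ ℓ * P.T) :
    UniformOn P p ℓ (fun ω => pos A ω r) (fun ω => refresh A ω r) := by
  have ht2 : 2 * P.T ≤ P.t := le_trans (Nat.mul_le_mul_right _ (by omega)) ht
  have hpb := past_subset_below (M := P.M) (ℓ := ℓ) hT
  induction r, h₀ using Nat.le_induction with
  | base =>
    intro S x B hB hS
    by_cases hℓ : P.M + 2 ≤ ℓ
    · obtain rfl | ⟨u, hu⟩ := S.eq_empty_or_nonempty
      · simp
      -- no node has been refreshed yet
      · have hBe : B = ∅ := Set.eq_empty_of_forall_notMem fun ω hω => by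
          have h1 : ℓ * P.T < refresh A ω ((ℓ - (P.M + 2)) * P.T) u + (P.M + 2) * P.T :=
            hS ω hω u hu
          have h2 := refresh_le A ω ((ℓ - (P.M + 2)) * P.T) u
          have h3 : (ℓ - (P.M + 2)) * P.T + (P.M + 2) * P.T = ℓ * P.T := by
            rw [← add_mul, Nat.sub_add_cancel hℓ]
          omega
        simp [hBe]
    · have h0 : (ℓ - (P.M + 2)) * P.T = 0 := by
        rw [Nat.sub_eq_zero_of_le (by omega), zero_mul]
      have h1 : {ω | ∀ u ∈ S, pos A ω ((ℓ - (P.M + 2)) * P.T) u = x u} =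
          {ω : Bits U k P.s | ∀ u ∈ S, ω.init u = x u} := by rw [h0]; rfl
      rw [h1, hB.indep (J := {Block.init}) (B := {ω | ∀ u ∈ S, ω.init u = x u})
        (determined_init.comp fun g => ∀ u ∈ S, g u = x u)
        (Set.disjoint_singleton_right.mpr hℓ) hpb
        (Set.singleton_subset_iff.mpr trivial), law_real_init]
  | succ r h₀ ih =>
    have hu := ih (by omega)
    have hv : view P.T P.t (r + 1) ⊆ past P.T P.M ℓ := view_subset_past hT ht h₁
    have hv' : view P.T P.t r ⊆ past P.T P.M ℓ := (view_mono r.le_succ).trans hv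
    have hub : past P.T P.M ℓ ∪ used P.T r r ⊆ below (ℓ * P.T + 1) := by
      refine Set.union_subset hpb ((used_mono (a' := ℓ * P.T) (h' := ℓ * P.T)
        (by omega) (by omega)).trans (used_subset_below hT))
    have hub' : past P.T P.M ℓ ∪ used P.T (r + 1) r ⊆ below (ℓ * P.T + 1) := by
      refine Set.union_subset hpb ((used_mono (a' := ℓ * P.T) (h' := ℓ * P.T)
        (by omega) (by omega)).trans (used_subset_below hT))
    have hmid : UniformOn P p ℓ (fun ω => hop A ω r (pos A ω r))
        (fun ω u => open scoped Classical in
          if Moves A ω r u then r + 1 else refresh A ω r u) := by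
      by_cases hTr : P.T ∣ r
      · have hm : Determined (past P.T P.M ℓ) fun ω => Moves A ω r :=
          determined_moves hv' (coin_mem_past h₁)
        refine hu.renew (b := .own (r / P.T + 1)) (E := Unit) (K := used P.T r r)
          (tok := fun _ u ω => ω.own (r / P.T + 1) u) (ren := fun ω u => Moves A ω r u)
          (ε := fun _ => ()) (src := fun _ u => u) (R := ℓ * P.T + 1) hub ?_ ?_
          (determined_pos hT ht2 r) (fun _ u => (determined_own _).comp fun g => g u)
          hm (determined_const _ _) ?_ ?_ ?_ ?_
        · exact hub' (.inr (own_mem_used P.T r r))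
        · exact fun h => h.elim (own_notMem_past hT h₀) (own_notMem_used hTr)
        · exact fun ω u h => hop_of_moves h
        · exact fun ω u h => hop_of_not_moves h
        · exact fun ω u h => if_neg h
        · exact fun ω S _ g => law_real_own _ S g
      · have h1 : ∀ ω u, ¬ Moves A ω r u := fun ω u h => hTr h.dvd
        have h2 : (fun ω => hop A ω r (pos A ω r)) = fun ω => pos A ω r :=
          funext₂ fun ω u => hop_of_not_moves (h1 ω u)
        simpa [h2, h1] using hu
    have hn : Determined (past P.T P.M ℓ) fun ω => IsNew A ω (r + 1) := determined_isNew hv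
    refine hmid.renew (b := .help (r + 1)) (E := U → U × Fin P.s) (K := used P.T (r + 1) r)
      (tok := fun e u ω => ω.help (r + 1) (e u).1 (e u).2)
      (ren := fun ω u => IsNew A ω (r + 1) u)
      (ε := fun ω => A.seed (r + 1) ω) (src := fun e u => (e u).1) (R := ℓ * P.T + 1) hub' ?_ ?_
      (determined_hop hT ht2 (determined_pos hT ht2 r))
      (fun e u => (determined_help _).comp fun g => g (e u).1 (e u).2)
      hn (determined_seed hv) ?_ ?_ ?_ ?_
    · exact Nat.lt_succ_of_le h₁
    · rintro (h | h)
      · change r + 1 + (P.M + 2) * P.T ≤ ℓ * P.T at h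
        have h2 : ℓ * P.T ≤ (ℓ - (P.M + 2) + (P.M + 2)) * P.T := Nat.mul_le_mul_right _ (by omega)
        rw [add_mul] at h2
        omega
      · exact absurd h (by change ¬ r + 1 ≤ r; omega)
    · exact fun ω u h => if_pos h
    · exact fun ω u h => if_neg h
    · intro ω u h
      have h' : ¬ IsNew A ω (r + 1) u := h
      rw [Spartan.refresh]
      by_cases hm : Moves A ω r u
      · rw [if_pos (.inr hm), if_pos hm]
      · rw [if_neg (not_or.mpr ⟨h', hm⟩), if_neg hm]
    · intro ω S hS g
      refine law_real_help _ S ((A.seed_inj r ω).mono fun u hu => ?_) g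
      have := isNew_succ.mp (hS u hu)
      simp [this]

/-- The ideal committees of all nodes in a round of cycle `ℓ` (or at the end of the bootstrap
phase, for `ℓ = 0`) are uniform, independent, and independent of the past. -/
lemma law_real_pos (hT : 0 < P.T) (ht : (P.M + 3) * P.T ≤ P.t) (hM : 2 ≤ P.M) {ℓ r : ℕ}
    (h₀ : ℓ * P.T < r + P.T) (h₁ : r ≤ ℓ * P.T) {B : Set (Bits U k P.s)}
    (hB : Determined (past P.T P.M ℓ) (· ∈ B)) (S : Finset U) (x : U → Committee k) :
    (law U k P.s p).real (B ∩ {ω | ∀ u ∈ S, pos A ω r u = x u}) =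
      (law U k P.s p).real B * (1 / (k * 2 ^ k : ℝ)) ^ S.card := by
  refine uniformOn_pos hT ht hM ?_ h₁ S x B hB fun ω _ u _ => lt_refresh_add hT h₀ u
  have h2 : (ℓ - (P.M + 2)) * P.T ≤ (ℓ - 1) * P.T := Nat.mul_le_mul_right _ (by omega)
  rw [Nat.sub_mul ℓ 1, one_mul] at h2
  omega

lemma isUniformPlacement_pos (hT : 0 < P.T) (ht : (P.M + 3) * P.T ≤ P.t) (hM : 2 ≤ P.M) (ℓ : ℕ) :
    IsUniformPlacement P p ℓ (fun r ω => pos A ω r) := by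
  intro r h₀ h₁
  have ht2 : 2 * P.T ≤ P.t := le_trans (Nat.mul_le_mul_right _ (by omega)) ht
  refine ⟨((determined_pos hT ht2 r).mono (used_subset_below hT)).measurable,
    fun E hE x => ?_⟩
  have hE' : Determined (past P.T P.M ℓ) (· ∈ E) := fun ω ω' h =>
    propext (hE ω ω' (sameView_iff.mpr fun b hb => h b (view_subset_past hT ht h₁ hb)))
  have h2 : ℓ * P.T < r + P.T := by
    rw [Nat.sub_mul, one_mul] at h₀
    omega
  have h3 := law_real_pos (p := p) (A := A) hT ht hM h2 h₁ hE' Finset.univ x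
  simpa [funext_iff] using h3

end Uniform

/-! ### Nodes that stay -/

section Staying

variable {P : Params} {U : Type} [DecidableEq U] {k : ℕ} [NeZero k]
  {A : Adversary P U k} {ω : Bits U k P.s} {w : U}

omit [NeZero k] in
/-- All but `J ε n` of the nodes are present for `J` consecutive windows of length `τ`. -/
lemma card_absent_le (A : Adversary P U k) (ω : Bits U k P.s) (r J : ℕ) :
    (((A.nodes r ω).filter fun u => ∃ i ≤ J * P.τ, u ∉ A.nodes (r + i) ω).card : ℝ) ≤
      J * (P.ε * P.n) := by
  induction J with
  | zero =>
    have : ((A.nodes r ω).filter fun u => ∃ i ≤ 0 * P.τ, u ∉ A.nodes (r + i) ω) = ∅ := by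
      refine Finset.filter_eq_empty_iff.mpr ?_
      rintro u hu ⟨i, hi, h⟩
      obtain rfl : i = 0 := by omega
      exact h hu
    rw [this]
    simp
  | succ J ih =>
    have h1 := A.deleted (r + J * P.τ) ω P.τ le_rfl
    have h2 : ((A.nodes r ω).filter fun u => ∃ i ≤ (J + 1) * P.τ, u ∉ A.nodes (r + i) ω) ⊆
        ((A.nodes r ω).filter fun u => ∃ i ≤ J * P.τ, u ∉ A.nodes (r + i) ω) ∪
        ((A.nodes (r + J * P.τ) ω).filter fun u =>
          ∃ i ≤ P.τ, u ∉ A.nodes (r + J * P.τ + i) ω) := by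
      intro u hu
      obtain ⟨hu, i, hi, h⟩ := Finset.mem_filter.mp hu
      rw [Finset.mem_union, Finset.mem_filter, Finset.mem_filter]
      by_cases h3 : ∃ i ≤ J * P.τ, u ∉ A.nodes (r + i) ω
      · exact .inl ⟨hu, h3⟩
      · push Not at h3
        rw [add_mul, one_mul] at hi
        have h4 : J * P.τ < i := by
          by_contra! h5
          exact h (h3 i h5)
        exact .inr ⟨h3 _ le_rfl, i - J * P.τ, by omega, by
          rwa [show r + J * P.τ + (i - J * P.τ) = r + i by omega]⟩
    have h3 : (_ : ℝ) ≤ _ := Nat.cast_le.mpr ((Finset.card_le_card h2).trans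
      (Finset.card_union_le _ _))
    push_cast at h3 ⊢
    linarith

open scoped Classical in
/-- The nodes that are present in all rounds from `a` to `b`. -/
def present [Fintype U] (A : Adversary P U k) (a b : ℕ) (ω : Bits U k P.s) : Finset U :=
  Finset.univ.filter fun w => ∀ r, a ≤ r → r ≤ b → w ∈ A.nodes r ω

omit [NeZero k] in
/-- The churn rate leaves at least half of the nodes in place for `J` windows of length `τ`. -/
lemma le_card_present [Fintype U] {a b J : ℕ} (hab : b ≤ a + J * P.τ) (hJ : J * P.ε ≤ 1 / 2) :
    (P.n : ℝ) / 2 ≤ (present A a b ω).card := by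
  classical
  have h1 := card_absent_le A ω a J
  have h2 : A.nodes a ω ⊆
      ((A.nodes a ω).filter fun u => ∃ i ≤ J * P.τ, u ∉ A.nodes (a + i) ω) ∪
        present A a b ω := by
    intro u hu
    rw [Finset.mem_union, Finset.mem_filter, present, Finset.mem_filter]
    by_cases h : ∃ i ≤ J * P.τ, u ∉ A.nodes (a + i) ω
    · exact .inl ⟨hu, h⟩
    · push Not at h
      refine .inr ⟨Finset.mem_univ u, fun r hr hr' => ?_⟩
      have := h (r - a) (by omega)
      rwa [show a + (r - a) = r by omega] at this
  have h3 : (_ : ℝ) ≤ _ := Nat.cast_le.mpr ((Finset.card_le_card h2).trans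
    (Finset.card_union_le _ _))
  have h4 := (A.card_nodes a ω).1
  have h5 : J * (P.ε * P.n) ≤ 1 / 2 * P.n := by
    rw [← mul_assoc]
    exact mul_le_mul_of_nonneg_right hJ (Nat.cast_nonneg _)
  push_cast at h3
  linarith

omit [NeZero k] in
lemma not_isNew_of_present {a b : ℕ} (hw : ∀ r, a ≤ r → r ≤ b → w ∈ A.nodes r ω)
    (ha : ¬ IsNew A ω a w) {r : ℕ} (h₁ : a ≤ r) (h₂ : r ≤ b) : ¬ IsNew A ω r w := by
  obtain rfl | h : a = r ∨ a < r := by omega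
  · exact ha
  · exact fun h' => h'.2.2 (hw (r - 1) (by omega) (by omega))

/-- Within a cycle, nothing happens to a node that remains present. -/
lemma pos_age_within_cycle (hT : 0 < P.T) {j : ℕ}
    (hw : ∀ r, j * P.T ≤ r → r ≤ j * P.T + P.T → w ∈ A.nodes r ω)
    (hn : ¬ IsNew A ω (j * P.T) w) {r : ℕ} (h₁ : j * P.T + 1 ≤ r) (h₂ : r ≤ j * P.T + P.T) :
    pos A ω r w = pos A ω (j * P.T + 1) w ∧ age A ω r w = age A ω (j * P.T + 1) w ∧
      (r < j * P.T + P.T → ¬ Moves A ω r w) := by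
  have hnm : ∀ r, j * P.T + 1 ≤ r → r < j * P.T + P.T → ¬ P.T ∣ r := by
    rintro r h h' ⟨q, rfl⟩
    rw [mul_comm P.T q] at h h'
    have h3 : j * P.T < q * P.T := h
    have h4 : q * P.T < (j + 1) * P.T := by rw [add_mul, one_mul]; exact h'
    have := lt_of_mul_lt_mul_right h3 hT.le
    have := lt_of_mul_lt_mul_right h4 hT.le
    omega
  induction r, h₁ using Nat.le_induction with
  | base => exact ⟨rfl, rfl, fun h hm => hnm _ le_rfl h hm.dvd⟩
  | succ r h₁ ih =>
    obtain ⟨ih₁, ih₂, ih₃⟩ := ih (by omega)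
    have hn₀ := not_isNew_of_present hw hn (r := r) (by omega) (by omega)
    have hn₁ := not_isNew_of_present hw hn (r := r + 1) (by omega) (by omega)
    have hm := ih₃ (by omega)
    refine ⟨?_, ?_, fun h hm => hnm _ (by omega) h hm.dvd⟩
    · rw [pos_succ_of_not_isNew hn₁, hop_of_not_moves hm, ih₁]
    · rw [age_succ_of_not_moves hn₀ hn₁ hm, if_neg (hnm r h₁ (by omega)), ih₂]

/-- A young node whose coin says so stays in its committee for a cycle. -/
lemma stays_cycle (hT : 0 < P.T) {j : ℕ}
    (hw : ∀ r, j * P.T ≤ r → r ≤ j * P.T + P.T → w ∈ A.nodes r ω)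
    (hn : ¬ IsNew A ω (j * P.T) w) (ha : age A ω (j * P.T) w < P.M)
    (hc : ω.coin (j + 1) w = false) :
    age A ω ((j + 1) * P.T) w = age A ω (j * P.T) w + 1 ∧
      ∀ r, j * P.T ≤ r → r ≤ j * P.T + P.T → pos A ω r w = pos A ω (j * P.T) w ∧
        (r < j * P.T + P.T → ¬ Moves A ω r w) := by
  have hm : ¬ Moves A ω (j * P.T) w := fun h => by
    have := h.2.2
    rw [Nat.mul_div_cancel _ hT, hc] at this
    simp only [Bool.false_eq_true, false_or] at this
    omega
  have hn₁ := not_isNew_of_present hw hn (r := j * P.T + 1) (by omega) (by omega)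
  have hp : pos A ω (j * P.T + 1) w = pos A ω (j * P.T) w := by
    rw [pos_succ_of_not_isNew hn₁, hop_of_not_moves hm]
  constructor
  · rw [add_mul, one_mul, (pos_age_within_cycle hT hw hn (by omega) le_rfl).2.1,
      age_succ_of_not_moves hn hn₁ hm, if_pos ⟨j, mul_comm _ _⟩]
  · intro r h₁ h₂
    obtain rfl | h : r = j * P.T ∨ j * P.T + 1 ≤ r := by omega
    · exact ⟨rfl, fun _ => hm⟩
    · obtain ⟨h3, -, h4⟩ := pos_age_within_cycle hT hw hn h h₂
      exact ⟨h3.trans hp, h4⟩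

/-- A node whose coin says so moves at the start of a cycle, and has age `0` at its end. -/
lemma moves_cycle (hT : 0 < P.T) {j : ℕ}
    (hw : ∀ r, j * P.T ≤ r → r ≤ j * P.T + P.T → w ∈ A.nodes r ω)
    (hn : ¬ IsNew A ω (j * P.T) w) (hc : ω.coin (j + 1) w = true) :
    age A ω ((j + 1) * P.T) w = 0 ∧
      pos A ω ((j + 1) * P.T) w = (ω.own (j + 1) w).dst (pos A ω (j * P.T) w) := by
  have hm : Moves A ω (j * P.T) w := ⟨⟨j, mul_comm _ _⟩, hn, .inl <| by
    rw [Nat.mul_div_cancel _ hT]; exact hc⟩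
  have hn₁ := not_isNew_of_present hw hn (r := j * P.T + 1) (by omega) (by omega)
  obtain ⟨h1, h2, -⟩ := pos_age_within_cycle hT hw hn (r := j * P.T + P.T) (by omega) le_rfl
  rw [add_mul, one_mul, h1, h2, age_succ_of_moves hm, pos_succ_of_not_isNew hn₁,
    hop_of_moves hm, Nat.mul_div_cancel _ hT]
  exact ⟨rfl, rfl⟩

/-- A member of `C` of age `0` whose next two coins say so stays for two cycles; this is where
`M ≥ 2` is needed. -/
lemma stays_of_age_zero (hT : 0 < P.T) (hM : 2 ≤ P.M) {j : ℕ} {C : Committee k}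
    (hw : ∀ r, j * P.T ≤ r → r ≤ (j + 2) * P.T → w ∈ A.nodes r ω)
    (hn : ¬ IsNew A ω (j * P.T) w) (ha : age A ω (j * P.T) w = 0)
    (hp : pos A ω (j * P.T) w = C)
    (hc₁ : ω.coin (j + 1) w = false) (hc₂ : ω.coin (j + 2) w = false) :
    Stays A ω (j + 2) C w := by
  have e1 : (j + 1) * P.T = j * P.T + P.T := by ring
  have e2 : (j + 2) * P.T = j * P.T + P.T + P.T := by ring
  obtain ⟨h1, h2⟩ := stays_cycle hT (fun r h h' => hw r h (by omega)) hn (by omega) hc₁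
  obtain ⟨-, h3⟩ := stays_cycle (j := j + 1) hT (fun r h h' => hw r (by omega) (by omega))
    (not_isNew_of_present hw hn (by omega) (by omega)) (by omega) hc₂
  intro r h h'
  rw [Nat.add_sub_cancel] at h
  refine ⟨hw r h h', not_isNew_of_present hw hn h h', ?_⟩
  rw [e1] at h3
  obtain hr | hr : r < j * P.T + P.T ∨ j * P.T + P.T ≤ r := by omega
  · exact ⟨(h2 r h hr.le).1.trans hp, fun _ => (h2 r h hr.le).2 hr⟩
  · obtain ⟨h4, h5⟩ := h3 r hr (by omega)
    exact ⟨h4.trans ((h2 _ (by omega) le_rfl).1.trans hp), fun h => h5 (by omega)⟩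

/-- In cycle `1`, a single coin suffices: truncated subtraction makes the window of `Stays` start in
round `0`. -/
lemma stays_one (hT : 0 < P.T) (hM : 2 ≤ P.M) {C : Committee k}
    (hw : ∀ r, r ≤ P.T → w ∈ A.nodes r ω) (hp : ω.init w = C) (hc : ω.coin 1 w = false) :
    Stays A ω 1 C w := by
  have hn : ¬ IsNew A ω (0 * P.T) w := by rw [zero_mul]; exact not_isNew_zero
  have hw' : ∀ r, 0 * P.T ≤ r → r ≤ 0 * P.T + P.T → w ∈ A.nodes r ω :=
    fun r _ h => hw r (by omega)
  have ha : age A ω (0 * P.T) w < P.M := by rw [zero_mul]; simp only [age]; omega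
  obtain ⟨-, h2⟩ := stays_cycle hT hw' hn ha hc
  intro r _ h'
  rw [one_mul] at h' ⊢
  have h3 := h2 r (by omega) (by omega)
  refine ⟨hw r h', not_isNew_of_present hw' hn (by omega) (by omega), h3.1.trans ?_,
    fun h => h3.2 (by omega)⟩
  rw [zero_mul]
  exact hp

end Staying

/-! ### Tail bounds for the sizes of the committees -/

section Bounds

variable {P : Params} {U : Type} [Fintype U] [DecidableEq U] {k : ℕ} [NeZero k]
  {A : Adversary P U k} {p : unitInterval}

/-- It is unlikely that the ideal process overcrowds a committee. -/
lemma law_real_load_le (hT : 0 < P.T) (ht : (P.M + 3) * P.T ≤ P.t) (hM : 2 ≤ P.M) {ℓ r : ℕ}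
    (h₀ : ℓ * P.T < r + P.T) (h₁ : r ≤ ℓ * P.T) {B : Set (Bits U k P.s)}
    (hB : Determined (past P.T P.M ℓ) (· ∈ B)) (C : Committee k) {d : ℝ} (hd : 0 ≤ d) :
    (law U k P.s p).real (B ∩ {ω | d < load A ω r C}) ≤
      (law U k P.s p).real B * Real.exp (P.f * P.n / (k * 2 ^ k) - d / 2) := by
  classical
  have ht2 : 2 * P.T ≤ P.t := le_trans (Nat.mul_le_mul_right _ (by omega)) ht
  have hpb := past_subset_below (M := P.M) (ℓ := ℓ) hT
  have hZ : Determined (past P.T P.M ℓ) (A.nodes r) :=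
    determined_nodes (view_subset_past hT ht h₁)
  refine measureReal_le_of_fiber (fun z => hZ.measurableSet_fiber hpb z) fun V => ?_
  obtain h | ⟨ω₀, hω₀⟩ := (B ∩ {ω | A.nodes r ω = V}).eq_empty_or_nonempty
  · rw [Set.inter_right_comm, h]
    simp
  have hV : (V.card : ℝ) ≤ P.f * P.n := by
    have := (A.card_nodes r ω₀).2
    rwa [show A.nodes r ω₀ = V from hω₀.2] at this
  have hpos := (determined_pos (A := A) hT ht2 r).mono (used_subset_below hT)
  obtain ⟨E, hE⟩ : ∃ E : U → Set (Bits U k P.s), ∀ v, E v = {ω | pos A ω r v = C} :=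
    ⟨_, fun _ => rfl⟩
  have hEm : ∀ v, MeasurableSet (E v) := fun v =>
    hE v ▸ Determined.measurableSet (hpos.comp fun π => π v = C)
  have hf : ∀ ω, (V.filter (ω ∈ E ·)).card = (V.filter fun v => pos A ω r v = C).card :=
    fun ω => congrArg Finset.card (Finset.filter_congr fun v _ => by rw [hE]; rfl)
  have hH : MeasurableSet {ω | d < ((V.filter (ω ∈ E ·)).card : ℝ)} := by
    simp only [hf]
    exact Determined.measurableSet (hpos.comp fun π => d < ((V.filter fun v => π v = C).card : ℝ))
  have hBV : Determined (past P.T P.M ℓ) (· ∈ B ∩ {ω | A.nodes r ω = V}) :=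
    hB.comp₂ (hZ.comp (· = V)) And
  have key := measureReal_inter_le_of_exp (μ := law U k P.s p) (B := B ∩ {ω | A.nodes r ω = V}) V
    hEm (q := 1 / (k * 2 ^ k : ℝ))
    (fun S _ => by
      simp only [hE]
      exact law_real_pos hT ht hM h₀ h₁ hBV S fun _ => C)
    (x := Real.log 2) (y := Real.log 2 * d) hH
    (fun ω hω => mul_le_mul_of_nonneg_left (show d ≤ ((V.filter (ω ∈ E ·)).card : ℝ)
      from le_of_lt (by exact hω))
      (Real.log_nonneg one_le_two))
    (by rw [Real.exp_log two_pos]; positivity)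
  rw [Real.exp_log two_pos] at key
  refine le_trans (measureReal_mono ?_) (key.trans ?_)
  · rintro ω ⟨⟨h1, h2⟩, h3⟩
    refine ⟨⟨h1, h3⟩, ?_⟩
    simp only [Set.mem_ofPred_eq, load] at h2 h3 ⊢
    rwa [hf, ← h3]
  · gcongr
    · have h4 : (V.card : ℝ) * (1 / (k * 2 ^ k) * (2 - 1)) = V.card / (k * 2 ^ k) := by ring
      rw [h4]
      gcongr
    · have := Real.log_two_gt_d9
      nlinarith

/-- A lower tail bound for the number of nodes that stay, from any sufficient condition for staying
that involves the coins of three cycles and one further block. -/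
lemma law_real_core_lt {K : Set Block} {b : Block} {R j : ℕ} (hK : K ⊆ below R)
    (hb : b ∈ below R) (hbK : b ∉ K) (hj : j + 2 < R)
    (hbc : ∀ i, b ≠ .coin i) (hcK : ∀ i, j ≤ i → .coin i ∉ K) {B : Set (Bits U k P.s)}
    (hB : Determined K (· ∈ B)) {V : Bits U k P.s → Finset U} (hV : Determined K V)
    {β : Type*} [Fintype β] {Z : Bits U k P.s → β} (hZ : Determined K Z)
    {F : β → U → Set (Bits U k P.s)} (hF : ∀ z u, Determined {b} (· ∈ F z u))
    (hF' : ∀ z (S : Finset U), (law U k P.s p).real {ω | ∀ u ∈ S, ω ∈ F z u} =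
      (1 / (k * 2 ^ k : ℝ)) ^ S.card) {ℓ : ℕ} {C : Committee k}
    (hst : ∀ ω, ∀ w ∈ V ω, ω ∈ F (Z ω) w → ω.coin j w = true → ω.coin (j + 1) w = false →
      ω.coin (j + 2) w = false → Stays A ω ℓ C w)
    {m h : ℝ} (hm : ∀ ω, m ≤ (V ω).card) :
    (law U k P.s p).real (B ∩ {ω | (core A ω ℓ C : ℝ) < h}) ≤
      (law U k P.s p).real B *
        Real.exp (h - m * (p * (1 - p) ^ 2 / (k * 2 ^ k)) / 2) := by
  classical
  have hVZ : Determined K fun ω => (V ω, Z ω) := hV.comp₂ hZ Prod.mk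
  refine measureReal_le_of_fiber (fun z => hVZ.measurableSet_fiber hK z) fun z => ?_
  set B' := B ∩ {ω | (V ω, Z ω) = z} with hB'
  have hdB' : Determined K (· ∈ B') := hB.comp₂ (hVZ.comp (· = z)) And
  set q : ℝ := p * (1 - p) ^ 2 / (k * 2 ^ k) with hq
  have hN : (1 : ℝ) ≤ k * 2 ^ k := by
    have h1 : (1 : ℝ) ≤ k := by exact_mod_cast NeZero.one_le
    have h2 : (1 : ℝ) ≤ 2 ^ k := one_le_pow₀ one_le_two
    nlinarith
  have hp0 := p.2.1
  have hp1 := p.2.2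
  have hq0 : 0 ≤ q := by positivity
  have hq1 : q ≤ 1 := by
    have h1 : (1 - (p : ℝ)) ^ 2 ≤ 1 := pow_le_one₀ (by linarith) (by linarith)
    have h2 : (p : ℝ) * (1 - p) ^ 2 ≤ 1 := mul_le_one₀ hp1 (by positivity) h1
    exact (div_le_one (by linarith)).mpr (h2.trans hN)
  have hcb : ∀ i ≤ j + 2, Block.coin i ∈ below R := fun i hi => lt_of_le_of_lt hi hj
  obtain ⟨E, hE⟩ : ∃ E : U → Set (Bits U k P.s), ∀ u, E u = {ω | ω ∈ F z.2 u ∧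
      ω.coin j u = true ∧ ω.coin (j + 1) u = false ∧ ω.coin (j + 2) u = false} :=
    ⟨_, fun _ => rfl⟩
  have hdF : ∀ S : Finset U, Determined {b} (· ∈ {ω | ∀ u ∈ S, ω ∈ F z.2 u}) := fun S =>
    Determined.forall fun u => Determined.forall fun _ => hF z.2 u
  have hdc : ∀ i (c : Bool) (S : Finset U), Determined {Block.coin i}
      (· ∈ {ω : Bits U k P.s | ∀ u ∈ S, ω.coin i u = c}) := fun i c S =>
    (determined_coin i).comp fun g => ∀ u ∈ S, g u = c
  have hdE : ∀ u, Determined (below R) (· ∈ E u) := fun u => hE u ▸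
    ((hF z.2 u).mono (Set.singleton_subset_iff.mpr hb)).comp₂
      ((((determined_coin j).mono (Set.singleton_subset_iff.mpr (hcb j (by omega)))).comp
        fun g => g u = true).comp₂
      ((((determined_coin (j + 1)).mono
        (Set.singleton_subset_iff.mpr (hcb _ (by omega)))).comp fun g => g u = false).comp₂
      (((determined_coin (j + 2)).mono
        (Set.singleton_subset_iff.mpr (hcb _ (by omega)))).comp fun g => g u = false) And) And) And
  have hEm : ∀ u, MeasurableSet (E u) := fun u => (hdE u).measurableSet
  have hind : ∀ S ⊆ z.1, (law U k P.s p).real (B' ∩ {ω | ∀ u ∈ S, ω ∈ E u}) =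
      (law U k P.s p).real B' * q ^ S.card := by
    intro S _
    have h1 : B' ∩ {ω | ∀ u ∈ S, ω ∈ E u} = (((B' ∩ {ω | ∀ u ∈ S, ω ∈ F z.2 u}) ∩
        {ω | ∀ u ∈ S, ω.coin j u = true}) ∩ {ω | ∀ u ∈ S, ω.coin (j + 1) u = false}) ∩
        {ω | ∀ u ∈ S, ω.coin (j + 2) u = false} := by
      ext ω
      simp only [hE, Set.mem_inter_iff, Set.mem_ofPred_eq]
      grind
    have d1 : Determined (K ∪ {b}) (· ∈ B' ∩ {ω | ∀ u ∈ S, ω ∈ F z.2 u}) :=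
      (hdB'.mono Set.subset_union_left).comp₂ ((hdF S).mono Set.subset_union_right) And
    have d2 : Determined (K ∪ {b} ∪ {.coin j}) (· ∈ B' ∩ {ω | ∀ u ∈ S, ω ∈ F z.2 u} ∩
        {ω | ∀ u ∈ S, ω.coin j u = true}) := (d1.mono Set.subset_union_left).comp₂
      ((hdc j true S).mono (Set.subset_union_right (s := K ∪ {b}))) And
    have d3 : Determined (K ∪ {b} ∪ {.coin j} ∪ {.coin (j + 1)})
        (· ∈ B' ∩ {ω | ∀ u ∈ S, ω ∈ F z.2 u} ∩ {ω | ∀ u ∈ S, ω.coin j u = true} ∩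
          {ω | ∀ u ∈ S, ω.coin (j + 1) u = false}) := (d2.mono Set.subset_union_left).comp₂
      ((hdc (j + 1) false S).mono (Set.subset_union_right (s := K ∪ {b} ∪ {.coin j}))) And
    have s0 : K ∪ {b} ⊆ below R := Set.union_subset hK (Set.singleton_subset_iff.mpr hb)
    have s1 : K ∪ {b} ∪ {.coin j} ⊆ below R :=
      Set.union_subset s0 (Set.singleton_subset_iff.mpr (hcb j (by omega)))
    have s2 : K ∪ {b} ∪ {.coin j} ∪ {.coin (j + 1)} ⊆ below R :=
      Set.union_subset s1 (Set.singleton_subset_iff.mpr (hcb _ (by omega)))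
    have n1 : ∀ i, j ≤ i → Block.coin i ∉ K ∪ {b} := fun i hi h =>
      h.elim (hcK i hi) fun h => hbc i (Set.mem_singleton_iff.mp h).symm
    rw [h1, Determined.indep d3 (hdc (j + 2) false S) (Set.disjoint_singleton_right.mpr ?_) s2
        (Set.singleton_subset_iff.mpr (hcb _ le_rfl)),
      Determined.indep d2 (hdc (j + 1) false S) (Set.disjoint_singleton_right.mpr ?_) s1
        (Set.singleton_subset_iff.mpr (hcb _ (by omega))),
      Determined.indep d1 (hdc j true S) (Set.disjoint_singleton_right.mpr (n1 j le_rfl)) s0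
        (Set.singleton_subset_iff.mpr (hcb _ (by omega))),
      Determined.indep hdB' (hdF S) (Set.disjoint_singleton_right.mpr hbK) hK
        (Set.singleton_subset_iff.mpr hb), hF', law_real_coin, law_real_coin, law_real_coin, hq]
    · simp only [if_true, Bool.false_eq_true, if_false, div_pow, mul_pow, one_pow,
        ← pow_mul, mul_comm 2 S.card]
      ring
    · rintro (h | h)
      · exact n1 (j + 1) (by omega) h
      · simp at h
    · rintro ((h | h) | h)
      · exact n1 (j + 2) (by omega) h
      · simp at h
      · simp at h
  have hH : MeasurableSet {ω | ((z.1.filter (ω ∈ E ·)).card : ℝ) < h} := by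
    refine Determined.measurableSet (R := R) ?_
    intro ω ω' hω
    have h1 : z.1.filter (ω ∈ E ·) = z.1.filter (ω' ∈ E ·) :=
      Finset.filter_congr fun u _ => Iff.of_eq (hdE u ω ω' hω)
    change (((z.1.filter (ω ∈ E ·)).card : ℝ) < h) = (((z.1.filter (ω' ∈ E ·)).card : ℝ) < h)
    rw [h1]
  have hhalf : Real.exp (-1) < 1 / 2 := by
    have := Real.exp_neg_one_lt_d9
    linarith
  have key := measureReal_inter_le_of_exp (μ := law U k P.s p) z.1 hEm hind
    (x := -1) (y := -h) hH (fun ω hω => by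
      have : ((z.1.filter (ω ∈ E ·)).card : ℝ) < h := hω
      linarith) (by nlinarith [Real.exp_pos (-1)])
  obtain hne | ⟨ω₀, hω₀⟩ := B'.eq_empty_or_nonempty
  · rw [Set.inter_right_comm, ← hB', hne]
    simp
  have hz : m ≤ z.1.card := by
    have := hm ω₀
    rwa [show V ω₀ = z.1 from congrArg Prod.fst hω₀.2] at this
  refine le_trans (measureReal_mono ?_) (key.trans ?_)
  · rintro ω ⟨⟨h1, h2⟩, h3⟩
    refine ⟨⟨h1, h3⟩, show ((z.1.filter (ω ∈ E ·)).card : ℝ) < h from lt_of_le_of_lt ?_ h2⟩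
    have hV' : V ω = z.1 := congrArg Prod.fst h3
    have hZ' : Z ω = z.2 := congrArg Prod.snd h3
    refine Nat.cast_le.mpr (Finset.card_le_card fun u hu => ?_)
    obtain ⟨hu, h4⟩ := Finset.mem_filter.mp hu
    rw [hE] at h4
    obtain ⟨h4, h5, h6, h7⟩ := h4
    exact Finset.mem_filter.mpr ⟨Finset.mem_univ u, hst ω u (hV' ▸ hu) (hZ' ▸ h4) h5 h6 h7⟩
  · refine mul_le_mul_of_nonneg_left (Real.exp_le_exp.mpr ?_) measureReal_nonneg
    have h1 : m * q ≤ z.1.card * q := mul_le_mul_of_nonneg_right hz hq0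
    have h2 : 0 ≤ (z.1.card : ℝ) * q := by positivity
    nlinarith

/-- The blocks of bits that have been used before cycle `ℓ - M - 1`, if there is such a cycle. -/
def old (T M ℓ : ℕ) : Set Block :=
  {b | M + 2 ≤ ℓ ∧ b ∈ used T ((ℓ - (M + 2)) * T) ((ℓ - (M + 2)) * T)}

lemma old_subset_past {T M ℓ : ℕ} : old T M ℓ ⊆ past T M ℓ := by
  have key : ∀ j, M + 2 ≤ ℓ → j * T < (ℓ - (M + 2)) * T + T → j + M + 2 ≤ ℓ := by
    intro j h h'
    have h1 : j * T < (ℓ - (M + 2) + 1) * T := by rw [add_mul, one_mul]; exact h'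
    have := lt_of_mul_lt_mul_right h1 (Nat.zero_le T)
    omega
  rintro (_ | j | j | j) ⟨h, hb⟩
  · exact h
  · have := key j h hb
    change j ≤ ℓ
    omega
  · exact key j h hb
  · change j + (M + 2) * T ≤ ℓ * T
    have h1 : j ≤ (ℓ - (M + 2)) * T := hb
    have h2 : (ℓ - (M + 2)) * T + (M + 2) * T = ℓ * T := by
      rw [← add_mul, Nat.sub_add_cancel h]
    omega

omit [NeZero k] in
lemma determined_present {I : Set Block} {a b : ℕ} (hI : view P.T P.t b ⊆ I) :
    Determined I (present A a b) := by
  intro ω ω' h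
  have h1 : ∀ r ≤ b, A.nodes r ω = A.nodes r ω' := fun r hr =>
    determined_nodes ((view_mono hr).trans hI) ω ω' h
  ext w
  simp only [present, Finset.mem_filter, Finset.mem_univ, true_and]
  exact forall_congr' fun r => forall_congr' fun _ => forall_congr' fun hr => by rw [h1 r hr]

/-- It is unlikely that few nodes stay in a committee. From cycle `3` on, the nodes are counted that
move to the committee at the start of cycle `ℓ - 2` and stay at the next two starts; in the first
two cycles, those that are in it from the bootstrap phase on. -/
lemma law_real_core_lt_of_old (hT : 0 < P.T) (ht : (P.M + 3) * P.T ≤ P.t) (hM : 2 ≤ P.M)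
    {J : ℕ} (hJ : J * P.ε ≤ 1 / 2) (hJτ : 4 * P.T ≤ J * P.τ) {ℓ : ℕ} (hℓ : 1 ≤ ℓ)
    {B : Set (Bits U k P.s)} (hB : Determined (old P.T P.M ℓ) (· ∈ B)) (C : Committee k) (h : ℝ) :
    (law U k P.s p).real (B ∩ {ω | (core A ω ℓ C : ℝ) < h}) ≤
      (law U k P.s p).real B *
        Real.exp (h - P.n / 2 * (p * (1 - p) ^ 2 / (k * 2 ^ k)) / 2) := by
  classical
  have ht2 : 2 * P.T ≤ P.t := le_trans (Nat.mul_le_mul_right _ (by omega)) ht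
  have ht5 : 5 * P.T ≤ P.t := le_trans (Nat.mul_le_mul_right _ (by omega)) ht
  by_cases hℓ2 : ℓ ≤ 2
  · have hℓT : ℓ * P.T ≤ 2 * P.T := Nat.mul_le_mul_right _ hℓ2
    -- The adversary knows nothing yet.
    have hv : view P.T P.t (ℓ * P.T) ⊆ ∅ := fun b hb => by
      change blockRound P.T b + P.t ≤ ℓ * P.T at hb
      omega
    have ho : old P.T P.M ℓ ⊆ ∅ := fun b hb => by
      have := hb.1
      omega
    refine law_real_core_lt (K := ∅) (b := .init) (R := 3) (j := 0)
      (Set.empty_subset _) trivial (Set.notMem_empty _) (by omega) (by simp) (by simp)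
      (hB.mono ho) (determined_present (A := A) (a := 0) hv) (Z := fun _ => ())
      (determined_const _ _)
      (F := fun _ u => {ω | ω.init u = C})
      (fun _ u => determined_init.comp fun g => g u = C) ?_ ?_ ?_
    · exact fun _ S => law_real_init S fun _ => C
    · intro ω w hw hp _ hc₁ hc₂
      have hw' := (Finset.mem_filter.mp hw).2
      obtain rfl | rfl : ℓ = 1 ∨ ℓ = 2 := by omega
      · exact stays_one hT hM (fun r hr => hw' r (Nat.zero_le r) (by omega)) hp hc₁
      · refine stays_of_age_zero (j := 0) hT hM (fun r _ hr => hw' r (Nat.zero_le r) (by omega))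
          ?_ ?_ ?_ hc₁ hc₂
        · rw [zero_mul]; exact not_isNew_zero
        · rw [zero_mul]; rfl
        · rw [zero_mul]; exact hp
    · exact fun ω => le_card_present (by omega) hJ
  · obtain ⟨j, rfl⟩ : ∃ j, ℓ = j + 3 := ⟨ℓ - 3, by omega⟩
    have e1 : (j + 1) * P.T = j * P.T + P.T := by ring
    have e3 : (j + 3) * P.T = j * P.T + 3 * P.T := by ring
    have hvp := view_subset_past (M := P.M) (ℓ := j + 3) hT ht le_rfl
    have hvb : view P.T P.t ((j + 3) * P.T) ⊆ below ((j + 3) * P.T + 3) :=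
      (view_subset_used hT ht2).trans ((used_subset_below hT).trans (below_mono (by omega)))
    have hub : used P.T (j * P.T) (j * P.T) ⊆ below ((j + 3) * P.T + 3) :=
      (used_subset_below hT).trans (below_mono (by omega))
    have hjT := Nat.le_mul_of_pos_right (j + 3) hT
    have ho : old P.T P.M (j + 3) ⊆
        view P.T P.t ((j + 3) * P.T) ∪ used P.T (j * P.T) (j * P.T) := fun b hb => by
      have h1 : (j + 3 - (P.M + 2)) * P.T ≤ j * P.T := Nat.mul_le_mul_right _ (by omega)
      exact .inr (used_mono h1 h1 hb.2)
    refine law_real_core_lt (K := view P.T P.t ((j + 3) * P.T) ∪ used P.T (j * P.T) (j * P.T))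
      (b := .own (j + 1)) (R := (j + 3) * P.T + 3) (j := j + 1)
      (Set.union_subset hvb hub) ?_ ?_ (by omega) (by simp) ?_ (hB.mono ho)
      (determined_present (A := A) (a := j * P.T - 1) (b := (j + 3) * P.T) Set.subset_union_left)
      ((determined_pos (A := A) hT ht2 (j * P.T)).mono Set.subset_union_right)
      (F := fun π u => {ω | ω.own (j + 1) u = tokenTo (π u) C})
      (fun π u => (determined_own _).comp fun g => g u = tokenTo (π u) C) ?_ ?_ ?_
    · change j + 1 < (j + 3) * P.T + 3
      omega
    · rintro (h1 | h1)
      · have h2 : j + 1 + P.M + 2 ≤ j + 3 := hvp h1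
        omega
      · have h2 : (j + 1) * P.T < j * P.T + P.T := h1
        omega
    · rintro i hi (h1 | h1)
      · have h2 : (i - 1) * P.T + 1 + P.t ≤ (j + 3) * P.T := h1
        have h3 : j * P.T ≤ (i - 1) * P.T := Nat.mul_le_mul_right _ (by omega)
        omega
      · have h2 : i * P.T < j * P.T + P.T := h1
        have h3 : (j + 1) * P.T ≤ i * P.T := Nat.mul_le_mul_right _ hi
        omega
    · exact fun π S => law_real_own (j + 1) S fun u => tokenTo (π u) C
    · intro ω w hw hp hc₀ hc₁ hc₂
      have hw' := (Finset.mem_filter.mp hw).2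
      have hn : ¬ IsNew A ω (j * P.T) w := fun h => h.2.2 (hw' _ le_rfl (by omega))
      have hw₀ : ∀ r, j * P.T ≤ r → r ≤ j * P.T + P.T → w ∈ A.nodes r ω :=
        fun r h h' => hw' r (by omega) (by omega)
      obtain ⟨h1, h2⟩ := moves_cycle hT hw₀ hn hc₀
      refine stays_of_age_zero (j := j + 1) hT hM (fun r h h' => hw' r (by omega) h') ?_ h1 ?_
        hc₁ hc₂
      · rw [e1]
        exact not_isNew_of_present hw₀ hn (by omega) le_rfl
      · rw [h2]
        exact (dst_eq_iff _ _ _).mpr hp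
    · exact fun ω => le_card_present (by omega) hJ

end Bounds

/-! ### Induction over the cycles -/

section Cycles

variable {P : Params} {U : Type} [Fintype U] [DecidableEq U] {k : ℕ} [NeZero k]
  {A : Adversary P U k} {p : unitInterval}

/-- In cycle `ℓ`, every committee keeps enough members, and the ideal process assigns at most `d`
nodes to each committee. -/
def GoodCycle (A : Adversary P U k) (d : ℝ) (ℓ : ℕ) (ω : Bits U k P.s) : Prop :=
  Lively A ω ℓ ∧ ∀ r, (ℓ - 1) * P.T < r → r ≤ ℓ * P.T → ∀ C, (load A ω r C : ℝ) ≤ d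

/-- The probability that the ideal process goes wrong in a cycle, by a union bound over the
committees and the rounds. -/
def failureBound (P : Params) (k : ℕ) (p : unitInterval) (d : ℝ) : ℝ :=
  k * 2 ^ k * (Real.exp (P.a * Real.log P.n - P.n / 2 * (p * (1 - p) ^ 2 / (k * 2 ^ k)) / 2) +
    P.T * Real.exp (P.f * P.n / (k * 2 ^ k) - d / 2))

lemma law_real_not_lively_le (hT : 0 < P.T) (ht : (P.M + 3) * P.T ≤ P.t) (hM : 2 ≤ P.M)
    {J : ℕ} (hJ : J * P.ε ≤ 1 / 2) (hJτ : 4 * P.T ≤ J * P.τ) {ℓ : ℕ} (hℓ : 1 ≤ ℓ)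
    {B : Set (Bits U k P.s)} (hB : Determined (old P.T P.M ℓ) (· ∈ B)) :
    (law U k P.s p).real (B ∩ {ω | ¬ Lively A ω ℓ}) ≤ (law U k P.s p).real B * (k * 2 ^ k *
      Real.exp (P.a * Real.log P.n - P.n / 2 * (p * (1 - p) ^ 2 / (k * 2 ^ k)) / 2)) := by
  have h1 : B ∩ {ω | ¬ Lively A ω ℓ} ⊆
      ⋃ C, B ∩ {ω | (core A ω ℓ C : ℝ) < P.a * Real.log P.n} := by
    rintro ω ⟨hω, h⟩
    simp only [Set.mem_ofPred_eq, Lively, not_forall, not_le] at h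
    obtain ⟨C, hC⟩ := h
    exact Set.mem_iUnion.mpr ⟨C, hω, hC⟩
  refine (measureReal_mono h1).trans ((measureReal_iUnion_fintype_le _).trans
    ((Finset.sum_le_sum fun C _ => law_real_core_lt_of_old hT ht hM hJ hJτ hℓ hB C _).trans
    (le_of_eq ?_)))
  rw [Finset.sum_const, nsmul_eq_mul, Finset.card_univ, card_committee]
  ring

lemma law_real_overload_le (hT : 0 < P.T) (ht : (P.M + 3) * P.T ≤ P.t) (hM : 2 ≤ P.M) {ℓ r : ℕ}
    (h₀ : ℓ * P.T < r + P.T) (h₁ : r ≤ ℓ * P.T) {B : Set (Bits U k P.s)}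
    (hB : Determined (past P.T P.M ℓ) (· ∈ B)) {d : ℝ} (hd : 0 ≤ d) :
    (law U k P.s p).real (B ∩ {ω | ¬ ∀ C, (load A ω r C : ℝ) ≤ d}) ≤
      (law U k P.s p).real B * (k * 2 ^ k * Real.exp (P.f * P.n / (k * 2 ^ k) - d / 2)) := by
  have h1 : B ∩ {ω | ¬ ∀ C, (load A ω r C : ℝ) ≤ d} ⊆ ⋃ C, B ∩ {ω | d < load A ω r C} := by
    rintro ω ⟨hω, h⟩
    simp only [Set.mem_ofPred_eq, not_forall, not_le] at h
    obtain ⟨C, hC⟩ := h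
    exact Set.mem_iUnion.mpr ⟨C, hω, hC⟩
  refine (measureReal_mono h1).trans ((measureReal_iUnion_fintype_le _).trans
    ((Finset.sum_le_sum fun C _ => law_real_load_le hT ht hM h₀ h₁ hB C hd).trans
    (le_of_eq ?_)))
  rw [Finset.sum_const, nsmul_eq_mul, Finset.card_univ, card_committee]
  ring

/-- Given what happened before cycle `ℓ - M - 1`, it is unlikely that cycle `ℓ` fails to be good. -/
lemma law_real_not_goodCycle_le (hT : 0 < P.T) (ht : (P.M + 3) * P.T ≤ P.t) (hM : 2 ≤ P.M)
    {J : ℕ} (hJ : J * P.ε ≤ 1 / 2) (hJτ : 4 * P.T ≤ J * P.τ) {d : ℝ} (hd : 0 ≤ d)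
    {ℓ : ℕ} (hℓ : 1 ≤ ℓ) {B : Set (Bits U k P.s)} (hB : Determined (old P.T P.M ℓ) (· ∈ B)) :
    (law U k P.s p).real (B ∩ {ω | ¬ GoodCycle A d ℓ ω}) ≤
      (law U k P.s p).real B * failureBound P k p d := by
  have h1 : B ∩ {ω | ¬ GoodCycle A d ℓ ω} ⊆ (B ∩ {ω | ¬ Lively A ω ℓ}) ∪
      ⋃ r ∈ Finset.Ioc ((ℓ - 1) * P.T) (ℓ * P.T), B ∩ {ω | ¬ ∀ C, (load A ω r C : ℝ) ≤ d} := by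
    rintro ω ⟨hω, h⟩
    by_cases hl : Lively A ω ℓ
    · have h2 : ¬ ∀ r, (ℓ - 1) * P.T < r → r ≤ ℓ * P.T → ∀ C, (load A ω r C : ℝ) ≤ d :=
        fun h2 => h ⟨hl, h2⟩
      push Not at h2
      obtain ⟨r, hr, hr', C, hC⟩ := h2
      refine .inr (Set.mem_biUnion (Finset.mem_coe.mpr (Finset.mem_Ioc.mpr ⟨hr, hr'⟩)) ⟨hω, ?_⟩)
      exact fun h3 => absurd (h3 C) (not_le.mpr hC)
    · exact .inl ⟨hω, hl⟩
  have e1 : (ℓ - 1) * P.T + P.T = ℓ * P.T := by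
    rw [← Nat.succ_mul, Nat.succ_eq_add_one, Nat.sub_add_cancel hℓ]
  have h2 := (measureReal_mono (μ := law U k P.s p) h1).trans ((measureReal_union_le _ _).trans
    (add_le_add (law_real_not_lively_le hT ht hM hJ hJτ hℓ hB)
      ((measureReal_biUnion_finset_le _ _).trans (Finset.sum_le_sum fun r hr =>
        law_real_overload_le hT ht hM (by rw [Finset.mem_Ioc] at hr; omega)
          (Finset.mem_Ioc.mp hr).2 (hB.mono old_subset_past) hd))))
  rw [Finset.sum_const, Nat.card_Ioc, nsmul_eq_mul,
    show ℓ * P.T - (ℓ - 1) * P.T = P.T by omega] at h2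
  refine h2.trans (le_of_eq ?_)
  rw [failureBound]
  ring

/-- Spartan is in order until the start of cycle `ℓ`. There is no condition for `ℓ = 0`, so that the
bootstrap phase can play the role of cycle `0`. -/
def orderly (A : Adversary P U k) (ℓ : ℕ) : Set (Bits U k P.s) :=
  {ω | 1 ≤ ℓ → InOrder A ω ((ℓ - 1) * P.T)}

omit [Fintype U] in
lemma orderly_anti {ℓ ℓ' : ℕ} (h : ℓ' ≤ ℓ) : orderly A ℓ ⊆ orderly A ℓ' := fun _ hω hℓ' =>
  (hω (hℓ'.trans h)).mono (Nat.mul_le_mul_right _ (by omega))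

omit [Fintype U] in
lemma determined_orderly_old (hT : 0 < P.T) (ht : 2 * P.T ≤ P.t) (ℓ : ℕ) :
    Determined (old P.T P.M ℓ) (· ∈ orderly A (ℓ - (P.M + 1))) := by
  by_cases h : P.M + 2 ≤ ℓ
  · have h1 : 1 ≤ ℓ - (P.M + 1) := by omega
    have h2 : ℓ - (P.M + 1) - 1 = ℓ - (P.M + 2) := by omega
    have h3 := (determined_inOrder (A := A) hT ht ((ℓ - (P.M + 2)) * P.T)).2.mono
      (J := old P.T P.M ℓ) fun b hb => ⟨h, hb⟩
    simpa only [orderly, h1, h2, forall_const, Set.mem_ofPred_eq] using h3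
  · have h1 : ¬ 1 ≤ ℓ - (P.M + 1) := by omega
    simpa only [orderly, h1, Set.mem_ofPred_eq, false_imp_iff] using determined_const _ True

lemma measurableSet_orderly (hT : 0 < P.T) (ht : 2 * P.T ≤ P.t) (ℓ : ℕ) :
    MeasurableSet (orderly A ℓ) := by
  refine Determined.measurableSet (R := (ℓ - 1) * P.T + 1) ?_
  exact ((determined_inOrder hT ht _).2.mono (used_subset_below hT)).comp fun q => 1 ≤ ℓ → q

/-- At the end of the bootstrap phase, Spartan is in order with high probability. -/
lemma le_law_real_orderly_one (hT : 0 < P.T) (ht : (P.M + 3) * P.T ≤ P.t) (hM : 2 ≤ P.M)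
    (hk : 2 ≤ k) {J : ℕ} (hJ : J * P.ε ≤ 1 / 2) (hJτ : 4 * P.T ≤ J * P.τ) {d : ℝ} (hd : 0 ≤ d)
    (hΔ : 5 * d ≤ P.Δ) :
    1 - failureBound P k p d ≤ (law U k P.s p).real (orderly A 1) := by
  have h1 : (orderly A 1)ᶜ ⊆ (Set.univ ∩ {ω | ¬ Lively A ω 1}) ∪
      (Set.univ ∩ {ω | ¬ ∀ C, (load A ω 0 C : ℝ) ≤ d}) := by
    intro ω hω
    by_contra h
    simp only [Set.univ_inter, Set.mem_union, Set.mem_ofPred_eq, not_or, not_not] at h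
    refine hω fun _ => ?_
    rw [Nat.sub_self, zero_mul]
    exact inOrder_zero hk hΔ h.1 h.2
  have h2 := (measureReal_mono (μ := law U k P.s p) h1).trans ((measureReal_union_le _ _).trans
    (add_le_add
      (law_real_not_lively_le hT ht hM hJ hJτ le_rfl (B := Set.univ) (determined_const _ True))
      (law_real_overload_le hT ht hM (ℓ := 0) (r := 0) (by omega) (by omega) (B := Set.univ)
        (determined_const _ True) hd)))
  have h3 : (1 : ℝ) ≤ P.T := by exact_mod_cast hT
  have ht2 : 2 * P.T ≤ P.t := le_trans (Nat.mul_le_mul_right _ (by omega)) ht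
  rw [probReal_compl_eq_one_sub (measurableSet_orderly hT ht2 1), probReal_univ] at h2
  have h4 : 1 * ((k : ℝ) * 2 ^ k * Real.exp (P.f * P.n / (k * 2 ^ k) - d / 2)) ≤
      P.T * (k * 2 ^ k * Real.exp (P.f * P.n / (k * 2 ^ k) - d / 2)) :=
    mul_le_mul_of_nonneg_right h3 (by positivity)
  have h5 : failureBound P k p d = k * 2 ^ k *
      Real.exp (P.a * Real.log P.n - P.n / 2 * (p * (1 - p) ^ 2 / (k * 2 ^ k)) / 2) +
      P.T * (k * 2 ^ k * Real.exp (P.f * P.n / (k * 2 ^ k) - d / 2)) := by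
    rw [failureBound]; ring
  linarith

lemma mul_le_of_forall_mul_le {g : ℕ → ℝ} {c : ℝ} (hc₀ : 0 ≤ c) (hc₁ : c ≤ 1) (hg : ∀ j, 0 ≤ g j)
    {ℓ : ℕ} (h : ∀ j < ℓ, c * g j ≤ g (j + 1)) (i : ℕ) : c ^ i * g (ℓ - i) ≤ g ℓ := by
  induction i with
  | zero => simp
  | succ i ih =>
    refine le_trans ?_ ih
    rw [pow_succ, mul_assoc]
    refine mul_le_mul_of_nonneg_left ?_ (pow_nonneg hc₀ i)
    by_cases hi : i < ℓ
    · have h1 := h (ℓ - (i + 1)) (by omega)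
      rwa [show ℓ - (i + 1) + 1 = ℓ - i by omega] at h1
    · rw [show ℓ - (i + 1) = ℓ - i by omega]
      exact mul_le_of_le_one_left (hg _) hc₁

/-- With high probability, Spartan remains in order for another cycle, even if the event that it has
been in order so far is unlikely. A failure of cycle `ℓ` is compared with the event that Spartan is
in order until the start of cycle `ℓ - M - 1`, of which it is independent enough; by induction,
the latter event is at most twice as likely as the one until the start of cycle `ℓ`. -/
lemma law_real_orderly (hT : 0 < P.T) (ht : (P.M + 3) * P.T ≤ P.t) (hM : 2 ≤ P.M)
    (hk : 2 ≤ k) (ha : 0 < P.a * Real.log P.n) (hQ : (P.Δ + 1) * (1 + P.s * P.T) ≤ P.Q)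
    {J : ℕ} (hJ : J * P.ε ≤ 1 / 2) (hJτ : 4 * P.T ≤ J * P.τ) {d : ℝ} (hd : 0 ≤ d)
    (hΔ : 5 * d ≤ P.Δ) {δ : ℝ} (hδ₀ : 0 ≤ δ) (hδ : (P.M + 1) * δ ≤ 1 / 2)
    (hf : 2 * failureBound P k p d ≤ δ) (ℓ : ℕ) :
    (1 - δ) * (law U k P.s p).real (orderly A ℓ) ≤ (law U k P.s p).real (orderly A (ℓ + 1)) ∧
      (1 ≤ ℓ → (1 - δ) * (law U k P.s p).real (orderly A ℓ) ≤ (law U k P.s p).real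
        (orderly A ℓ ∩ {ω | Robust A ω (ℓ * P.T) ∧ Follows A ω ℓ fun r ω => pos A ω r})) := by
  set μ := law U k P.s p
  have ht2 : 2 * P.T ≤ P.t := le_trans (Nat.mul_le_mul_right _ (by omega)) ht
  have hfb : 0 ≤ failureBound P k p d := by unfold failureBound; positivity
  have hδ1 : δ ≤ 1 / 2 := by
    have : 0 ≤ (P.M : ℝ) * δ := by positivity
    linarith
  induction ℓ using Nat.strong_induction_on with
  | _ ℓ ih =>
  obtain rfl | hℓ : ℓ = 0 ∨ 1 ≤ ℓ := by omega
  · refine ⟨?_, fun h => absurd h (by omega)⟩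
    have h1 := le_law_real_orderly_one (A := A) (p := p) hT ht hM hk hJ hJτ hd hΔ
    have h2 : orderly A 0 = Set.univ := Set.eq_univ_of_forall fun ω h => absurd h (by omega)
    rw [h2, probReal_univ, mul_one]
    linarith
  have key : (1 - δ) * μ.real (orderly A ℓ) ≤
      μ.real (orderly A ℓ ∩ {ω | GoodCycle A d ℓ ω}) := by
    have h1 := mul_le_of_forall_mul_le (g := fun j => μ.real (orderly A j)) (c := 1 - δ)
      (by linarith) (by linarith) (fun j => measureReal_nonneg) (fun j hj => (ih j hj).1) (P.M + 1)
    have h2 : 1 / 2 ≤ (1 - δ) ^ (P.M + 1) := by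
      have := one_add_mul_le_pow (a := -δ) (by linarith) (P.M + 1)
      push_cast at this
      rw [← sub_eq_add_neg] at this
      linarith
    have h3 : 1 / 2 * μ.real (orderly A (ℓ - (P.M + 1))) ≤ μ.real (orderly A ℓ) :=
      (mul_le_mul_of_nonneg_right h2 measureReal_nonneg).trans h1
    have h4 : μ.real (orderly A ℓ ∩ {ω | ¬ GoodCycle A d ℓ ω}) ≤
        μ.real (orderly A (ℓ - (P.M + 1))) * failureBound P k p d :=
      (measureReal_mono (Set.inter_subset_inter_left _ (orderly_anti (Nat.sub_le _ _)))).trans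
        (law_real_not_goodCycle_le hT ht hM hJ hJτ hd hℓ (determined_orderly_old hT ht2 ℓ))
    have h5 : μ.real (orderly A ℓ) ≤ μ.real (orderly A ℓ ∩ {ω | GoodCycle A d ℓ ω}) +
        μ.real (orderly A ℓ ∩ {ω | ¬ GoodCycle A d ℓ ω}) := by
      refine le_trans (measureReal_mono fun ω hω => ?_) (measureReal_union_le _ _)
      by_cases h : GoodCycle A d ℓ ω
      · exact .inl ⟨hω, h⟩
      · exact .inr ⟨hω, h⟩
    have h6 : μ.real (orderly A (ℓ - (P.M + 1))) * failureBound P k p d ≤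
        (2 * μ.real (orderly A ℓ)) * failureBound P k p d :=
      mul_le_mul_of_nonneg_right (by linarith) hfb
    have h7 : μ.real (orderly A ℓ) * (2 * failureBound P k p d) ≤ μ.real (orderly A ℓ) * δ :=
      mul_le_mul_of_nonneg_left hf measureReal_nonneg
    linarith
  have hgood : ∀ ω ∈ orderly A ℓ ∩ {ω | GoodCycle A d ℓ ω},
      InOrder A ω (ℓ * P.T) ∧ Follows A ω ℓ fun r ω => pos A ω r := fun ω hω =>
    inOrder_of_lively hT hk ha hQ hΔ (hω.1 hℓ) hω.2.1 hω.2.2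
  refine ⟨key.trans (measureReal_mono fun ω hω _ => ?_),
    fun _ => key.trans (measureReal_mono fun ω hω => ⟨hω.1, (hgood ω hω).1.1, (hgood ω hω).2⟩)⟩
  rw [Nat.add_sub_cancel]
  exact (hgood ω hω).1

/-- The unconditional bound for the first `ℓ` cycles, by `(1 - δ) ^ ℓ ≥ 1 - ℓ δ`. -/
lemma one_sub_mul_le_law_real_orderly {δ : ℝ} (hδ₀ : 0 ≤ δ)
    (h : ∀ ℓ, (1 - δ) * (law U k P.s p).real (orderly A ℓ) ≤
      (law U k P.s p).real (orderly A (ℓ + 1))) (ℓ : ℕ) :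
    1 - ℓ * δ ≤ (law U k P.s p).real (orderly A ℓ) := by
  induction ℓ with
  | zero =>
    have h2 : orderly A 0 = Set.univ := Set.eq_univ_of_forall fun ω h => absurd h (by omega)
    simp [h2]
  | succ ℓ ih =>
    have h1 := h ℓ
    have h2 : (law U k P.s p).real (orderly A ℓ) ≤ 1 := measureReal_le_one
    push_cast
    nlinarith

lemma le_cond_real {Ω : Type*} [MeasurableSpace Ω] {μ : Measure Ω} [IsProbabilityMeasure μ]
    {B H : Set Ω} (hB : MeasurableSet B) (hpos : 0 < μ.real B) {x : ℝ}
    (h : x * μ.real B ≤ μ.real (B ∩ H)) : x ≤ (ProbabilityTheory.cond μ B).real H := by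
  rw [Measure.real, ProbabilityTheory.cond_apply hB, ENNReal.toReal_mul, ENNReal.toReal_inv,
    ← Measure.real, ← Measure.real, inv_mul_eq_div]
  exact (le_div_iff₀ hpos).mpr h

/-- The conclusions about the conditional probabilities, from a bound `δ` for the probability of a
failure in one cycle. -/
lemma cond_law_real (hT : 0 < P.T) (ht : (P.M + 3) * P.T ≤ P.t) (hM : 2 ≤ P.M)
    (hk : 2 ≤ k) (ha : 0 < P.a * Real.log P.n) (hQ : (P.Δ + 1) * (1 + P.s * P.T) ≤ P.Q)
    {J : ℕ} (hJ : J * P.ε ≤ 1 / 2) (hJτ : 4 * P.T ≤ J * P.τ) {d : ℝ} (hd : 0 ≤ d)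
    (hΔ : 5 * d ≤ P.Δ) {δ : ℝ} (hδ₀ : 0 ≤ δ) (hδ : (P.M + 1) * δ ≤ 1 / 2)
    (hf : 2 * failureBound P k p d ≤ δ) {ℓ : ℕ} (hℓ : 1 ≤ ℓ) :
    1 - δ ≤ (ProbabilityTheory.cond (law U k P.s p)
        {ω | Robust A ω ((ℓ - 1) * P.T) ∧ Placed A ω ((ℓ - 1) * P.T)}).real
        {ω | Robust A ω (ℓ * P.T) ∧ Follows A ω ℓ fun r ω => pos A ω r} ∧
      (ℓ * δ < 1 → 1 - (ℓ + 1) * δ ≤ (ProbabilityTheory.cond (law U k P.s p)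
        {ω | Robust A ω ((ℓ - 1) * P.T)}).real
        {ω | Robust A ω (ℓ * P.T) ∧ Follows A ω ℓ fun r ω => pos A ω r}) := by
  set μ := law U k P.s p
  have ht2 : 2 * P.T ≤ P.t := le_trans (Nat.mul_le_mul_right _ (by omega)) ht
  have hδ1 : δ ≤ 1 / 2 := by
    have : 0 ≤ (P.M : ℝ) * δ := by positivity
    linarith
  have main := law_real_orderly (A := A) (p := p) hT ht hM hk ha hQ hJ hJτ hd hΔ hδ₀ hδ hf
  have hord : {ω | Robust A ω ((ℓ - 1) * P.T) ∧ Placed A ω ((ℓ - 1) * P.T)} = orderly A ℓ := by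
    ext ω
    exact ⟨fun h _ => h, fun h => h hℓ⟩
  have hpos : ∀ j, 0 < μ.real (orderly A j) := fun j => by
    induction j with
    | zero =>
      have h2 : orderly A 0 = Set.univ := Set.eq_univ_of_forall fun ω h => absurd h (by omega)
      simp [h2]
    | succ j ih =>
      exact (mul_pos (by linarith) ih).trans_le (main j).1
  constructor
  · rw [hord]
    exact le_cond_real (measurableSet_orderly hT ht2 ℓ) (hpos ℓ) ((main ℓ).2 hℓ)
  · intro hℓδ
    have hsub : orderly A ℓ ⊆ {ω | Robust A ω ((ℓ - 1) * P.T)} := fun ω h => (h hℓ).1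
    have hm : MeasurableSet {ω | Robust A ω ((ℓ - 1) * P.T)} :=
      Determined.measurableSet
        ((determined_inOrder hT ht2 _).1.mono (used_subset_below hT))
    refine le_cond_real hm ((hpos ℓ).trans_le (measureReal_mono hsub)) ?_
    have h1 := one_sub_mul_le_law_real_orderly (p := p) (A := A) hδ₀ (fun j => (main j).1) ℓ
    have h2 := ((main ℓ).2 hℓ).trans (measureReal_mono (Set.inter_subset_inter_left _ hsub))
    have h3 : μ.real {ω | Robust A ω ((ℓ - 1) * P.T)} ≤ 1 := measureReal_le_one
    have h4 : (1 - δ) * (1 - ℓ * δ) ≤ (1 - δ) * μ.real (orderly A ℓ) :=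
      mul_le_mul_of_nonneg_left h1 (by linarith)
    have h5 : 0 ≤ (ℓ : ℝ) * δ * δ := by positivity
    obtain h6 | h6 := le_total 0 (1 - (ℓ + 1) * δ)
    · refine (mul_le_of_le_one_right h6 h3).trans (le_trans ?_ h2)
      nlinarith
    · exact (mul_nonpos_of_nonpos_of_nonneg h6 measureReal_nonneg).trans measureReal_nonneg

end Cycles

/-! ### Choice of the constants -/

/-- Both terms of the failure bound decay polynomially in `n`, with an exponent that is controlled
by the lower bound `K₁` on the average committee size and by the tolerated load. -/
lemma failureBound_le {P : Params} {k : ℕ} [NeZero k] {p : unitInterval} {c K₁ K₂ : ℝ}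
    (hf : 0 ≤ P.f) (hp : (p : ℝ) ≤ 1 / 2) (hn : 1 ≤ P.n) (hN : (k * 2 ^ k : ℝ) ≤ P.n)
    (hT : (P.T : ℝ) ≤ P.n) (h₁ : K₁ * Real.log P.n ≤ P.n / (k * 2 ^ k : ℝ))
    (h₂ : P.n / (k * 2 ^ k : ℝ) ≤ K₂ * Real.log P.n) (ha : P.a = p * K₁ / 32)
    (hK : 32 * (c + 2) ≤ p * K₁) :
    failureBound P k p (2 * (P.f * K₂ + c + 2) * Real.log P.n) ≤ 2 * (P.n : ℝ) ^ (-c) := by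
  have hk : (0 : ℝ) < k * 2 ^ k := by
    have : (0 : ℝ) < k := by exact_mod_cast Nat.pos_of_ne_zero (NeZero.ne k)
    positivity
  have hn' : (1 : ℝ) ≤ P.n := by exact_mod_cast hn
  have hn₀ : (0 : ℝ) < P.n := by linarith
  have hL : 0 ≤ Real.log P.n := Real.log_nonneg hn'
  have hp₀ : (0 : ℝ) ≤ p := p.2.1
  set N : ℝ := k * 2 ^ k
  set L := Real.log P.n
  have hpow : Real.exp (-(c + 2) * L) = (P.n : ℝ) ^ (-c) / P.n ^ 2 := by
    rw [← Real.rpow_natCast, ← Real.rpow_sub hn₀, Real.rpow_def_of_pos hn₀, mul_comm]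
    congr 1
    push_cast
    ring
  have e₁ : P.a * L - P.n / 2 * (p * (1 - p) ^ 2 / N) / 2 ≤ -(c + 2) * L := by
    have h3 : (1 : ℝ) / 4 ≤ (1 - p) ^ 2 := by nlinarith
    have h4 : p * (1 / 4) * (K₁ * L) ≤ p * (1 - p) ^ 2 * (P.n / N) :=
      (mul_le_mul_of_nonneg_left h₁ (by positivity)).trans
        (mul_le_mul_of_nonneg_right (mul_le_mul_of_nonneg_left h3 hp₀) (by positivity))
    have h5 : (P.n : ℝ) / 2 * (p * (1 - p) ^ 2 / N) / 2 = p * (1 - p) ^ 2 * (P.n / N) / 4 := by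
      ring
    have h6 := mul_le_mul_of_nonneg_right hK hL
    rw [h5, ha]
    linarith
  have e₂ : P.f * P.n / N - 2 * (P.f * K₂ + c + 2) * L / 2 ≤ -(c + 2) * L := by
    have h3 := mul_le_mul_of_nonneg_left h₂ hf
    rw [mul_div_assoc]
    linarith
  have hx : 0 ≤ (P.n : ℝ) ^ (-c) / P.n ^ 2 := by positivity
  calc failureBound P k p (2 * (P.f * K₂ + c + 2) * L)
      ≤ N * (Real.exp (-(c + 2) * L) + P.T * Real.exp (-(c + 2) * L)) := by
        unfold failureBound
        gcongr
    _ ≤ P.n * (P.n * ((P.n : ℝ) ^ (-c) / P.n ^ 2) + P.n * ((P.n : ℝ) ^ (-c) / P.n ^ 2)) := by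
        rw [hpow]
        gcongr
        exact le_mul_of_one_le_left hx hn'
    _ = 2 * (P.n : ℝ) ^ (-c) := by
        field_simp
        ring

open Filter in
/-- The conditions under which `n` is large enough for the other constants. -/
lemma eventually_large (M : ℕ) {K₁ K₂ b c : ℝ} (hK₁ : 0 < K₁) (hc : 0 < c) :
    ∀ᶠ n : ℕ in atTop, 4 ≤ n ∧ 1 ≤ Real.log n ∧ 1 ≤ Real.log (Real.log n) ∧
      1 ≤ K₁ * Real.log n ∧ b * Real.log (Real.log n) ≤ n ∧ 2 * (K₂ * Real.log n) < n ∧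
      (M + 1) * (n : ℝ) ^ (-c) ≤ 1 / 2 := by
  have hcast : Tendsto (fun n : ℕ => (n : ℝ)) atTop atTop := tendsto_natCast_atTop_atTop
  have hlog := Real.tendsto_log_atTop.comp hcast
  have hlog2 := Real.tendsto_log_atTop.comp hlog
  have h1 := ((Real.isLittleO_log_id_atTop.comp_tendsto hcast).const_mul_left (2 * K₂)).def
    (c := 1 / 2) (by norm_num)
  have h2 := (((Real.isLittleO_log_id_atTop.comp_tendsto hlog).trans
    (Real.isLittleO_log_id_atTop.comp_tendsto hcast)).const_mul_left b).def
    (c := 1) (by norm_num)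
  have h3 := ((tendsto_rpow_neg_atTop hc).comp hcast).const_mul ((M : ℝ) + 1)
  rw [mul_zero] at h3
  filter_upwards [eventually_ge_atTop 4, hlog.eventually_ge_atTop 1, hlog2.eventually_ge_atTop 1,
    (hlog.const_mul_atTop hK₁).eventually_ge_atTop 1, h1, h2,
    h3.eventually_le_const (show (0 : ℝ) < 1 / 2 by norm_num)] with n a1 a2 a3 a4 a5 a6 a7
  have hn : (0 : ℝ) < n := by exact_mod_cast (by omega : 0 < n)
  simp only [Function.comp_apply, Real.norm_eq_abs, id, abs_of_pos hn] at *
  refine ⟨a1, a2, a3, a4, by linarith [le_abs_self (b * Real.log (Real.log n))], ?_, a7⟩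
  linarith [le_abs_self (2 * K₂ * Real.log n)]

end

end Spartan

theorem mainTheorem3
    (f : ℝ) (hf : 1 ≤ f) (s M : ℕ) (hs : 1 ≤ s) (hM : 2 ≤ M)
    (p : unitInterval) (hp₀ : 0 < (p : ℝ)) (hp₁ : (p : ℝ) < 1 / 2)
    (b₁ b₂ b₃ : ℝ) (hb₁ : 0 < b₁) (hb₂ : b₁ ≤ b₂) (hb₃ : 0 < b₃) :
    ∃ ε : ℝ, 0 < ε ∧ ∀ c : ℝ, 0 < c → ∀ q : ℝ, 0 < q →
    ∃ K₀ : ℝ, 0 < K₀ ∧ ∀ K₁ K₂ : ℝ, K₀ ≤ K₁ → K₁ ≤ K₂ →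
    ∃ a D κ : ℝ, 0 < a ∧ 0 < D ∧ 0 < κ ∧ ∃ n₀ : ℕ, ∀ n : ℕ, n₀ ≤ n →
    ∀ (k : ℕ) [NeZero k],
      K₁ * Real.log n ≤ n / (k * 2 ^ k : ℝ) → n / (k * 2 ^ k : ℝ) ≤ K₂ * Real.log n →
    ∀ T τ t : ℕ,
      b₁ * Real.log (Real.log n) ≤ T → T ≤ b₂ * Real.log (Real.log n) →
      b₃ * Real.log (Real.log n) ≤ τ → (M + 3) * T ≤ t →
    ∀ P : Spartan.Params,
      P = { n := n, f := f, ε := ε, τ := τ, t := t, s := s, T := T, M := M,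
            Q := ⌈κ * (Real.log n * Real.log (Real.log n))⌉₊, Δ := ⌈D * Real.log n⌉₊, a := a } →
    ∀ (U : Type) [Fintype U] [DecidableEq U] (A : Spartan.Adversary P U k) (ℓ : ℕ), 1 ≤ ℓ →
    ∃ X : ℕ → Spartan.Bits U k P.s → U → Spartan.Committee k,
      Spartan.IsUniformPlacement P p ℓ X ∧
      1 - (n : ℝ) ^ (-c) ≤
        (ProbabilityTheory.cond (Spartan.law U k P.s p)
          {ω | Spartan.Robust A ω ((ℓ - 1) * T) ∧ Spartan.Placed A ω ((ℓ - 1) * T)}).real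
          {ω | Spartan.Robust A ω (ℓ * T) ∧ Spartan.Follows A ω ℓ X} ∧
      ((ℓ : ℝ) ≤ (n : ℝ) ^ q →
        1 - (n : ℝ) ^ (-c) ≤
          (ProbabilityTheory.cond (Spartan.law U k P.s p)
            {ω | Spartan.Robust A ω ((ℓ - 1) * T)}).real
            {ω | Spartan.Robust A ω (ℓ * T) ∧ Spartan.Follows A ω ℓ X}) := by
  -- `J` windows of length `τ` cover four cycles, and at most half of the nodes leave meanwhile.
  set J : ℕ := ⌈4 * b₂ / b₃⌉₊ with hJ
  have hb₂' : 0 < b₂ := hb₁.trans_le hb₂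
  have hJ₀ : (0 : ℝ) < J := by
    rw [Nat.cast_pos, hJ, Nat.ceil_pos]
    positivity
  refine ⟨1 / (2 * J), by positivity, fun c hc q hq => ?_⟩
  -- The failure probability of one cycle will be `n ^ (-(c + q + 1))`: the union bound over `n ^ q`
  -- cycles costs an exponent `q`. One more unit absorbs constant factors, and two more the union
  -- bound over at most `n` committees and at most `n` rounds.
  refine ⟨32 * (c + q + 4) / p, by positivity, fun K₁ K₂ hK₁ hK₂ => ?_⟩
  have hK : 32 * (c + q + 4) ≤ p * K₁ := by
    rwa [div_le_iff₀ hp₀, mul_comm K₁] at hK₁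
  have hK₁₀ : 0 < K₁ := lt_of_lt_of_le (by positivity) hK₁
  have hK₂₀ : 0 < K₂ := hK₁₀.trans_le hK₂
  have hf₀ : 0 < f := by linarith
  -- `D₀ * log n` is the tolerated load. A node sees at most five committees, so that it needs at
  -- most `5 * D₀ * log n` ports.
  set D₀ : ℝ := 2 * (f * K₂ + (c + q + 2) + 2) with hD₀
  have hD₀' : 0 < D₀ := by positivity
  obtain ⟨n₀, hn₀⟩ := Filter.eventually_atTop.mp (Spartan.eventually_large M (K₁ := K₁) (K₂ := K₂)
    (b := b₂) (c := c + q + 1) hK₁₀ (by positivity))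
  refine ⟨p * K₁ / 32, 5 * D₀, (5 * D₀ + 2) * (1 + s * b₂), by positivity, by positivity,
    by positivity, n₀, fun n hn k _ h₁ h₂ T τ t hT₁ hT₂ hτ ht P hP U _ _ A ℓ hℓ => ?_⟩
  obtain ⟨hn4, hL, hLL, hKL, hbn, hKn, hMn⟩ := hn₀ n hn
  subst hP
  have hn4' : (4 : ℝ) ≤ n := by exact_mod_cast hn4
  have hk₀ : 0 < k := Nat.pos_of_ne_zero (NeZero.ne k)
  have hN₀ : (0 : ℝ) < k * 2 ^ k := by positivity
  have hN : (k * 2 ^ k : ℝ) ≤ n := by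
    have := hKL.trans h₁
    rwa [one_le_div hN₀] at this
  have hT : 0 < T := by
    rw [← Nat.cast_pos (α := ℝ)]
    exact lt_of_lt_of_le (by positivity) hT₁
  have hk : 2 ≤ k := by
    by_contra hk
    obtain rfl : k = 1 := by omega
    norm_num at h₂
    linarith
  have hJτ : 4 * T ≤ J * τ := by
    rw [← Nat.cast_le (α := ℝ)]
    push_cast
    calc (4 : ℝ) * T ≤ 4 * (b₂ * Real.log (Real.log n)) := by gcongr
      _ = 4 * b₂ / b₃ * (b₃ * Real.log (Real.log n)) := by field_simp
      _ ≤ J * τ := by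
        gcongr
        exact Nat.le_ceil _
  have hQ : (⌈5 * D₀ * Real.log n⌉₊ + 1) * (1 + s * T) ≤
      ⌈(5 * D₀ + 2) * (1 + s * b₂) * (Real.log n * Real.log (Real.log n))⌉₊ := by
    rw [← Nat.cast_le (α := ℝ)]
    refine le_trans ?_ (Nat.le_ceil _)
    push_cast
    have h3 := Nat.ceil_lt_add_one (show 0 ≤ 5 * D₀ * Real.log n by positivity)
    calc ((⌈5 * D₀ * Real.log n⌉₊ : ℝ) + 1) * (1 + s * T)
        ≤ ((5 * D₀ + 2) * Real.log n) * ((1 + s * b₂) * Real.log (Real.log n)) := by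
          gcongr
          · linarith
          · nlinarith [mul_le_mul_of_nonneg_left hT₂ (Nat.cast_nonneg (α := ℝ) s)]
      _ = _ := by ring
  set δ : ℝ := (n : ℝ) ^ (-(c + q + 1)) with hδ
  have hδ₀ : 0 < δ := by positivity
  have hfail := Spartan.failureBound_le (k := k) (p := p) (c := c + q + 2) (K₁ := K₁) (K₂ := K₂)
    (P := { n := n, f := f, ε := 1 / (2 * J), τ := τ, t := t, s := s, T := T, M := M,
            Q := ⌈(5 * D₀ + 2) * (1 + s * b₂) * (Real.log n * Real.log (Real.log n))⌉₊,
            Δ := ⌈5 * D₀ * Real.log n⌉₊, a := p * K₁ / 32 })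
    hf₀.le hp₁.le (by dsimp only; omega) hN (hT₂.trans hbn) h₁ h₂ rfl (by linarith)
  have hnδ : (n : ℝ) ^ (-(c + q + 2)) ≤ δ / 4 := by
    have h3 : (n : ℝ) ^ (-(c + q + 2)) = δ / n := by
      rw [hδ, ← Real.rpow_sub_one (by positivity)]
      ring_nf
    rw [h3]
    gcongr
  have hmain := Spartan.cond_law_real (A := A) (p := p) (δ := δ) (J := J) (d := D₀ * Real.log n)
    hT ht hM hk (mul_pos (by positivity) (by linarith)) hQ (by field_simp; norm_num) hJτ
    (by positivity) (le_trans (by linarith) (Nat.le_ceil _)) hδ₀.le hMn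
    ((mul_le_mul_of_nonneg_left hfail zero_le_two).trans (by linarith)) hℓ
  refine ⟨fun r ω => Spartan.pos A ω r, Spartan.isUniformPlacement_pos hT ht hM ℓ, ?_,
    fun hℓq => ?_⟩
  · refine le_trans ?_ hmain.1
    rw [hδ]
    gcongr
    · linarith
    · linarith
  · have h3 : (n : ℝ) ^ q * δ = (n : ℝ) ^ (-c) / n := by
      rw [hδ, ← Real.rpow_add (by positivity), ← Real.rpow_sub_one (by positivity)]
      ring_nf
    have h4 : (n : ℝ) ^ (-c) ≤ 1 := Real.rpow_le_one_of_one_le_of_nonpos (by linarith) (by linarith)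
    have h5 : (n : ℝ) ^ (-c) / n ≤ (n : ℝ) ^ (-c) / 4 := by gcongr
    have h6 : ℓ * δ ≤ (n : ℝ) ^ q * δ := by gcongr
    have h7 : δ ≤ ℓ * δ := le_mul_of_one_le_left hδ₀.le (by exact_mod_cast hℓ)
    have h8 : 0 < (n : ℝ) ^ (-c) := by positivity
    refine le_trans ?_ (hmain.2 (by linarith))
    linarith
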